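/- Let $M$ be a smooth ($C^\infty$, Hausdorff, second countable, boundaryless) $3$-manifold, let $3\le k\le\infty$, and let $f_0,f_1:M\to M$ be $C^k$-diffeomorphisms. For $j=0,1$ suppose the following. (i) $p_j$ is a fixed point of $f_j$; in suitable $C^k$-coordinates around $p_j$ the map $f_j$ is linear, and $Df_j(p_j)$ has the eigenvalues $r_je^{\pm i\theta_j}$ and $\lambda_j$, where $r_j>1$, $\theta_j\notin\pi\mathbb Z$ and $0<\lambda_j<1$. Then there are linearizing coordinates $(z,t)$ at $p_j$, that is, $C^k$-coordinates centred at $p_j$ which map a neighbourhood $U(p_j)$ of $p_j$ onto a cylinder $\{(z,t)\in\mathbb C\times\mathbb R : |z|<a_j,\ |t|<a_j\}$ and in which $f_j$ is $(z,t)\mapsto(r_je^{i\theta_j}z,\lambda_jt)$; changing $z$ to $\bar z$ replaces $\theta_j$ by $-\theta_j$. Put $W^u_{\rm loc}(p_j)=\{t=0\}\subset U(p_j)$, which the coordinate $z$ identifies with the disk $\{|z|<a_j\}\subset\mathbb C$. (ii) $q_j\ne p_j$ is a homoclinic quadratic tangency of $p_j$: the curve $W^s(p_j)$ and the surface $W^u(p_j)$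 are tangent at $q_j$ with contact of order exactly two (if $g=0$, $dg\neq0$, is a local equation of the surface at $q_j$ and $\alpha$ a regular parametrization of the curve with $\alpha(0)=q_j$, then $(g\circ\alpha)'(0)=0\ne(g\circ\alpha)''(0)$). (iii) $q_j$ is positively associated with $p_j$: for all sufficiently large $n$, the point $f_j^n(q_j)$ and the set $f_j^{-n}(\alpha\setminus\{q_j\})$, for any sufficiently small (depending on $n$) regular curve $\alpha$ in $W^s(p_j)$ through $q_j$, lie in the same component of $U(p_j)\setminus W^u_{\rm loc}(p_j)$. Suppose moreover that $h:M\to M$ is a homeomorphism with $h\circ f_0=f_1\circ h$, $h(p_0)=p_1$ and $h(q_0)=q_1$, and that $\theta_0/2\pi$ is irrational. Then: (1) $\lambda_0=\lambda_1$ and $r_0=r_1$. (2) There are linearizing coordinates at $p_0$ and at $p_1$ in which $f_0$ and $f_1$ are $(z,t)\mapsto(r_0e^{i\theta_0}z,\lambda_0t)$ and $(z,t)\mapsto(r_1e^{i\theta_0}z,\lambda_1t)$ (the same angle $\theta_0$ for both maps). In any such coordinates, the restriction of $h$ to $W^u_{\rm loc}(p_0)$ is a linear conformal map: there are $\rho\in\mathbb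 R\setminus\{0\}$ and $\omega\in\mathbb R$ such that a point $x\in W^u_{\rm loc}(p_0)$ with coordinate $z$ is mapped into $W^u_{\rm loc}(p_1)$ if and only if $|\rho e^{i\omega}z|<a_1$, and then $h(x)$ has the coordinate $\rho e^{i\omega}z$. This restriction is uniquely determined: every homeomorphism $h':M\to M$ with $h'\circ f_0=f_1\circ h'$, $h'(p_0)=p_1$ and $h'(q_0)=q_1$ coincides with $h$ on $W^u_{\rm loc}(p_0)$. -/

import Mathlib

open scoped Manifold ContDiff Topology
open Set Filter

noncomputable section

namespace SaddleFocus

variable {M : Type*} [TopologicalSpace M] [ChartedSpace (EuclideanSpace ℝ (Fin 3)) M]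

/-- `φ` is a `C^k` coordinate system of the `3`-manifold `M`, defined on the open neighbourhood
`φ.source` of `p` and centred at `p`, in which `f` is given by the map `A`. -/
structure IsCoordFor (k : ℕ∞) (f : M ≃ₘ^k⟮𝓡 3, 𝓡 3⟯ M) (p : M)
    (φ : OpenPartialHomeomorph M (ℂ × ℝ)) (A : ℂ × ℝ → ℂ × ℝ) : Prop where
  mem_source : p ∈ φ.source
  map_base : φ p = 0
  contMDiffOn : ContMDiffOn (𝓡 3) 𝓘(ℝ, ℂ × ℝ) k φ φ.source
  contMDiffOn_symm : ContMDiffOn 𝓘(ℝ, ℂ × ℝ) (𝓡 3) k φ.symm φ.target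
  conj : ∀ x ∈ φ.source, f x ∈ φ.source → φ (f x) = A (φ x)

/-- `p` is a fixed point of `f`, the map `f` is linear in some `C^k` coordinates around `p`, and its
derivative at `p` (which is `A` in these coordinates) has the non-real eigenvalues
`r e^{iθ}`, `r e^{-iθ}` with `r > 1` and the real eigenvalue `0 < lam < 1`. -/
def IsLinearSaddleFocus (k : ℕ∞) (f : M ≃ₘ^k⟮𝓡 3, 𝓡 3⟯ M) (p : M) (r θ lam : ℝ) : Prop :=
  f p = p ∧ 1 < r ∧ (∀ n : ℤ, θ ≠ n * Real.pi) ∧ 0 < lam ∧ lam < 1 ∧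
  ∃ (φ : OpenPartialHomeomorph M (ℂ × ℝ)) (A : (ℂ × ℝ) →ₗ[ℝ] (ℂ × ℝ)),
    IsCoordFor k f p φ A ∧
    (A.charpoly.map (algebraMap ℝ ℂ)).roots =
      {(r : ℂ) * Complex.exp (θ * Complex.I), (r : ℂ) * Complex.exp (-(θ * Complex.I)), (lam : ℂ)}

/-- The linear map `(z, t) ↦ (r e^{iθ} z, lam t)`. -/
def normalForm (r θ lam : ℝ) (v : ℂ × ℝ) : ℂ × ℝ :=
  ((r : ℂ) * Complex.exp (θ * Complex.I) * v.1, lam * v.2)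

/-- Linearizing coordinates `(z, t)` of `f` at `p`: they map a neighbourhood `U(p) = φ.source` of `p`
onto the cylinder `|z| < a`, `|t| < a`, and `f` reads `(z, t) ↦ (r e^{iθ} z, lam t)`. -/
structure IsLinearizing (k : ℕ∞) (f : M ≃ₘ^k⟮𝓡 3, 𝓡 3⟯ M) (p : M) (r θ lam : ℝ)
    (φ : OpenPartialHomeomorph M (ℂ × ℝ)) (a : ℝ) : Prop
    extends IsCoordFor k f p φ (normalForm r θ lam) where
  pos : 0 < a
  target_eq : φ.target = Metric.ball (0 : ℂ) a ×ˢ Ioo (-a) a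

/-- The local unstable manifold `t = 0` in `U(p) = φ.source`, for linearizing coordinates `φ`. -/
def localUnstable (φ : OpenPartialHomeomorph M (ℂ × ℝ)) : Set M :=
  {x | x ∈ φ.source ∧ (φ x).2 = 0}

/-- `α` is a regular `C^k` curve in the stable manifold `W^s(p)` through `q`. The uniform convergence
of the forward iterates says that `α` is an arc in the immersed manifold `W^s(p)`, that is, that it is
mapped into the local stable manifold by some iterate of `f`. -/
def IsStableArc (k : ℕ∞) (f : M ≃ₘ^k⟮𝓡 3, 𝓡 3⟯ M) (p q : M) (α : ℝ → M) : Prop :=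
  α 0 = q ∧ mfderiv 𝓘(ℝ, ℝ) (𝓡 3) α 0 ≠ 0 ∧
  ∃ ε > 0, ContMDiffOn 𝓘(ℝ, ℝ) (𝓡 3) k α (Ioo (-ε) ε) ∧
    ∀ V ∈ 𝓝 p, ∀ᶠ n : ℕ in atTop, ∀ s ∈ Ioo (-ε) ε, f^[n] (α s) ∈ V

/-- `σ` is a regularly parametrized `C^k` disk in the unstable manifold `W^u(p)` through `q`. -/
def IsUnstableDisk (k : ℕ∞) (f : M ≃ₘ^k⟮𝓡 3, 𝓡 3⟯ M) (p q : M) (σ : ℂ → M) : Prop :=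
  σ 0 = q ∧ Function.Injective (mfderiv 𝓘(ℝ, ℂ) (𝓡 3) σ 0) ∧
  ∃ ε > 0, ContMDiffOn 𝓘(ℝ, ℂ) (𝓡 3) k σ (Metric.ball 0 ε) ∧
    ∀ V ∈ 𝓝 p, ∀ᶠ n : ℕ in atTop, ∀ w ∈ Metric.ball (0 : ℂ) ε, f.symm^[n] (σ w) ∈ V

/-- `q` is a homoclinic quadratic tangency of `p`: the curve `W^s(p)` and the surface `W^u(p)` are
tangent at `q ≠ p`, with contact of order exactly two. Here `g = 0` is a local equation of the surface
`W^u(p)` near `q`. -/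
def IsHomoclinicQuadraticTangency (k : ℕ∞) (f : M ≃ₘ^k⟮𝓡 3, 𝓡 3⟯ M) (p q : M) : Prop :=
  q ≠ p ∧ ∃ (α : ℝ → M) (σ : ℂ → M) (g : M → ℝ),
    IsStableArc k f p q α ∧ IsUnstableDisk k f p q σ ∧
    ContMDiffAt (𝓡 3) 𝓘(ℝ, ℝ) k g q ∧ mfderiv (𝓡 3) 𝓘(ℝ, ℝ) g q ≠ 0 ∧
    (∀ᶠ w in 𝓝 (0 : ℂ), g (σ w) = 0) ∧
    deriv (g ∘ α) 0 = 0 ∧ iteratedDeriv 2 (g ∘ α) 0 ≠ 0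

/-- `q` is positively associated with `p`: for all large `n`, the point `f^n(q)` and `f^{-n}(α)`, for
any small curve `α` in `W^s(p)` through `q`, lie in the same component of `U(p) \ W^u_loc(p)`. (The
tangency point itself is left out of `α`, since `f^{-n}(q)` lies on `W^u_loc(p)`.) -/
def IsPositivelyAssociated (k : ℕ∞) (f : M ≃ₘ^k⟮𝓡 3, 𝓡 3⟯ M) (p q : M) (r θ lam : ℝ) : Prop :=
  ∀ (φ : OpenPartialHomeomorph M (ℂ × ℝ)) (a : ℝ), IsLinearizing k f p r θ lam φ a →
    ∀ α : ℝ → M, IsStableArc k f p q α →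
      ∀ᶠ n : ℕ in atTop, ∀ᶠ s in 𝓝[≠] (0 : ℝ),
        f.symm^[n] (α s) ∈ connectedComponentIn (φ.source \ localUnstable φ) (f^[n] q)

/-- The homeomorphism `h` conjugates `f₀` to `f₁` and maps `p₀` to `p₁` and `q₀` to `q₁`. -/
def IsConjugacy {k : ℕ∞} (f₀ f₁ : M ≃ₘ^k⟮𝓡 3, 𝓡 3⟯ M) (p₀ p₁ q₀ q₁ : M) (h : M ≃ₜ M) : Prop :=
  (∀ x, h (f₀ x) = f₁ (h x)) ∧ h p₀ = p₁ ∧ h q₀ = q₁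

/-- In the coordinates `φ₀`, and `φ₁` (onto the cylinder of radius `a₁`), the map `h` between the local
unstable manifolds is `z ↦ ρ e^{iβ} z`, wherever the latter has its value in the disk `|z| < a₁`. -/
def IsLinearConformal (h : M → M) (φ₀ φ₁ : OpenPartialHomeomorph M (ℂ × ℝ)) (a₁ : ℝ) : Prop :=
  ∃ ρ β : ℝ, ρ ≠ 0 ∧ ∀ x ∈ localUnstable φ₀,
    (h x ∈ localUnstable φ₁ ↔ ‖(ρ : ℂ) * Complex.exp (β * Complex.I) * (φ₀ x).1‖ < a₁) ∧
    (h x ∈ localUnstable φ₁ →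
      (φ₁ (h x)).1 = (ρ : ℂ) * Complex.exp (β * Complex.I) * (φ₀ x).1)

end SaddleFocus

end

/-!
In linearizing coordinates `(z, t)` a point on the unstable disk near the homoclinic point can leave
along the homoclinic orbit, return to the axis `z = 0` near `t = t₀`, and be expanded by
`μ = r e^{iθ}` in the `z` direction. The unstable surface near `(0, t₀)` is tangent to the axis and, by
positive association, the axis lies on one side of it; so to first order it is the half plane
`dot ξ z ≤ 0`, folded along a curve through `(0, t₀)`. Its images under `fᵐ` therefore converge to half
planes of the unstable disk bounded by a line through `0`, with normal the limit of `ξ e^{imθ}`. A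
second excursion starts from a point at height of order `lamⁿ` over the homoclinic point, so that the
limits after `m` further steps are half planes `dot (ξ v) w ≤ τ` with `τ = lim rᵐ lamⁿ`; when `τ > 0`
the line does not pass through `0`. Both families are described by topological itineraries
(`FirstPassage`, `SecondPassage`), so a conjugacy maps those of `f₀` to those of `f₁`. Only this
one-sidedness of the tangency enters, and not the exact order of the contact.

Near `0` on the unstable disk the conjugacy extends, by the expansions, to a homeomorphism `Θ` of the
plane (`exists_plane`).

* One excursion: `Θ` maps the half plane with normal `lim ξ₀ e^{inθ₀}` onto that with normal
  `lim ξ₁ e^{inθ₁}`, so that either limit determines the other. As `θ₀/2π` is irrational this gives an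
  injective continuous endomorphism of the circle taking `e^{iθ₀}` to `e^{iθ₁}`, hence
  `θ₁ ≡ ±θ₀` modulo `2π` (`circle_eq_or_eq_inv`).
* In coordinates with the same angle, `Θ` maps every half plane bounded by a line through `0` to a
  rotated one, always by the same angle, so `Θ w` is a fixed unit complex number times a nonnegative
  multiple `ρ(w) w`. Two excursions give a line off `0` that is mapped to a parallel line up to this
  rotation; there `ρ` is constant. Comparing this line with its images under the expansions, which meet
  it and are dense in direction, gives `r₀ = r₁` and `ρ` constant (`linear_of_halfPlanes`). Finally
  `lim rᵐ lam₀ⁿ` and `lim rᵐ lam₁ⁿ` are both finite and positive along the same `m` and `n`, so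
  `lam₀ = lam₁`.
* The linear factor is determined by its value at a point of the orbit of the homoclinic point.
-/

namespace SaddleFocus

/-! ### Characters of the circle and irrational rotations -/

/-- The powers of `e^{iθ}` accumulate at every point of the circle when `θ / 2π` is irrational. -/
theorem mapClusterPt_circleExp_pow {θ : ℝ} (hθ : Irrational (θ / (2 * Real.pi))) (x : Circle) :
    MapClusterPt x atTop (fun n : ℕ => Circle.exp θ ^ n) := by
  have h1 : DenseRange (· • (θ : AddCircle (2 * Real.pi)) : ℤ → AddCircle (2 * Real.pi)) :=
    AddCircle.denseRange_zsmul_coe_iff.2 hθ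
  have h2 : DenseRange (fun n : ℤ => Circle.exp θ ^ n) := by
    have := AddCircle.homeomorphCircle'.surjective.denseRange.comp h1
      AddCircle.homeomorphCircle'.continuous
    convert this using 1
    funext n
    have : n • (θ : AddCircle (2 * Real.pi)) = ((n • θ : ℝ) : AddCircle (2 * Real.pi)) := rfl
    simp only [Function.comp]
    rw [this, AddCircle.homeomorphCircle'_apply_mk, Circle.exp_zsmul]
  exact ((mapClusterPt_atTop_pow_tfae x (Circle.exp θ)).out 0 3).2 (h2 x)

/-- A continuous character of the circle is a power map: one of its Fourier coefficients does not
vanish, and the invariance of the Haar measure then identifies the character. -/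
theorem exists_eq_zpow_of_continuous_hom (χ : Circle → Circle) (hc : Continuous χ)
    (hm : ∀ x y, χ (x * y) = χ x * χ y) : ∃ d : ℤ, ∀ x, χ x = x ^ d := by
  have : Fact (0 < 2 * Real.pi) := ⟨Real.two_pi_pos⟩
  let e : AddCircle (2 * Real.pi) → Circle := AddCircle.toCircle
  have hec : Continuous e := AddCircle.continuous_toCircle
  let f : C(AddCircle (2 * Real.pi), ℂ) := ⟨fun x => (χ (e x) : ℂ), by fun_prop⟩
  obtain ⟨d, hd⟩ : ∃ d : ℤ, fourierCoeff f d ≠ 0 := by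
    by_contra! h0
    have h1 : Summable (fourierCoeff f) := by
      have : fourierCoeff f = 0 := funext h0
      rw [this]; exact summable_zero
    have h2 := has_pointwise_sum_fourier_series_of_summable h1 0
    simp only [h0, zero_smul] at h2
    exact (χ (e 0)).coe_ne_zero (h2.unique hasSum_zero)
  refine ⟨d, fun x => ?_⟩
  obtain ⟨y, rfl⟩ : ∃ y, e y = x := by
    obtain ⟨y, hy⟩ := (AddCircle.homeomorphCircle Real.two_pi_pos.ne').surjective x
    exact ⟨y, by rw [← hy, AddCircle.homeomorphCircle_apply]⟩
  have hadd : ∀ s t, e (s + t) = e s * e t := AddCircle.toCircle_add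
  let ψ : AddCircle (2 * Real.pi) → ℂ := fun t => fourier (-d) t • f t
  have hψ : ∀ s t, ψ (s + t) = ψ t * ψ s := by
    intro s t
    simp only [ψ, f, ContinuousMap.coe_mk, hadd, hm, Circle.coe_mul, smul_eq_mul,
      fourier_apply, smul_add, AddCircle.toCircle_add]
    ring
  have hI : (∫ t, ψ t ∂AddCircle.haarAddCircle) * ψ y = ∫ t, ψ t ∂AddCircle.haarAddCircle := by
    rw [← MeasureTheory.integral_mul_const]
    simp_rw [← hψ]
    exact MeasureTheory.integral_add_left_eq_self ψ y
  have hI0 : (∫ t, ψ t ∂AddCircle.haarAddCircle) ≠ 0 := hd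
  have h1 : ψ y = 1 := mul_left_cancel₀ hI0 (by rw [hI, mul_one])
  have h2 : e ((-d) • y) * χ (e y) = 1 := by
    apply Circle.ext
    rw [Circle.coe_mul, Circle.coe_one]
    exact h1
  have h3 : e ((-d) • y) = e y ^ (-d) := AddCircle.toCircle_zsmul y (-d)
  rw [h3, zpow_neg] at h2
  exact (inv_mul_eq_one.1 h2).symm

/-- If the limits of the powers of `c₀` and of `c₁` along ultrafilters determine each other, then
`c₀ ↦ c₁` extends to an injective continuous character of the circle, so `c₁ = c₀` or
`c₁ = c₀⁻¹`. -/
theorem eq_or_eq_inv_of_limits_determined {c₀ c₁ : Circle}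
    (hd : ∀ x, MapClusterPt x atTop (fun n : ℕ => c₀ ^ n))
    (hE : ∀ U V : Ultrafilter ℕ, ↑U ≤ (atTop : Filter ℕ) → ↑V ≤ (atTop : Filter ℕ) →
      ∀ x x' y y', Tendsto (fun n : ℕ => c₀ ^ n) U (𝓝 x) → Tendsto (fun n : ℕ => c₀ ^ n) V (𝓝 x') →
        Tendsto (fun n : ℕ => c₁ ^ n) U (𝓝 y) → Tendsto (fun n : ℕ => c₁ ^ n) V (𝓝 y') →
        (x = x' ↔ y = y')) : c₁ = c₀ ∨ c₁ = c₀⁻¹ := by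
  have hlim : ∀ U : Ultrafilter ℕ, ∃ y, Tendsto (fun n : ℕ => c₁ ^ n) U (𝓝 y) := fun U =>
    ⟨(U.map fun n => c₁ ^ n).lim, (U.map fun n => c₁ ^ n).le_nhds_lim⟩
  have hex : ∀ x, ∃ y, ∃ U : Ultrafilter ℕ, ↑U ≤ (atTop : Filter ℕ) ∧
      Tendsto (fun n : ℕ => c₀ ^ n) U (𝓝 x) ∧ Tendsto (fun n : ℕ => c₁ ^ n) U (𝓝 y) := by
    intro x
    obtain ⟨U, hU, hUx⟩ := mapClusterPt_iff_ultrafilter.1 (hd x)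
    obtain ⟨y, hy⟩ := hlim U
    exact ⟨y, U, hU, hUx, hy⟩
  choose χ hχ using hex
  have huniq : ∀ V : Ultrafilter ℕ, ↑V ≤ (atTop : Filter ℕ) → ∀ x,
      Tendsto (fun n : ℕ => c₀ ^ n) V (𝓝 x) → Tendsto (fun n : ℕ => c₁ ^ n) V (𝓝 (χ x)) := by
    intro V hV x hx
    obtain ⟨y, hy⟩ := hlim V
    obtain ⟨U, hU, hUx, hUy⟩ := hχ x
    rwa [← (hE V U hV hU x x y (χ x) hx hUx hy hUy).1 rfl]
  have hinj : Function.Injective χ := by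
    intro x x' hxx
    obtain ⟨U, hU, hUx, hUy⟩ := hχ x
    obtain ⟨V, hV, hVx, hVy⟩ := hχ x'
    exact (hE U V hU hV x x' _ _ hUx hVx hUy hVy).2 hxx
  have hmul : ∀ x y, χ (x * y) = χ x * χ y := by
    intro x y
    obtain ⟨U, hU, hUx, hUy⟩ := hχ x
    obtain ⟨V, hV, hVx, hVy⟩ := hχ y
    let W : Ultrafilter (ℕ × ℕ) := Ultrafilter.of ((U : Filter ℕ) ×ˢ (V : Filter ℕ))
    have hW : (W : Filter (ℕ × ℕ)) ≤ (U : Filter ℕ) ×ˢ (V : Filter ℕ) :=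
      Ultrafilter.of_le _
    have h1 : Tendsto Prod.fst (W : Filter (ℕ × ℕ)) U := tendsto_fst.mono_left hW
    have h2 : Tendsto Prod.snd (W : Filter (ℕ × ℕ)) V := tendsto_snd.mono_left hW
    have ht : Tendsto (fun p : ℕ × ℕ => p.1 + p.2) (W : Filter (ℕ × ℕ)) atTop :=
      tendsto_atTop_mono (fun p => Nat.le_add_right p.1 p.2) (h1.mono_right hU)
    let S : Ultrafilter ℕ := W.map fun p : ℕ × ℕ => p.1 + p.2
    have hS : (S : Filter ℕ) ≤ atTop := ht
    have e0 : Tendsto (fun n : ℕ => c₀ ^ n) S (𝓝 (x * y)) := by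
      change Tendsto _ (Filter.map _ _) _
      rw [tendsto_map'_iff]
      simpa [Function.comp_def, pow_add] using (hUx.comp h1).mul (hVx.comp h2)
    have e1 : Tendsto (fun n : ℕ => c₁ ^ n) S (𝓝 (χ x * χ y)) := by
      change Tendsto _ (Filter.map _ _) _
      rw [tendsto_map'_iff]
      simpa [Function.comp_def, pow_add] using (hUy.comp h1).mul (hVy.comp h2)
    exact tendsto_nhds_unique (huniq S hS _ e0) e1
  have hcont : Continuous χ := by
    rw [continuous_iff_continuousAt]
    intro x
    by_contra hx
    obtain ⟨O, ⟨hO, hOc⟩, hxO⟩ : ∃ O : Set Circle, (O ∈ 𝓝 (χ x) ∧ IsClosed O) ∧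
        ¬ ∀ᶠ x' in 𝓝 x, χ x' ∈ O := by
      by_contra! h
      exact hx ((closed_nhds_basis (χ x)).tendsto_right_iff.2 fun O hO => h O hO)
    -- the powers `c₁ ^ n ∉ O` with `c₀ ^ n` near `x` give a limit point different from `χ x`
    have hfr : ∃ᶠ n in atTop ⊓ comap (fun n : ℕ => c₀ ^ n) (𝓝 x), c₁ ^ n ∉ O := by
      rw [((atTop_basis).inf ((nhds_basis_opens x).comap _)).frequently_iff]
      rintro ⟨N, B⟩ ⟨-, hxB, hB⟩
      have : ∃ᶠ x' in 𝓝 x, χ x' ∉ O := not_eventually.1 hxO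
      obtain ⟨x', hx'O, hx'B⟩ := (this.and_eventually (hB.mem_nhds hxB)).exists
      obtain ⟨U, hU, hUx, hUy⟩ := hχ x'
      have a1 : ∀ᶠ n in (U : Filter ℕ), N ≤ n := hU (eventually_ge_atTop N)
      have a2 : ∀ᶠ n in (U : Filter ℕ), c₀ ^ n ∈ B := hUx (hB.mem_nhds hx'B)
      have a3 : ∀ᶠ n in (U : Filter ℕ), c₁ ^ n ∈ Oᶜ := hUy (hOc.isOpen_compl.mem_nhds hx'O)
      obtain ⟨n, h1, h2, h3⟩ := (a1.and (a2.and a3)).exists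
      exact ⟨n, ⟨h1, h2⟩, h3⟩
    obtain ⟨V, hVle⟩ := exists_ultrafilter_iff.2 (frequently_iff_neBot.1 hfr)
    have hV := hVle.trans inf_le_left
    have hVO : ∀ᶠ n in (V : Filter ℕ), c₁ ^ n ∉ O := le_principal_iff.1 (hVle.trans inf_le_right)
    have b1 := huniq V (hV.trans inf_le_left) x (tendsto_iff_comap.2 (hV.trans inf_le_right))
    obtain ⟨n, h1, h2⟩ := (hVO.and (b1 hO)).exists
    exact h1 h2
  obtain ⟨d, hd'⟩ := exists_eq_zpow_of_continuous_hom χ hcont hmul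
  have h01 : c₁ = c₀ ^ d := by
    obtain ⟨U, hU, hUx⟩ := mapClusterPt_iff_ultrafilter.1 (hd c₀)
    obtain ⟨V, hV, hVx⟩ := mapClusterPt_iff_ultrafilter.1 (hd 1)
    have hsucc : Tendsto (fun n : ℕ => n + 1) (V : Filter ℕ) atTop :=
      (tendsto_add_atTop_nat 1).mono_left hV
    let S : Ultrafilter ℕ := V.map fun n : ℕ => n + 1
    have hS : (S : Filter ℕ) ≤ atTop := hsucc
    have e0 : Tendsto (fun n : ℕ => c₀ ^ n) S (𝓝 c₀) := by
      change Tendsto _ (Filter.map _ _) _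
      rw [tendsto_map'_iff]
      simpa [Function.comp_def, pow_succ] using hVx.mul_const c₀
    have e1 : Tendsto (fun n : ℕ => c₁ ^ n) S (𝓝 c₁) := by
      change Tendsto _ (Filter.map _ _) _
      rw [tendsto_map'_iff]
      simpa [Function.comp_def, pow_succ, hd'] using (huniq V hV 1 hVx).mul_const c₁
    rw [← hd']
    exact tendsto_nhds_unique e1 (huniq S hS _ e0)
  have hdinj : ∀ x : Circle, x ^ d = 1 → x = 1 := fun x hx =>
    hinj (by rw [hd', hd', hx, one_zpow])
  have hd0 : d ≠ 0 := by
    rintro rfl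
    exact Circle.exp_pi_ne_one (hdinj _ (zpow_zero _))
  have hx : Circle.exp (2 * Real.pi / d) = 1 := by
    apply hdinj
    rw [← Circle.exp_zsmul, zsmul_eq_mul, mul_div_cancel₀ _ (by exact_mod_cast hd0)]
    exact Circle.exp_two_pi
  obtain ⟨m, hm⟩ := Circle.exp_eq_one.1 hx
  have hunit : IsUnit d := by
    refine IsUnit.of_mul_eq_one m ?_
    have hd0' : (d : ℝ) ≠ 0 := by exact_mod_cast hd0
    have : (d : ℝ) * m = 1 := by
      have := Real.pi_pos.ne'
      field_simp at hm
      linarith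
    exact_mod_cast this
  rcases Int.isUnit_iff.1 hunit with rfl | rfl
  · left; simpa using h01
  · right; simpa using h01

/-! ### Half planes and planar homeomorphisms preserving them -/

/-- The Euclidean inner product of `ℂ = ℝ²`; the half planes of the argument are
`{w | dot ξ w ≤ τ}`. -/
def dot (ξ w : ℂ) : ℝ := ξ.re * w.re + ξ.im * w.im

theorem dot_add (ξ w w' : ℂ) : dot ξ (w + w') = dot ξ w + dot ξ w' := by
  simp [dot]; ring

theorem dot_real_mul (ξ w : ℂ) (s : ℝ) : dot ξ (s * w) = s * dot ξ w := by
  simp [dot]; ring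

theorem real_mul_dot (ξ w : ℂ) (s : ℝ) : dot (s * ξ) w = s * dot ξ w := by
  simp [dot]; ring

theorem dot_mul_conj (ξ u w : ℂ) : dot (ξ * u) w = dot ξ (starRingEnd ℂ u * w) := by
  simp [dot]; ring

theorem dot_mul_mul (c ξ w : ℂ) : dot (ξ * c) (c * w) = ‖c‖ ^ 2 * dot ξ w := by
  rw [← Complex.normSq_eq_norm_sq, Complex.normSq_apply]
  simp [dot]; ring

theorem dot_self (ξ : ℂ) : dot ξ ξ = ‖ξ‖ ^ 2 := by
  rw [← Complex.normSq_eq_norm_sq, Complex.normSq_apply]; rfl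

theorem dot_self_pos {ξ : ℂ} (h : ξ ≠ 0) : 0 < dot ξ ξ := by
  rw [dot_self]; positivity

theorem continuous_dot : Continuous fun p : ℂ × ℂ => dot p.1 p.2 := by
  unfold dot; fun_prop

@[fun_prop]
theorem continuous_dot_right (ξ : ℂ) : Continuous (dot ξ) := by
  unfold dot; fun_prop

theorem abs_dot_le (ξ w : ℂ) : |dot ξ w| ≤ ‖ξ‖ * ‖w‖ := by
  rw [← Complex.norm_conj ξ, ← norm_mul]
  convert Complex.abs_re_le_norm (starRingEnd ℂ ξ * w) using 2
  simp [dot]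

/-- A vector `b` lying in every closed half plane through `0` that contains `a` lies on the ray of
`a`. -/
theorem exists_nonneg_eq_mul {a b : ℂ} (ha : a ≠ 0) (h : ∀ n, dot n a ≤ 0 → dot n b ≤ 0) :
    ∃ s : ℝ, 0 ≤ s ∧ b = s * a := by
  have hpos := dot_self_pos ha
  have h1 := h (Complex.I * a) (by simp [dot]; linarith)
  have h2 := h (-(Complex.I * a)) (by simp [dot]; linarith)
  have h3 := h (-a) (by simp [dot] at hpos ⊢; linarith)
  simp only [dot, Complex.mul_re, Complex.mul_im, Complex.I_re, Complex.I_im, Complex.neg_re,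
    Complex.neg_im] at h1 h2 h3 hpos
  have h0 : a.re * b.im = a.im * b.re := by linarith
  refine ⟨(a.re * b.re + a.im * b.im) / (a.re * a.re + a.im * a.im),
    div_nonneg (by linarith) hpos.le, ?_⟩
  apply Complex.ext
  · rw [Complex.re_ofReal_mul, div_mul_eq_mul_div, eq_div_iff hpos.ne']
    linear_combination -a.im * h0
  · rw [Complex.im_ofReal_mul, div_mul_eq_mul_div, eq_div_iff hpos.ne']
    linear_combination a.re * h0

/-- A closed half plane through `0` determines its unit normal vector. -/
theorem eq_of_halfPlane_eq {a b : ℂ} (hab : ‖a‖ = ‖b‖) (ha : a ≠ 0)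
    (h : ∀ w, dot a w ≤ 0 → dot b w ≤ 0) : a = b := by
  have hsymm : ∀ x y, dot x y = dot y x := fun x y => by simp [dot]; ring
  obtain ⟨s, hs, rfl⟩ := exists_nonneg_eq_mul ha fun n hn => by
    rw [hsymm] at hn ⊢; exact h n hn
  rw [norm_mul, Complex.norm_real, Real.norm_of_nonneg hs] at hab
  have : s = 1 := by
    have := norm_pos_iff.2 ha
    nlinarith
  simp [this]

theorem exists_circle_dot_eq_zero (n : ℂ) {w : ℂ} (hw : w ≠ 0) :
    ∃ x : Circle, dot n (x * w) = 0 := by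
  by_cases hn : n = 0
  · exact ⟨1, by simp [hn, dot]⟩
  refine ⟨Circle.exp (Complex.arg (Complex.I * n / w)), ?_⟩
  have h1 := Complex.norm_mul_exp_arg_mul_I (Complex.I * n / w)
  have h2 : (‖Complex.I * n / w‖ : ℝ) * dot n (Circle.exp (Complex.arg (Complex.I * n / w)) * w)
      = 0 := by
    rw [← dot_real_mul, Circle.coe_exp, ← mul_assoc, h1, div_mul_cancel₀ _ hw]
    simp [dot]; ring
  have h3 : ‖Complex.I * n / w‖ ≠ 0 := by simp [hn, hw]
  exact (mul_eq_zero.1 h2).resolve_left h3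

/-- A continuous map `H` of the plane that conjugates `μ₀` to `μ₁` (similarities with the same angle),
preserves the pencil of half planes through `0` and maps one half plane with `0` in its interior to
another one is linear conformal. It is radial up to a rotation, hence conformal with a constant
factor on the boundary line `ℓ` of the last half plane. The lines `ℓ` and `μ₀ ℓ` meet, which forces
`μ₀ = μ₁`, and the lines `μ₀⁻ʲ ℓ` are dense. -/
theorem linear_of_halfPlanes {H : ℂ → ℂ} (hH : Continuous H) {μ₀ μ₁ ξ₀ ξ₁ : ℂ} {r : ℝ} {c v : Circle}
    {d₀ d₁ : ℝ} (hr : 1 < r) (hμ₀ : μ₀ = r * c) (hc : (c : ℂ).im ≠ 0)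
    (hdense : ∀ x, MapClusterPt x atTop (fun n : ℕ => c ^ n))
    (hξ₀ : ξ₀ ≠ 0) (hξ₁ : ξ₁ ≠ 0) (hconj : ∀ w, H (μ₀ * w) = μ₁ * H w) (hH0 : H 0 = 0)
    (hF : ∀ (u : Circle) (w : ℂ), dot (ξ₀ * u) w ≤ 0 ↔ dot (ξ₁ * u) (H w) ≤ 0)
    (hd₀ : 0 < d₀) (hd₁ : 0 < d₁)
    (hline : ∀ w, dot (ξ₀ * v) w ≤ d₀ ↔ dot (ξ₁ * v) (H w) ≤ d₁) :
    μ₀ = μ₁ ∧ ∃ L : ℂ, L ≠ 0 ∧ ∀ w, H w = L * w := by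
  -- `K` is `H` normalized so that it fixes every ray
  set ζ : ℂ := ξ₁ / ξ₀ with hζ
  have hζ0 : starRingEnd ℂ ζ ≠ 0 := by
    rw [Ne, map_eq_zero]; exact div_ne_zero hξ₁ hξ₀
  have hξ : ξ₁ = ξ₀ * ζ := by rw [hζ]; field_simp
  set K : ℂ → ℂ := fun w => starRingEnd ℂ ζ * H w with hK
  have hKc : Continuous K := by fun_prop
  have hdot : ∀ (u : Circle) w, dot (ξ₁ * u) (H w) = dot (ξ₀ * u) (K w) := by
    intro u w
    rw [hξ, mul_right_comm, dot_mul_conj]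
  have hray : ∀ n w, dot n w ≤ 0 → dot n (K w) ≤ 0 := by
    intro n w hn
    by_cases hn0 : n = 0
    · simp [hn0, dot]
    have h1 := Complex.norm_mul_exp_arg_mul_I (n / ξ₀)
    have h2 : n = (‖n / ξ₀‖ : ℝ) * (ξ₀ * Circle.exp (Complex.arg (n / ξ₀))) := by
      rw [Circle.coe_exp, mul_left_comm, h1]; field_simp
    have h3 : 0 < ‖n / ξ₀‖ := by
      have := div_ne_zero hn0 hξ₀
      positivity
    rw [h2, real_mul_dot] at hn ⊢
    rw [← hdot]
    have h4 := (hF _ w).1 (nonpos_of_mul_nonpos_right hn h3)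
    exact mul_nonpos_of_nonneg_of_nonpos h3.le h4
  have hKμ : ∀ w, K (μ₀ * w) = μ₁ * K w := by
    intro w; simp only [hK, hconj]; ring
  set n₀ : ℂ := ξ₀ * v with hn₀
  have hn₀0 : n₀ ≠ 0 := mul_ne_zero hξ₀ v.coe_ne_zero
  have hline' : ∀ w, dot n₀ w ≤ d₀ ↔ dot n₀ (K w) ≤ d₁ := fun w => by rw [hline, hdot]
  set κ : ℝ := d₁ / d₀ with hκ
  have hκ0 : 0 < κ := div_pos hd₁ hd₀
  have hℓ : ∀ w, dot n₀ w = d₀ → K w = κ * w := by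
    intro w hw
    have hw0 : w ≠ 0 := by
      rintro rfl
      simp [dot] at hw
      exact hd₀.ne hw
    obtain ⟨s, -, hs⟩ := exists_nonneg_eq_mul hw0 fun n hn => hray n w hn
    have h1 : dot n₀ (K w) ≤ d₁ := (hline' w).1 hw.le
    have h2 : d₁ ≤ dot n₀ (K w) := by
      have ht : Tendsto (fun t : ℝ => dot n₀ (K ((t : ℂ) * w))) (𝓝[>] 1) (𝓝 (dot n₀ (K w))) := by
        have hcont : Continuous fun t : ℝ => dot n₀ (K ((t : ℂ) * w)) := by fun_prop
        have := hcont.tendsto 1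
        simp only [Complex.ofReal_one, one_mul] at this
        exact this.mono_left nhdsWithin_le_nhds
      refine ge_of_tendsto ht (eventually_mem_nhdsWithin.mono fun t ht => ?_)
      by_contra! hlt
      have h3 := (hline' _).2 hlt.le
      rw [dot_real_mul, hw] at h3
      have ht' : 1 < t := ht
      nlinarith
    rw [hs, dot_real_mul, hw] at h1 h2
    rw [hs, hκ, (le_antisymm h1 h2 : s * d₀ = d₁).symm]
    congr 2
    field_simp
  have hr0 : (r : ℂ) ≠ 0 := by exact_mod_cast (zero_lt_one.trans hr).ne'
  have hμ0 : μ₀ ≠ 0 := by rw [hμ₀]; exact mul_ne_zero hr0 c.coe_ne_zero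
  -- a point common to `ℓ` and `μ₀⁻¹ ℓ`, on which `K` is the factor `κ` both before and after `μ₀`
  obtain ⟨p, hp1, hp2⟩ : ∃ p, dot n₀ p = d₀ ∧ dot n₀ (μ₀ * p) = d₀ := by
    set n₁ : ℂ := n₀ * starRingEnd ℂ μ₀ with hn₁
    have hD : n₀.re * n₁.im - n₀.im * n₁.re ≠ 0 := by
      have : n₀.re * n₁.im - n₀.im * n₁.re = -(dot n₀ n₀ * (r * (c : ℂ).im)) := by
        simp [hn₁, hμ₀, dot]; ring
      rw [this]
      exact neg_ne_zero.2 (mul_ne_zero (dot_self_pos hn₀0).ne'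
        (mul_ne_zero (zero_lt_one.trans hr).ne' hc))
    have e : ∀ p, dot n₀ (μ₀ * p) = dot n₁ p := fun p => by
      rw [hn₁, dot_mul_conj n₀, Complex.conj_conj]
    refine ⟨⟨(d₀ * n₁.im - d₀ * n₀.im) / (n₀.re * n₁.im - n₀.im * n₁.re),
      (n₀.re * d₀ - n₁.re * d₀) / (n₀.re * n₁.im - n₀.im * n₁.re)⟩, ?_, ?_⟩
    · simp only [dot]; field_simp; ring
    · rw [e]; simp only [dot]
      rw [mul_div_assoc', mul_div_assoc', ← add_div, div_eq_iff hD]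
      ring
  have hp0 : p ≠ 0 := by
    rintro rfl
    simp [dot] at hp1
    exact hd₀.ne hp1
  have hμ : μ₀ = μ₁ := by
    have h1 := hKμ p
    rw [hℓ _ hp1, hℓ _ hp2] at h1
    have h2 : (μ₀ - μ₁) * (κ * p) = 0 := by linear_combination h1
    have h3 : (κ : ℂ) * p ≠ 0 := mul_ne_zero (by exact_mod_cast hκ0.ne') hp0
    exact sub_eq_zero.1 ((mul_eq_zero.1 h2).resolve_right h3)
  refine ⟨hμ, κ / starRingEnd ℂ ζ, div_ne_zero (by exact_mod_cast hκ0.ne') hζ0, ?_⟩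
  have hiter : ∀ (j : ℕ) w, dot n₀ (μ₀ ^ j * w) = d₀ → K w = κ * w := by
    intro j
    have h1 : ∀ w, K (μ₀ ^ j * w) = μ₀ ^ j * K w := by
      induction j with
      | zero => simp
      | succ j ih =>
        intro w
        rw [pow_succ', mul_assoc, hKμ, ih, ← hμ, mul_assoc]
    intro w hw
    have h2 := hℓ _ hw
    rw [h1] at h2
    exact mul_left_cancel₀ (pow_ne_zero j hμ0) (by rw [h2]; ring)
  have hall : ∀ w, w ≠ 0 → K w = κ * w := by
    intro w hw
    obtain ⟨x, hx⟩ := exists_circle_dot_eq_zero n₀ hw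
    obtain ⟨U, hU, hUx⟩ := mapClusterPt_iff_ultrafilter.1 (hdense x)
    -- the foot on `μ₀⁻ʲ ℓ` of the perpendicular from `w`
    set s : ℕ → ℝ := fun j => (d₀ * (r⁻¹) ^ j - dot n₀ ((c ^ j : Circle) * w)) / dot n₀ n₀ with hs
    set y : ℕ → ℂ := fun j => w + s j * (starRingEnd ℂ (c ^ j : Circle) * n₀) with hy
    have hys : ∀ j, dot n₀ (μ₀ ^ j * y j) = d₀ := by
      intro j
      have h1 : μ₀ ^ j * y j = (r ^ j : ℝ) * ((c ^ j : Circle) * w + s j * n₀) := by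
        have h2 : ((c ^ j : Circle) : ℂ) * starRingEnd ℂ ((c ^ j : Circle) : ℂ) = 1 := by
          rw [Complex.mul_conj, Circle.normSq_coe, Complex.ofReal_one]
        have h3 : μ₀ ^ j = (r ^ j : ℝ) * ((c ^ j : Circle) : ℂ) := by
          rw [hμ₀, mul_pow]; push_cast; rfl
        rw [h3, hy]
        linear_combination ((r ^ j : ℝ) : ℂ) * s j * n₀ * h2
      rw [h1, dot_real_mul, dot_add, dot_real_mul, hs]
      have h2 : r ^ j ≠ 0 := pow_ne_zero _ (zero_lt_one.trans hr).ne'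
      have h3 := (dot_self_pos hn₀0).ne'
      field_simp
      rw [add_sub_cancel, mul_left_comm, ← mul_pow, one_div,
        mul_inv_cancel₀ (zero_lt_one.trans hr).ne', one_pow, mul_one]
    have hcx : Tendsto (fun j : ℕ => ((c ^ j : Circle) : ℂ)) U (𝓝 x) :=
      (continuous_subtype_val.tendsto x).comp hUx
    have hst : Tendsto s U (𝓝 0) := by
      have h1 : Tendsto (fun j : ℕ => (r⁻¹) ^ j) U (𝓝 0) :=
        (tendsto_pow_atTop_nhds_zero_of_lt_one (by positivity) (inv_lt_one_of_one_lt₀ hr)).mono_left hU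
      have h2 : Tendsto (fun j : ℕ => dot n₀ ((c ^ j : Circle) * w)) U (𝓝 0) := by
        rw [← hx]
        exact ((continuous_dot_right n₀).tendsto _).comp (hcx.mul_const w)
      have h3 := ((h1.const_mul d₀).sub h2).div_const (dot n₀ n₀)
      rwa [mul_zero, sub_zero, zero_div] at h3
    have hyt : Tendsto y U (𝓝 w) := by
      have h1 : Tendsto (fun j : ℕ => (s j : ℂ)) U (𝓝 0) := by
        have := (Complex.continuous_ofReal.tendsto 0).comp hst
        rwa [Complex.ofReal_zero] at this
      have h2 := ((Complex.continuous_conj.tendsto _).comp hcx).mul_const n₀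
      have h3 := (h1.mul h2).const_add w
      rwa [zero_mul, add_zero] at h3
    have h1 : Tendsto (fun j => K (y j)) U (𝓝 (K w)) := (hKc.tendsto w).comp hyt
    have h2 : Tendsto (fun j => K (y j)) U (𝓝 (κ * w)) := by
      have : (fun j => K (y j)) = fun j => κ * y j := funext fun j => hiter j _ (hys j)
      rw [this]
      exact hyt.const_mul _
    exact tendsto_nhds_unique h1 h2
  intro w
  by_cases hw : w = 0
  · rw [hw, hH0, mul_zero]
  · have := hall w hw
    rw [div_mul_eq_mul_div, eq_div_iff hζ0, ← this, mul_comm]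

/-! ### Extending a local conjugacy of expanding similarities -/

theorem exists_inv_pow_mul_mem_ball {μ : ℂ} (hμ : 1 < ‖μ‖) {δ : ℝ} (hδ : 0 < δ) (z : ℂ) :
    ∃ n : ℕ, (μ⁻¹) ^ n * z ∈ Metric.ball (0 : ℂ) δ := by
  have h : Tendsto (fun n : ℕ => (μ⁻¹) ^ n * z) atTop (𝓝 (0 * z)) := by
    refine Tendsto.mul_const z (tendsto_pow_atTop_nhds_zero_of_norm_lt_one ?_)
    rw [norm_inv]; exact inv_lt_one_of_one_lt₀ hμ
  rw [zero_mul] at h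
  exact (h.eventually (Metric.ball_mem_nhds 0 hδ)).exists

theorem inv_mul_mem_ball {μ z : ℂ} {δ : ℝ} (hμ : 1 < ‖μ‖) (hz : z ∈ Metric.ball (0 : ℂ) δ) :
    μ⁻¹ * z ∈ Metric.ball (0 : ℂ) δ := by
  rw [mem_ball_zero_iff] at hz ⊢
  rw [norm_mul, norm_inv]
  have := inv_lt_one_of_one_lt₀ hμ
  nlinarith [norm_nonneg z]

theorem exists_extension {μ₀ μ₁ : ℂ} (hμ₀ : 1 < ‖μ₀‖) (hμ₁ : μ₁ ≠ 0) {k : ℂ → ℂ} {δ : ℝ}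
    (hδ : 0 < δ) (hk : ContinuousOn k (Metric.ball 0 δ))
    (hc : ∀ z ∈ Metric.ball (0 : ℂ) δ, k (μ₀⁻¹ * z) = μ₁⁻¹ * k z) :
    ∃ H : ℂ → ℂ, Continuous H ∧ (∀ w, H (μ₀ * w) = μ₁ * H w) ∧
      ∀ z ∈ Metric.ball (0 : ℂ) δ, H z = k z := by
  have hμ0 : μ₀ ≠ 0 := fun h => by simp [h] at hμ₀; linarith
  set F : ℕ → ℂ → ℂ := fun n z => μ₁ ^ n * k ((μ₀⁻¹) ^ n * z) with hF
  have hmem : ∀ {n m : ℕ} {z : ℂ}, (μ₀⁻¹) ^ n * z ∈ Metric.ball (0 : ℂ) δ → n ≤ m →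
      (μ₀⁻¹) ^ m * z ∈ Metric.ball (0 : ℂ) δ ∧ F m z = F n z := by
    intro n m z hz hnm
    induction m, hnm using Nat.le_induction with
    | base => exact ⟨hz, rfl⟩
    | succ m _ ih =>
      have e : (μ₀⁻¹) ^ (m + 1) * z = μ₀⁻¹ * ((μ₀⁻¹) ^ m * z) := by rw [pow_succ']; ring
      refine ⟨by rw [e]; exact inv_mul_mem_ball hμ₀ ih.1, ?_⟩
      rw [← ih.2]
      simp only [hF]
      rw [e, hc _ ih.1, pow_succ]
      field_simp
  choose N hN using exists_inv_pow_mul_mem_ball hμ₀ hδ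
  have hind : ∀ {n : ℕ} {z : ℂ}, (μ₀⁻¹) ^ n * z ∈ Metric.ball (0 : ℂ) δ → F (N z) z = F n z := by
    intro n z hz
    rw [← (hmem hz (le_max_left n (N z))).2, ← (hmem (hN z) (le_max_right n (N z))).2]
  refine ⟨fun z => F (N z) z, ?_, ?_, ?_⟩
  · rw [continuous_iff_continuousAt]
    intro z
    have hcont : Continuous fun x : ℂ => (μ₀⁻¹) ^ N z * x := by fun_prop
    have hev : ∀ᶠ x in 𝓝 z, (μ₀⁻¹) ^ N z * x ∈ Metric.ball (0 : ℂ) δ :=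
      hcont.continuousAt.eventually (Metric.isOpen_ball.mem_nhds (hN z))
    have h1 : ContinuousAt (F (N z)) z := by
      have h2 : ContinuousAt k ((μ₀⁻¹) ^ N z * z) :=
        hk.continuousAt (Metric.isOpen_ball.mem_nhds (hN z))
      exact continuousAt_const.mul (ContinuousAt.comp (f := fun x => (μ₀⁻¹) ^ N z * x) h2
        hcont.continuousAt)
    refine h1.congr (hev.mono fun x hx => (hind hx).symm)
  · intro w
    have h1 : (μ₀⁻¹) ^ (N w + 1) * (μ₀ * w) = (μ₀⁻¹) ^ N w * w := by
      rw [pow_succ]; field_simp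
    have h2 : F (N (μ₀ * w)) (μ₀ * w) = F (N w + 1) (μ₀ * w) := hind (by rw [h1]; exact hN w)
    simp only [h2]
    simp only [hF]
    rw [h1, pow_succ']
    ring
  · intro z hz
    have h1 : F (N z) z = F 0 z := hind (by simpa using hz)
    simpa [hF] using h1

/-- Mutually inverse germs of conjugacies between the expanding similarities `μ₀` and `μ₁` extend to
a homeomorphism of the plane. -/
theorem exists_homeomorph_extension {μ₀ μ₁ : ℂ} (hμ₀ : 1 < ‖μ₀‖) (hμ₁ : 1 < ‖μ₁‖) {k₀ k₁ : ℂ → ℂ}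
    {δ₀ δ₁ : ℝ} (hδ₀ : 0 < δ₀) (hδ₁ : 0 < δ₁) (hk₀ : ContinuousOn k₀ (Metric.ball 0 δ₀))
    (hk₁ : ContinuousOn k₁ (Metric.ball 0 δ₁)) (h0 : k₀ 0 = 0) (h0' : k₁ 0 = 0)
    (hc₀ : ∀ z ∈ Metric.ball (0 : ℂ) δ₀, k₀ (μ₀⁻¹ * z) = μ₁⁻¹ * k₀ z)
    (hc₁ : ∀ z ∈ Metric.ball (0 : ℂ) δ₁, k₁ (μ₁⁻¹ * z) = μ₀⁻¹ * k₁ z)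
    (hinv₀ : ∀ z ∈ Metric.ball (0 : ℂ) δ₀, k₀ z ∈ Metric.ball (0 : ℂ) δ₁ → k₁ (k₀ z) = z)
    (hinv₁ : ∀ z ∈ Metric.ball (0 : ℂ) δ₁, k₁ z ∈ Metric.ball (0 : ℂ) δ₀ → k₀ (k₁ z) = z) :
    ∃ H : ℂ ≃ₜ ℂ, (∀ w, H (μ₀ * w) = μ₁ * H w) ∧
      (∀ z ∈ Metric.ball (0 : ℂ) δ₀, H z = k₀ z) ∧
      ∀ z ∈ Metric.ball (0 : ℂ) δ₁, H.symm z = k₁ z := by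
  have key : ∀ {μ₀ μ₁ : ℂ} {k₀ k₁ H₀ H₁ : ℂ → ℂ} {δ₀ δ₁ : ℝ}, 1 < ‖μ₀‖ → 1 < ‖μ₁‖ → 0 < δ₀ →
      0 < δ₁ → k₀ 0 = 0 → Continuous H₀ →
      (∀ w, H₀ (μ₀ * w) = μ₁ * H₀ w) → (∀ z ∈ Metric.ball (0 : ℂ) δ₀, H₀ z = k₀ z) →
      (∀ w, H₁ (μ₁ * w) = μ₀ * H₁ w) → (∀ z ∈ Metric.ball (0 : ℂ) δ₁, H₁ z = k₁ z) →
      (∀ z ∈ Metric.ball (0 : ℂ) δ₀, k₀ z ∈ Metric.ball (0 : ℂ) δ₁ → k₁ (k₀ z) = z) →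
      ∀ w, H₁ (H₀ w) = w := by
    intro μ₀ μ₁ k₀ k₁ H₀ H₁ δ₀ δ₁ hμ₀ hμ₁ hδ₀ hδ₁ h0 hH₀ hc₀ he₀ hc₁ he₁ hinv w
    have hn0 : μ₀ ≠ 0 := fun h => by simp [h] at hμ₀; linarith
    have hit₀ : ∀ n w, H₀ (μ₀ ^ n * w) = μ₁ ^ n * H₀ w := by
      intro n
      induction n with
      | zero => simp
      | succ n ih => intro w; rw [pow_succ', mul_assoc, hc₀, ih, pow_succ', mul_assoc]
    have hit₁ : ∀ n w, H₁ (μ₁ ^ n * w) = μ₀ ^ n * H₁ w := by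
      intro n
      induction n with
      | zero => simp
      | succ n ih => intro w; rw [pow_succ', mul_assoc, hc₁, ih, pow_succ', mul_assoc]
    have hev : ∀ᶠ z in 𝓝 (0 : ℂ), z ∈ Metric.ball (0 : ℂ) δ₀ ∧ H₀ z ∈ Metric.ball (0 : ℂ) δ₁ := by
      refine Filter.Eventually.and (Metric.ball_mem_nhds 0 hδ₀) (hH₀.continuousAt.eventually ?_)
      rw [he₀ 0 (Metric.mem_ball_self hδ₀), h0]
      exact Metric.ball_mem_nhds 0 hδ₁
    obtain ⟨ε, hε, hball⟩ := Metric.eventually_nhds_iff_ball.1 hev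
    obtain ⟨n, hn⟩ := exists_inv_pow_mul_mem_ball hμ₀ hε w
    obtain ⟨h1, h2⟩ := hball _ hn
    have hw : w = μ₀ ^ n * ((μ₀⁻¹) ^ n * w) := by
      rw [← mul_assoc, ← mul_pow, mul_inv_cancel₀ hn0, one_pow, one_mul]
    rw [hw, hit₀, hit₁, he₁ _ h2, he₀ _ h1, hinv _ h1 (by rwa [he₀ _ h1] at h2)]
  have hn0 : μ₀ ≠ 0 := fun h => by simp [h] at hμ₀; linarith
  have hn1 : μ₁ ≠ 0 := fun h => by simp [h] at hμ₁; linarith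
  obtain ⟨H₀, hH₀, hc₀', he₀⟩ := exists_extension hμ₀ hn1 hδ₀ hk₀ hc₀
  obtain ⟨H₁, hH₁, hc₁', he₁⟩ := exists_extension hμ₁ hn0 hδ₁ hk₁ hc₁
  exact ⟨⟨⟨H₀, H₁, key hμ₀ hμ₁ hδ₀ hδ₁ h0 hH₀ hc₀' he₀ hc₁' he₁ hinv₀,
    key hμ₁ hμ₀ hδ₁ hδ₀ h0' hH₁ hc₁' he₁ hc₀' he₀ hinv₁⟩, hH₀, hH₁⟩, hc₀', he₀, he₁⟩

/-! ### A folded return map in coordinates -/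

section

/-- The inverse return map near a one-sided tangency, in linearizing coordinates scaled so that the
tangency point on the stable axis is `(0, 1)`. `Z` and `G` are the unstable and the stable coordinate
of the preimage, so that `G = 0` is the unstable surface through `(0, 1)`. The surface is tangent to
the axis, with conormal `ξ`, and `G` is positive on the rest of the axis. -/
structure ReturnModel (Z : ℂ × ℝ → ℂ) (G : ℂ × ℝ → ℝ) (z₀ ξ : ℂ) : Prop where
  continuousAt_Z : ∀ᶠ x in 𝓝 ((0 : ℂ), (1 : ℝ)), ContinuousAt Z x
  continuousAt_G : ∀ᶠ x in 𝓝 ((0 : ℂ), (1 : ℝ)), ContinuousAt G x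
  Z_base : Z (0, 1) = z₀
  G_base : G (0, 1) = 0
  expand : ∀ ε > 0, ∀ᶠ x in 𝓝 ((0 : ℂ), (1 : ℝ)), |G x - G (0, x.2) - dot ξ x.1| ≤ ε * ‖x.1‖
  pos : ∀ᶠ s in 𝓝[≠] (1 : ℝ), 0 < G (0, s)

variable {Z : ℂ × ℝ → ℂ} {G : ℂ × ℝ → ℝ} {z₀ ξ : ℂ} {μ : ℂ} {r : ℝ} {c : Circle}

theorem dot_mul_circle_pow (hμ : μ = r * c) (ξ z : ℂ) (m : ℕ) :
    dot (ξ * (c ^ m : Circle)) (μ ^ m * z) = r ^ m * dot ξ z := by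
  have h3 : μ ^ m * z = (r ^ m : ℝ) * (((c ^ m : Circle) : ℂ) * z) := by
    rw [hμ, mul_pow]; push_cast; ring
  rw [h3, dot_real_mul, dot_mul_mul, Circle.norm_coe]
  ring

theorem norm_eq_of_polar (hr : 1 < r) (hμ : μ = r * c) : ‖μ‖ = r := by
  rw [hμ, norm_mul, Circle.norm_coe, mul_one, Complex.norm_real, Real.norm_of_nonneg (by linarith)]

theorem ne_zero_of_polar (hr : 1 < r) (hμ : μ = r * c) : μ ≠ 0 :=
  norm_pos_iff.1 (by rw [norm_eq_of_polar hr hμ]; linarith)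

theorem tendsto_dot_circle_pow {l : Filter ℕ} {m : ℕ → ℕ} {v : Circle}
    (hv : Tendsto (fun n => c ^ m n) l (𝓝 v)) (ξ w : ℂ) :
    Tendsto (fun n => dot (ξ * (c ^ m n : Circle)) w) l (𝓝 (dot (ξ * v) w)) := by
  have h1 : Tendsto (fun n => ((c ^ m n : Circle) : ℂ)) l (𝓝 v) :=
    (continuous_subtype_val.tendsto v).comp hv
  exact (continuous_dot.tendsto (ξ * v, w)).comp ((h1.const_mul ξ).prodMk_nhds tendsto_const_nhds)

/-- Limits of the `m`-th iterates of points near `(0, 1)` on levels `G = e` lie in the half plane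
`dot (ξ v) w ≤ τ`, where `v` and `τ` are the limits of `cᵐ` and `rᵐ e`. -/
theorem ReturnModel.dot_le_of_limit (hR : ReturnModel Z G z₀ ξ) (hr : 1 < r) (hμ : μ = r * c)
    {l : Filter ℕ} [NeBot l] {m : ℕ → ℕ} {v : Circle} {τ : ℝ} {w : ℂ}
    (hv : Tendsto (fun n => c ^ m n) l (𝓝 v))
    (h : ∀ V ∈ 𝓝 ((0 : ℂ), (1 : ℝ)), ∀ ε > 0, ∀ᶠ n in l, ∃ x ∈ V,
      |r ^ m n * G x - τ| < ε ∧ ‖μ ^ m n * x.1 - w‖ < ε) :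
    dot (ξ * v) w ≤ τ := by
  have hnn : ∀ᶠ x in 𝓝 ((0 : ℂ), (1 : ℝ)), 0 ≤ G (0, x.2) := by
    have h1 : ∀ᶠ s in 𝓝 (1 : ℝ), 0 ≤ G (0, s) := by
      have := eventually_nhdsWithin_iff.1 hR.pos
      filter_upwards [this] with s hs
      by_cases h1 : s = 1
      · rw [h1, hR.G_base]
      · exact (hs h1).le
    exact (continuous_snd.tendsto ((0 : ℂ), (1 : ℝ))).eventually h1
  have key : ∀ ε > 0, dot (ξ * v) w ≤ τ + ε * (1 + ‖w‖ + ε + ‖ξ‖) := by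
    intro ε hε
    refine le_of_tendsto (tendsto_dot_circle_pow hv ξ w) ?_
    filter_upwards [h _ (Filter.inter_mem (hR.expand ε hε) hnn) ε hε] with n hn
    obtain ⟨x, ⟨hx1, hx2⟩, hx3, hx4⟩ := hn
    simp only [mem_ofPred_eq] at hx1 hx2
    have hrm : 0 < r ^ m n := pow_pos (by linarith) _
    have e1 := dot_mul_circle_pow hμ ξ x.1 (m n)
    have e2 : dot (ξ * (c ^ m n : Circle)) w = r ^ m n * dot ξ x.1
        + dot (ξ * (c ^ m n : Circle)) (-(μ ^ m n * x.1 - w)) := by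
      rw [← e1, ← dot_add]; congr 1; ring
    have e3 : dot (ξ * (c ^ m n : Circle)) (-(μ ^ m n * x.1 - w)) ≤ ‖ξ‖ * ε := by
      refine (le_abs_self _).trans ((abs_dot_le _ _).trans ?_)
      rw [norm_mul, Circle.norm_coe, mul_one, norm_neg]
      exact mul_le_mul_of_nonneg_left hx4.le (norm_nonneg _)
    have e4 : r ^ m n * ‖x.1‖ ≤ ‖w‖ + ε := by
      have : r ^ m n * ‖x.1‖ = ‖w + (μ ^ m n * x.1 - w)‖ := by
        rw [add_sub_cancel, norm_mul, norm_pow, norm_eq_of_polar hr hμ]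
      rw [this]
      exact (norm_add_le _ _).trans (by linarith)
    have e5 : dot ξ x.1 ≤ G x + ε * ‖x.1‖ := by
      have := (abs_le.1 hx1).1
      linarith
    have e6 : r ^ m n * dot ξ x.1 ≤ r ^ m n * G x + ε * (r ^ m n * ‖x.1‖) := by
      calc _ ≤ r ^ m n * (G x + ε * ‖x.1‖) := mul_le_mul_of_nonneg_left e5 hrm.le
        _ = _ := by ring
    have e7 : ε * (r ^ m n * ‖x.1‖) ≤ ε * (‖w‖ + ε) := mul_le_mul_of_nonneg_left e4 hε.le
    have e8 := (abs_lt.1 hx3).2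
    rw [e2]
    nlinarith
  have hlim : Tendsto (fun ε : ℝ => τ + ε * (1 + ‖w‖ + ε + ‖ξ‖)) (𝓝[>] 0) (𝓝 τ) := by
    have : Continuous fun ε : ℝ => τ + ε * (1 + ‖w‖ + ε + ‖ξ‖) := by fun_prop
    have := this.tendsto 0
    simp only [zero_mul, add_zero] at this
    exact this.mono_left nhdsWithin_le_nhds
  exact ge_of_tendsto hlim (eventually_mem_nhdsWithin.mono fun ε hε => key ε hε)

theorem tendsto_inv_pow_mul (hr : 1 < r) (hμ : μ = r * c) {l : Filter ℕ} {m : ℕ → ℕ}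
    (hm : Tendsto m l atTop) (w : ℂ) : Tendsto (fun n => (μ⁻¹) ^ m n * w) l (𝓝 0) := by
  have : Tendsto (fun n : ℕ => (μ⁻¹) ^ n) atTop (𝓝 0) := by
    refine tendsto_pow_atTop_nhds_zero_of_norm_lt_one ?_
    rw [norm_inv, norm_eq_of_polar hr hμ]; exact inv_lt_one_of_one_lt₀ hr
  simpa using (this.comp hm).mul_const w

/-- Over the interior of the half plane `dot (ξ v) w ≤ τ`, the tangency level lies below `e`. -/
theorem ReturnModel.eventually_lt (hR : ReturnModel Z G z₀ ξ) (hr : 1 < r) (hμ : μ = r * c)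
    {l : Filter ℕ} {m : ℕ → ℕ} (hm : Tendsto m l atTop) {v : Circle} {τ : ℝ} {w : ℂ}
    (hv : Tendsto (fun n => c ^ m n) l (𝓝 v)) {e : ℕ → ℝ}
    (he : Tendsto (fun n => r ^ m n * e n) l (𝓝 τ)) (hw : dot (ξ * v) w < τ) :
    ∃ η > 0, ∀ᶠ n in l, ∀ w' ∈ Metric.ball w η, G ((μ⁻¹) ^ m n * w', 1) < e n := by
  have hμ0 := ne_zero_of_polar hr hμ
  set g := τ - dot (ξ * v) w with hg
  have hg0 : 0 < g := by linarith
  set B := ‖ξ‖ + ‖w‖ + 2 with hB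
  have hB0 : 0 < B := by positivity
  set η : ℝ := min 1 (g / (4 * B)) with hη
  have hη0 : 0 < η := lt_min one_pos (by positivity)
  have hηB : η * B ≤ g / 4 := by
    calc η * B ≤ g / (4 * B) * B := mul_le_mul_of_nonneg_right (min_le_right _ _) hB0.le
      _ = g / 4 := by field_simp
  refine ⟨η, hη0, ?_⟩
  obtain ⟨ρ, hρ, hball⟩ := Metric.eventually_nhds_iff_ball.1 (hR.expand η hη0)
  have h1 := tendsto_dot_circle_pow hv ξ w
  have h2 : ∀ᶠ n in l, dot (ξ * (c ^ m n : Circle)) w < dot (ξ * v) w + g / 4 :=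
    h1.eventually (gt_mem_nhds (by linarith))
  have h3 : ∀ᶠ n in l, τ - g / 4 < r ^ m n * e n := he.eventually (lt_mem_nhds (by linarith))
  have h4 : ∀ᶠ n in l, (μ⁻¹) ^ m n * ((‖w‖ + 1 : ℝ) : ℂ) ∈ Metric.ball (0 : ℂ) ρ :=
    (tendsto_inv_pow_mul hr hμ hm _).eventually (Metric.ball_mem_nhds 0 hρ)
  filter_upwards [h2, h3, h4] with n hn2 hn3 hn4 w' hw'
  have hrm : 0 < r ^ m n := pow_pos (by linarith) _
  have hw'' : ‖w' - w‖ < η := by rwa [mem_ball_iff_norm] at hw'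
  have hη1 : η ≤ 1 := min_le_left _ _
  have hwn : ‖w'‖ ≤ ‖w‖ + 1 := by
    have := norm_sub_norm_le w' w
    linarith
  set z := (μ⁻¹) ^ m n * w' with hz
  have hzw : μ ^ m n * z = w' := by
    rw [hz, ← mul_assoc, ← mul_pow, mul_inv_cancel₀ hμ0, one_pow, one_mul]
  have hzx : (z, (1 : ℝ)) ∈ Metric.ball ((0 : ℂ), (1 : ℝ)) ρ := by
    rw [mem_ball_zero_iff, norm_mul, Complex.norm_real, Real.norm_of_nonneg (by positivity)] at hn4
    rw [mem_ball_iff_norm, Prod.mk_sub_mk, sub_zero, sub_self, Prod.norm_mk, norm_zero,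
      max_eq_left (norm_nonneg _), hz, norm_mul]
    exact lt_of_le_of_lt (mul_le_mul_of_nonneg_left hwn (norm_nonneg _)) hn4
  have h5 := hball _ hzx
  simp only [hR.G_base, sub_zero] at h5
  have h6 : G (z, 1) ≤ dot ξ z + η * ‖z‖ := by linarith [(abs_le.1 h5).2]
  have h7 : r ^ m n * dot ξ z = dot (ξ * (c ^ m n : Circle)) w' := by
    rw [← dot_mul_circle_pow hμ, hzw]
  have h8 : r ^ m n * ‖z‖ = ‖w'‖ := by
    have h := congrArg norm hzw
    rwa [norm_mul, norm_pow, norm_eq_of_polar hr hμ] at h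
  have h9 : dot (ξ * (c ^ m n : Circle)) w' ≤ dot (ξ * (c ^ m n : Circle)) w + ‖ξ‖ * η := by
    have e1 : dot (ξ * (c ^ m n : Circle)) w' = dot (ξ * (c ^ m n : Circle)) w
        + dot (ξ * (c ^ m n : Circle)) (w' - w) := by
      rw [← dot_add]; congr 1; ring
    have e2 := (le_abs_self _).trans (abs_dot_le (ξ * (c ^ m n : Circle)) (w' - w))
    rw [norm_mul, Circle.norm_coe, mul_one] at e2
    have e3 := mul_le_mul_of_nonneg_left hw''.le (norm_nonneg ξ)
    linarith
  have h10 : r ^ m n * G (z, 1) < r ^ m n * e n := by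
    have e1 : r ^ m n * G (z, 1) ≤ r ^ m n * dot ξ z + η * (r ^ m n * ‖z‖) := by
      calc _ ≤ r ^ m n * (dot ξ z + η * ‖z‖) := mul_le_mul_of_nonneg_left h6 hrm.le
        _ = _ := by ring
    rw [h7, h8] at e1
    have e2 : η * ‖w'‖ ≤ η * (‖w‖ + 1) := mul_le_mul_of_nonneg_left hwn hη0.le
    have e3 : η * B = ‖ξ‖ * η + η * (‖w‖ + 1) + η := by rw [hB]; ring
    linarith
  exact lt_of_mul_lt_mul_left h10 hrm.le

/-- Off the tangency point, the values of `G` near the stable axis stay away from `0`. -/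
theorem ReturnModel.eventually_gt {s : ℝ} (hG : ContinuousAt G (0, s)) (hs : 0 < G (0, s))
    (hr : 1 < r) (hμ : μ = r * c) {l : Filter ℕ} {m : ℕ → ℕ} (hm : Tendsto m l atTop) (B : ℝ) :
    ∀ᶠ n in l, ∀ w' : ℂ, ‖w'‖ ≤ B → G (0, s) / 2 < G ((μ⁻¹) ^ m n * w', s) := by
  have h1 : ∀ᶠ x in 𝓝 ((0 : ℂ), s), G (0, s) / 2 < G x := hG.eventually (lt_mem_nhds (by linarith))
  obtain ⟨ρ, hρ, hball⟩ := Metric.eventually_nhds_iff_ball.1 h1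
  have h4 : ∀ᶠ n in l, (μ⁻¹) ^ m n * (B : ℂ) ∈ Metric.ball (0 : ℂ) ρ :=
    (tendsto_inv_pow_mul hr hμ hm _).eventually (Metric.ball_mem_nhds 0 hρ)
  filter_upwards [h4] with n hn w' hw'
  apply hball
  rw [mem_ball_zero_iff, norm_mul, Complex.norm_real] at hn
  rw [mem_ball_iff_norm, Prod.mk_sub_mk, sub_zero, sub_self, Prod.norm_mk, norm_zero,
    max_eq_left (norm_nonneg _), norm_mul]
  exact lt_of_le_of_lt (mul_le_mul_of_nonneg_left (hw'.trans (le_abs_self B)) (norm_nonneg _)) hn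

/-- Arbitrarily small boxes on which `Z` and `G` are controlled. -/
theorem ReturnModel.exists_box (hR : ReturnModel Z G z₀ ξ) {V : Set (ℂ × ℝ)}
    (hV : V ∈ 𝓝 ((0 : ℂ), (1 : ℝ))) : ∃ η > 0, ∃ κ > 0, κ < η ∧ 0 < G (0, 1 + κ) ∧
      ∀ z : ℂ, ∀ s : ℝ, ‖z‖ < η → |s - 1| < η →
        (z, s) ∈ V ∧ ContinuousAt Z (z, s) ∧ ContinuousAt G (z, s) := by
  have h1 : ∀ᶠ x in 𝓝 ((0 : ℂ), (1 : ℝ)), x ∈ V ∧ ContinuousAt Z x ∧ ContinuousAt G x :=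
    Filter.Eventually.and hV (hR.continuousAt_Z.and hR.continuousAt_G)
  obtain ⟨η, hη, hball⟩ := Metric.eventually_nhds_iff_ball.1 h1
  have h2 : ∀ᶠ s in 𝓝[>] (1 : ℝ), 0 < G (0, s) :=
    hR.pos.filter_mono (nhdsWithin_mono _ fun s hs => ne_of_gt hs)
  have h3 : ∀ᶠ s in 𝓝[>] (1 : ℝ), s < 1 + η :=
    (gt_mem_nhds (by linarith)).filter_mono nhdsWithin_le_nhds
  obtain ⟨s, ⟨hs1, hs2⟩, hs3⟩ := ((h2.and h3).and eventually_mem_nhdsWithin).exists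
  have hs3' : 1 < s := hs3
  refine ⟨η, hη, s - 1, by linarith, by linarith, by rwa [add_sub_cancel], fun z t hz ht => ?_⟩
  apply hball
  rw [mem_ball_iff_norm, Prod.mk_sub_mk, sub_zero, Prod.norm_mk]
  exact max_lt hz ht

/-- Over the open half plane `dot (ξ v) w < 0`, the `m`-th iterate of the unstable surface `G = 0`
covers `w`. -/
theorem ReturnModel.exists_first (hR : ReturnModel Z G z₀ ξ) (hr : 1 < r) (hμ : μ = r * c)
    {l : Filter ℕ} {m : ℕ → ℕ} (hm : Tendsto m l atTop) {v : Circle} {w : ℂ}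
    (hv : Tendsto (fun n => c ^ m n) l (𝓝 v)) (hw : dot (ξ * v) w < 0)
    {V : Set (ℂ × ℝ)} (hV : V ∈ 𝓝 ((0 : ℂ), (1 : ℝ))) :
    ∀ᶠ n in l, ∃ s, ((μ⁻¹) ^ m n * w, s) ∈ V ∧ G ((μ⁻¹) ^ m n * w, s) = 0 := by
  obtain ⟨η, hη, κ, hκ, hκη, hGκ, hbox⟩ := hR.exists_box hV
  obtain ⟨η', hη', h1⟩ := hR.eventually_lt hr hμ hm hv (e := 0) (τ := 0) (by simpa using tendsto_const_nhds) hw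
  have h2 := ReturnModel.eventually_gt (hbox 0 (1 + κ) (by simpa) (by simp [abs_of_pos hκ, hκη])).2.2
    hGκ hr hμ hm ‖w‖
  have h3 : ∀ᶠ n in l, (μ⁻¹) ^ m n * w ∈ Metric.ball (0 : ℂ) η :=
    (tendsto_inv_pow_mul hr hμ hm _).eventually (Metric.ball_mem_nhds 0 hη)
  filter_upwards [h1, h2, h3] with n hn1 hn2 hn3
  rw [mem_ball_zero_iff] at hn3
  have ha := hn1 w (Metric.mem_ball_self hη')
  have hb := hn2 w le_rfl
  have habs : ∀ s ∈ Icc (1 : ℝ) (1 + κ), |s - 1| < η := fun s hs => by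
    rw [abs_of_nonneg (by linarith [hs.1])]; linarith [hs.2]
  have hcont : ContinuousOn (fun s => G ((μ⁻¹) ^ m n * w, s)) (Icc 1 (1 + κ)) := fun s hs =>
    (ContinuousAt.comp (f := fun s : ℝ => ((μ⁻¹) ^ m n * w, s)) (hbox _ s hn3 (habs s hs)).2.2
      (by fun_prop)).continuousWithinAt
  simp only [Pi.zero_apply] at ha
  obtain ⟨s, hs, hs0⟩ := intermediate_value_Icc (by linarith) hcont
    (mem_Icc.2 ⟨ha.le, by linarith⟩)
  exact ⟨s, (hbox _ s hn3 (habs s hs)).1, hs0⟩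

/-- Over the open half plane `dot (ξ v) w < τ`, the `m`-th iterate of the image, under the return map,
of the sheets at height about `lamⁿ` of the `n`-th iterate of the unstable surface covers `w`. -/
theorem ReturnModel.exists_second (hR : ReturnModel Z G z₀ ξ) (hr : 1 < r) (hμ : μ = r * c)
    {lam : ℝ} (hlam0 : 0 < lam) (hlam1 : lam < 1)
    {l : Filter ℕ} (hl : l ≤ atTop) {m : ℕ → ℕ} (hm : Tendsto m l atTop) {u v : Circle} {w : ℂ}
    {τ : ℝ} (hu : Tendsto (fun n => c ^ n) l (𝓝 u)) (hz₀ : dot (ξ * u) z₀ < 0)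
    (hv : Tendsto (fun n => c ^ m n) l (𝓝 v))
    (hτ : Tendsto (fun n => r ^ m n * lam ^ n) l (𝓝 τ)) (hw : dot (ξ * v) w < τ)
    {V : Set (ℂ × ℝ)} (hV : V ∈ 𝓝 ((0 : ℂ), (1 : ℝ))) :
    ∀ᶠ n in l, ∃ s s', ((μ⁻¹) ^ m n * w, s) ∈ V ∧
      ((μ⁻¹) ^ n * Z ((μ⁻¹) ^ m n * w, s), s') ∈ V ∧
      G ((μ⁻¹) ^ m n * w, s) = lam ^ n * s' ∧ G ((μ⁻¹) ^ n * Z ((μ⁻¹) ^ m n * w, s), s') = 0 := by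
  have hid : Tendsto (fun n : ℕ => n) l atTop := hl
  obtain ⟨η₀, hη₀, h0⟩ := hR.eventually_lt hr hμ hid hu (e := 0) (τ := 0) (by simpa using tendsto_const_nhds) hz₀
  have hZ : ∀ᶠ x in 𝓝 ((0 : ℂ), (1 : ℝ)), Z x ∈ Metric.ball z₀ η₀ := by
    have := hR.continuousAt_Z.self_of_nhds
    refine this.eventually ?_
    rw [hR.Z_base]
    exact Metric.ball_mem_nhds _ hη₀
  obtain ⟨η, hη, κ, hκ, hκη, hGκ, hbox⟩ := hR.exists_box (Filter.inter_mem hV hZ)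
  obtain ⟨η', hη', h1⟩ := hR.eventually_lt hr hμ hm hv hτ hw
  have hcκ := (hbox 0 (1 + κ) (by simpa) (by simp [abs_of_pos hκ, hκη])).2.2
  have h2 := ReturnModel.eventually_gt hcκ hGκ hr hμ hm ‖w‖
  have h2' := ReturnModel.eventually_gt hcκ hGκ hr hμ hid (‖z₀‖ + η₀)
  have h3 : ∀ᶠ n in l, (μ⁻¹) ^ m n * w ∈ Metric.ball (0 : ℂ) η :=
    (tendsto_inv_pow_mul hr hμ hm _).eventually (Metric.ball_mem_nhds 0 hη)
  have h3' : ∀ᶠ n in l, (μ⁻¹) ^ n * ((‖z₀‖ + η₀ : ℝ) : ℂ) ∈ Metric.ball (0 : ℂ) η :=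
    (tendsto_inv_pow_mul hr hμ hid _).eventually (Metric.ball_mem_nhds 0 hη)
  have h4 : ∀ᶠ n in l, lam ^ n * (1 + κ) < G (0, 1 + κ) / 2 := by
    have : Tendsto (fun n : ℕ => lam ^ n * (1 + κ)) l (𝓝 (0 * (1 + κ))) :=
      ((tendsto_pow_atTop_nhds_zero_of_lt_one hlam0.le hlam1).mono_left hl).mul_const _
    rw [zero_mul] at this
    exact this.eventually (gt_mem_nhds (by linarith))
  filter_upwards [h0, h1, h2, h2', h3, h3', h4] with n hn0 hn1 hn2 hn2' hn3 hn3' hn4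
  rw [mem_ball_zero_iff] at hn3
  rw [mem_ball_zero_iff, norm_mul, Complex.norm_real, Real.norm_of_nonneg (by positivity)] at hn3'
  have hln : 0 < lam ^ n := pow_pos hlam0 n
  have habs : ∀ s ∈ Icc (1 : ℝ) (1 + κ), |s - 1| < η := fun s hs => by
    rw [abs_of_nonneg (by linarith [hs.1])]; linarith [hs.2]
  set z : ℂ := (μ⁻¹) ^ m n * w with hz
  have hZb : ∀ s ∈ Icc (1 : ℝ) (1 + κ), ‖Z (z, s)‖ ≤ ‖z₀‖ + η₀ := by
    intro s hs
    have h5 : Z (z, s) ∈ Metric.ball z₀ η₀ := (hbox z s hn3 (habs s hs)).1.2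
    rw [mem_ball_iff_norm] at h5
    linarith [norm_sub_norm_le (Z (z, s)) z₀]
  have hZs : ∀ s ∈ Icc (1 : ℝ) (1 + κ), ‖(μ⁻¹) ^ n * Z (z, s)‖ < η := fun s hs => by
    rw [norm_mul]
    exact lt_of_le_of_lt (mul_le_mul_of_nonneg_left (hZb s hs) (norm_nonneg _)) hn3'
  -- `q` is the height in units of `lamⁿ`; clamping it to `[1, 1 + κ]` reduces the system of two
  -- equations `q = s'` and `G (·, s') = 0` to a single one
  set q : ℝ → ℝ := fun s => G (z, s) / lam ^ n with hq
  set cl : ℝ → ℝ := fun s => max 1 (min (q s) (1 + κ)) with hcl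
  have hclI : ∀ s, cl s ∈ Icc (1 : ℝ) (1 + κ) := fun s =>
    ⟨le_max_left _ _, max_le (by linarith) (min_le_right _ _)⟩
  set Φ : ℝ → ℝ := fun s => G ((μ⁻¹) ^ n * Z (z, s), cl s) + (q s - cl s) with hΦ
  have hlow : ∀ s ∈ Icc (1 : ℝ) (1 + κ), q s < 1 → Φ s < 0 := by
    intro s hs hqs
    have e1 : cl s = 1 := max_eq_left ((min_le_left _ _).trans hqs.le)
    have e2 := hn0 (Z (z, s)) (hbox z s hn3 (habs s hs)).1.2
    simp only [Pi.zero_apply] at e2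
    simp only [hΦ, e1]
    linarith
  have hhigh : ∀ s ∈ Icc (1 : ℝ) (1 + κ), 1 + κ < q s → 0 < Φ s := by
    intro s hs hqs
    have e1 : cl s = 1 + κ := by
      simp only [hcl]
      rw [min_eq_right hqs.le, max_eq_right (by linarith)]
    have e2 := hn2' (Z (z, s)) (hZb s hs)
    simp only [hΦ, e1]
    linarith
  have hqc : ContinuousOn q (Icc 1 (1 + κ)) := fun s hs =>
    ((ContinuousAt.comp (f := fun s : ℝ => (z, s)) (hbox _ s hn3 (habs s hs)).2.2
      (by fun_prop)).div_const _).continuousWithinAt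
  have hclc : ContinuousOn cl (Icc 1 (1 + κ)) :=
    continuousOn_const.sup (hqc.inf continuousOn_const)
  have hZc : ContinuousOn (fun s => Z (z, s)) (Icc 1 (1 + κ)) := fun s hs =>
    (ContinuousAt.comp (f := fun s : ℝ => (z, s)) (hbox _ s hn3 (habs s hs)).2.1
      (by fun_prop)).continuousWithinAt
  have hΦc : ContinuousOn Φ (Icc 1 (1 + κ)) := by
    refine ContinuousOn.add (fun s hs => ?_) (hqc.sub hclc)
    exact ContinuousAt.comp_continuousWithinAt (f := fun s => ((μ⁻¹) ^ n * Z (z, s), cl s))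
      (hbox _ _ (hZs s hs) (habs _ (hclI s))).2.2
      (((continuousOn_const.mul hZc) s hs).prodMk (hclc s hs))
  have hq1 : q 1 < 1 := by
    rw [hq, div_lt_one hln]
    exact hn1 w (Metric.mem_ball_self hη')
  have hq2 : 1 + κ < q (1 + κ) := by
    rw [hq, lt_div_iff₀ hln]
    have := hn2 w le_rfl
    linarith
  obtain ⟨s, hs, hs0⟩ := intermediate_value_Icc (by linarith) hΦc
    (mem_Icc.2 ⟨(hlow 1 ⟨le_rfl, by linarith⟩ hq1).le, (hhigh _ ⟨by linarith, le_rfl⟩ hq2).le⟩)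
  have hq3 : 1 ≤ q s := by
    by_contra! hlt
    exact (hlow s hs hlt).ne hs0
  have hq4 : q s ≤ 1 + κ := by
    by_contra! hlt
    exact (hhigh s hs hlt).ne' hs0
  have e1 : cl s = q s := by
    simp only [hcl]
    rw [min_eq_left hq4, max_eq_right hq3]
  refine ⟨s, q s, (hbox z s hn3 (habs s hs)).1.1, (hbox _ _ (hZs s hs) (habs _ ⟨hq3, hq4⟩)).1.1, ?_, ?_⟩
  · rw [hq]; field_simp
  · simpa [hΦ, e1] using hs0

end

/-! ### Dynamics in linearizing coordinates -/

section Chart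

variable {M : Type*} [TopologicalSpace M]

/-- The topological content of linearizing coordinates `φ` at a fixed point `p` of `f`: they map onto
the cylinder of radius `a`, and `f` reads `(z, t) ↦ (μ z, lam t)` with `μ` expanding and
`0 < lam < 1`. -/
structure SaddleChart (f : M ≃ₜ M) (p : M) (μ : ℂ) (lam : ℝ)
    (φ : OpenPartialHomeomorph M (ℂ × ℝ)) (a : ℝ) : Prop where
  fixed : f p = p
  mem_source : p ∈ φ.source
  map_base : φ p = 0
  pos : 0 < a
  target_eq : φ.target = Metric.ball (0 : ℂ) a ×ˢ Ioo (-a) a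
  conj : ∀ x ∈ φ.source, f x ∈ φ.source → φ (f x) = (μ * (φ x).1, lam * (φ x).2)
  one_lt : 1 < ‖μ‖
  lam_pos : 0 < lam
  lam_lt : lam < 1

/-- The points of `φ.source` with coordinates `|z| < δ`, `|t| < δ`. -/
def box (φ : OpenPartialHomeomorph M (ℂ × ℝ)) (δ : ℝ) : Set M :=
  φ.source ∩ φ ⁻¹' (Metric.ball (0 : ℂ) δ ×ˢ Ioo (-δ) δ)

variable {f : M ≃ₜ M} {p : M} {μ : ℂ} {lam : ℝ} {φ : OpenPartialHomeomorph M (ℂ × ℝ)} {a δ : ℝ}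

namespace SaddleChart

theorem mem_target (hφ : SaddleChart f p μ lam φ a) {z : ℂ} {t : ℝ} :
    (z, t) ∈ φ.target ↔ ‖z‖ < a ∧ |t| < a := by
  rw [hφ.target_eq, mem_prod, mem_ball_zero_iff, mem_Ioo, abs_lt]

theorem mem_box {z : ℂ} {t : ℝ} (h : (z, t) ∈ φ.target) :
    φ.symm (z, t) ∈ box φ δ ↔ ‖z‖ < δ ∧ |t| < δ := by
  rw [box, mem_inter_iff, mem_preimage, φ.right_inv h, mem_prod, mem_ball_zero_iff, mem_Ioo, abs_lt]
  simp [φ.map_target h]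

theorem symm_zero (hφ : SaddleChart f p μ lam φ a) : φ.symm (0, 0) = p := by
  have := φ.left_inv hφ.mem_source
  rwa [hφ.map_base] at this

theorem ne_zero (hφ : SaddleChart f p μ lam φ a) : μ ≠ 0 :=
  norm_pos_iff.1 (zero_lt_one.trans hφ.one_lt)

theorem norm_inv_pow_mul_le (hφ : SaddleChart f p μ lam φ a) (n : ℕ) (z : ℂ) :
    ‖(μ⁻¹) ^ n * z‖ ≤ ‖z‖ := by
  rw [norm_mul, norm_pow, norm_inv]
  exact mul_le_of_le_one_left (norm_nonneg _)
    (pow_le_one₀ (by positivity) (inv_le_one_of_one_le₀ hφ.one_lt.le))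

theorem abs_pow_mul_le (hφ : SaddleChart f p μ lam φ a) (n : ℕ) (t : ℝ) :
    |lam ^ n * t| ≤ |t| := by
  rw [abs_mul, abs_of_pos (pow_pos hφ.lam_pos n)]
  exact mul_le_of_le_one_left (abs_nonneg _) (pow_le_one₀ hφ.lam_pos.le hφ.lam_lt.le)

/-- Where the linear map stays in the cylinder, the map `f` stays in the domain of the coordinates:
the set of such points where this holds is open and closed in a convex set. -/
theorem map_symm [T2Space M] (hφ : SaddleChart f p μ lam φ a) {z : ℂ} {t : ℝ} (hz : ‖μ * z‖ < a)
    (ht : |t| < a) : f (φ.symm (z, t)) = φ.symm (μ * z, lam * t) := by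
  let A : ℂ × ℝ → ℂ × ℝ := fun v => (μ * v.1, lam * v.2)
  have hA : Continuous A := by fun_prop
  let C : Set (ℂ × ℝ) := Metric.ball (0 : ℂ) (a / ‖μ‖) ×ˢ Ioo (-a) a
  have hμ : 0 < ‖μ‖ := zero_lt_one.trans hφ.one_lt
  have hCmem : ∀ {v : ℂ × ℝ}, v ∈ C ↔ ‖μ * v.1‖ < a ∧ |v.2| < a := by
    intro v
    rw [mem_prod, mem_ball_zero_iff, mem_Ioo, lt_div_iff₀ hμ, norm_mul, mul_comm, abs_lt]
  have hCt : ∀ {v}, v ∈ C → v ∈ φ.target := by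
    intro v hv
    have h := hCmem.1 hv
    refine hφ.mem_target.2 ⟨lt_of_le_of_lt ?_ h.1, h.2⟩
    rw [norm_mul]
    exact le_mul_of_one_le_left (norm_nonneg _) hφ.one_lt.le
  have hCA : ∀ {v}, v ∈ C → A v ∈ φ.target := by
    intro v hv
    have h := hCmem.1 hv
    refine hφ.mem_target.2 ⟨h.1, lt_of_le_of_lt ?_ h.2⟩
    simpa using hφ.abs_pow_mul_le 1 v.2
  have hCpre : IsPreconnected C :=
    ((convex_ball (0 : ℂ) _).prod (convex_Ioo (-a) a)).isPreconnected
  have h0 : ((0 : ℂ), (0 : ℝ)) ∈ C := hCmem.2 (by simp [hφ.pos])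
  have hcont : ContinuousOn φ.symm C := φ.continuousOn_symm.mono fun v hv => hCt hv
  have heq : ∀ v ∈ C, f (φ.symm v) ∈ φ.source → f (φ.symm v) = φ.symm (A v) := by
    intro v hv h
    have h1 := hφ.conj _ (φ.map_target (hCt hv)) h
    rw [φ.right_inv (hCt hv)] at h1
    rw [← φ.left_inv h, h1]
  -- the points of `C` mapped into the domain, and those where the two maps differ, are open
  have hu : ContinuousOn (fun v => f (φ.symm v)) C := f.continuous.comp_continuousOn hcont
  have hg : ContinuousOn (fun v => φ.symm (A v)) C :=
    φ.continuousOn_symm.comp hA.continuousOn fun v hv => hCA hv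
  have hCo : IsOpen C := Metric.isOpen_ball.prod isOpen_Ioo
  have ho1 : IsOpen (C ∩ (fun v => f (φ.symm v)) ⁻¹' φ.source) :=
    hu.isOpen_inter_preimage hCo φ.open_source
  have ho2 : IsOpen (C ∩ (fun v => (f (φ.symm v), φ.symm (A v))) ⁻¹' (diagonal M)ᶜ) :=
    (hu.prodMk hg).isOpen_inter_preimage hCo isClosed_diagonal.isOpen_compl
  have hsub : C ⊆ C ∩ (fun v => f (φ.symm v)) ⁻¹' φ.source := by
    refine hCpre.subset_left_of_subset_union ho1 ho2 ?_ ?_ ⟨0, h0, h0, ?_⟩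
    · rw [Set.disjoint_left]
      rintro v ⟨hv, h1⟩ ⟨-, h2⟩
      exact h2 (heq v hv h1)
    · intro v hv
      by_cases h : f (φ.symm v) = φ.symm (A v)
      · left
        refine ⟨hv, ?_⟩
        rw [mem_preimage, h]
        exact φ.map_target (hCA hv)
      · exact Or.inr ⟨hv, h⟩
    · change f (φ.symm (0, 0)) ∈ φ.source
      rw [hφ.symm_zero, hφ.fixed]
      exact hφ.mem_source
  have hv : (z, t) ∈ C := hCmem.2 ⟨hz, ht⟩
  exact heq _ hv (hsub hv).2

theorem iterate_symm [T2Space M] (hφ : SaddleChart f p μ lam φ a) (n : ℕ) {z : ℂ} {t : ℝ}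
    (hz : ‖μ ^ n * z‖ < a) (ht : |t| < a) :
    f^[n] (φ.symm (z, t)) = φ.symm (μ ^ n * z, lam ^ n * t) := by
  induction n with
  | zero => simp
  | succ n ih =>
    rw [pow_succ', mul_assoc] at hz
    have h1 : ‖μ ^ n * z‖ < a := by
      refine lt_of_le_of_lt ?_ hz
      rw [norm_mul μ]
      exact le_mul_of_one_le_left (norm_nonneg _) hφ.one_lt.le
    rw [Function.iterate_succ_apply', ih h1,
      hφ.map_symm hz (lt_of_le_of_lt (hφ.abs_pow_mul_le n t) ht), pow_succ', pow_succ', mul_assoc,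
      mul_assoc]

theorem iterate_symm_inv_pow [T2Space M] (hφ : SaddleChart f p μ lam φ a) {i m : ℕ} (him : i ≤ m)
    {z : ℂ} {t : ℝ} (hz : ‖z‖ < a) (ht : |t| < a) :
    f^[i] (φ.symm ((μ⁻¹) ^ m * z, t)) = φ.symm ((μ⁻¹) ^ (m - i) * z, lam ^ i * t) := by
  have h1 : μ ^ i * ((μ⁻¹) ^ m * z) = (μ⁻¹) ^ (m - i) * z := by
    obtain ⟨j, rfl⟩ := Nat.exists_eq_add_of_le him
    have := pow_ne_zero i hφ.ne_zero
    rw [Nat.add_sub_cancel_left, pow_add, ← mul_assoc, ← mul_assoc, ← mul_pow,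
      mul_inv_cancel₀ hφ.ne_zero, one_pow, one_mul]
  rw [hφ.iterate_symm i (by rw [h1]; exact lt_of_le_of_lt (hφ.norm_inv_pow_mul_le _ _) hz) ht, h1]

theorem iterate_mem_box [T2Space M] (hφ : SaddleChart f p μ lam φ a) (hδ : δ ≤ a) {i m : ℕ}
    (him : i ≤ m) {z : ℂ} {t : ℝ} (hz : ‖z‖ < δ) (ht : |t| < δ) :
    f^[i] (φ.symm ((μ⁻¹) ^ m * z, t)) ∈ box φ δ := by
  rw [hφ.iterate_symm_inv_pow him (hz.trans_le hδ) (ht.trans_le hδ)]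
  have h1 := lt_of_le_of_lt (hφ.norm_inv_pow_mul_le (m - i) z) hz
  have h2 := lt_of_le_of_lt (hφ.abs_pow_mul_le i t) ht
  exact (mem_box (hφ.mem_target.2 ⟨h1.trans_le hδ, h2.trans_le hδ⟩)).2 ⟨h1, h2⟩

theorem symm_iterate_symm [T2Space M] (hφ : SaddleChart f p μ lam φ a) (n : ℕ) {z : ℂ}
    (hz : ‖z‖ < a) : f.symm^[n] (φ.symm (z, 0)) = φ.symm ((μ⁻¹) ^ n * z, 0) := by
  have h := hφ.iterate_symm_inv_pow (le_refl n) hz (t := 0) (by simpa using hφ.pos)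
  simp only [Nat.sub_self, pow_zero, one_mul, mul_zero] at h
  rw [← h]
  exact (f.left_inv.iterate n) _

theorem coord_iterate (hφ : SaddleChart f p μ lam φ a) {x : M} {n : ℕ}
    (hx : ∀ i ≤ n, f^[i] x ∈ φ.source) :
    φ (f^[n] x) = (μ ^ n * (φ x).1, lam ^ n * (φ x).2) := by
  induction n with
  | zero => simp
  | succ n ih =>
    have h1 := hx (n + 1) le_rfl
    rw [Function.iterate_succ_apply'] at h1 ⊢
    rw [hφ.conj _ (hx n n.le_succ) h1, ih fun i hi => hx i (hi.trans n.le_succ), pow_succ', pow_succ',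
      mul_assoc, mul_assoc]

theorem coord_lt (hφ : SaddleChart f p μ lam φ a) {x : M} (hx : x ∈ φ.source) :
    ‖(φ x).1‖ < a ∧ |(φ x).2| < a := hφ.mem_target.1 (φ.map_source hx)

/-- A forward orbit that stays in the domain of the coordinates lies on the stable axis. -/
theorem fst_eq_zero (hφ : SaddleChart f p μ lam φ a) {x : M} (hx : ∀ n, f^[n] x ∈ φ.source) :
    (φ x).1 = 0 := by
  by_contra h
  have h1 : Tendsto (fun n : ℕ => ‖μ‖ ^ n * ‖(φ x).1‖) atTop atTop :=
    (tendsto_pow_atTop_atTop_of_one_lt hφ.one_lt).atTop_mul_const (norm_pos_iff.2 h)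
  obtain ⟨n, hn⟩ := (h1.eventually_ge_atTop a).exists
  have h2 := (hφ.coord_lt (hx n)).1
  rw [hφ.coord_iterate fun i _ => hx i, norm_mul, norm_pow] at h2
  linarith

/-- A backward orbit that stays in the domain of the coordinates lies on the unstable disk. -/
theorem snd_eq_zero (hφ : SaddleChart f p μ lam φ a) {x : M} (hx : ∀ n, f.symm^[n] x ∈ φ.source) :
    (φ x).2 = 0 := by
  by_contra h
  have h1 : Tendsto (fun n : ℕ => lam ^ n * a) atTop (𝓝 0) := by
    simpa using (tendsto_pow_atTop_nhds_zero_of_lt_one hφ.lam_pos.le hφ.lam_lt).mul_const a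
  obtain ⟨n, hn⟩ := (h1.eventually (gt_mem_nhds (abs_pos.2 h))).exists
  have hinv : ∀ i ≤ n, f^[i] (f.symm^[n] x) = f.symm^[n - i] x := by
    intro i hi
    obtain ⟨j, rfl⟩ := Nat.exists_eq_add_of_le hi
    rw [Function.iterate_add_apply, Nat.add_sub_cancel_left]
    exact (f.right_inv.iterate i) _
  have h2 := hφ.coord_iterate (x := f.symm^[n] x) (n := n) fun i hi => by
    rw [hinv i hi]; exact hx _
  rw [hinv n le_rfl, Nat.sub_self, Function.iterate_zero, id] at h2
  have h3 : |(φ x).2| = lam ^ n * |(φ (f.symm^[n] x)).2| := by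
    rw [h2, abs_mul, abs_of_pos (pow_pos hφ.lam_pos n)]
  have h4 := mul_lt_mul_of_pos_left (hφ.coord_lt (hx n)).2 (pow_pos hφ.lam_pos n)
  linarith

theorem box_mem_nhds (hφ : SaddleChart f p μ lam φ a) (hδ : 0 < δ) : box φ δ ∈ 𝓝 p := by
  have ho : IsOpen (box φ δ) := φ.isOpen_inter_preimage (Metric.isOpen_ball.prod isOpen_Ioo)
  refine ho.mem_nhds ⟨hφ.mem_source, ?_⟩
  rw [mem_preimage, hφ.map_base]
  exact ⟨Metric.mem_ball_self hδ, by simpa using hδ⟩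

theorem exists_box_subset (hφ : SaddleChart f p μ lam φ a) {V : Set M} (hV : V ∈ 𝓝 p) :
    ∃ δ, 0 < δ ∧ δ ≤ a ∧ box φ δ ⊆ V := by
  have h0 : ((0 : ℂ), (0 : ℝ)) ∈ φ.target := hφ.mem_target.2 (by simp [hφ.pos])
  have h1 : φ.symm ⁻¹' V ∈ 𝓝 ((0 : ℂ), (0 : ℝ)) := by
    refine (φ.continuousAt_symm h0).preimage_mem_nhds ?_
    rwa [hφ.symm_zero]
  obtain ⟨ε, hε, hball⟩ := Metric.mem_nhds_iff.1 h1
  refine ⟨min ε a, lt_min hε hφ.pos, min_le_right _ _, ?_⟩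
  rintro x ⟨hx, hx2⟩
  rw [← φ.left_inv hx]
  apply hball
  obtain ⟨hz, ht⟩ := hx2
  rw [mem_ball_zero_iff] at hz
  rw [mem_ball_iff_norm, show φ x - (0, 0) = φ x from sub_zero _, Prod.norm_def]
  refine max_lt (hz.trans_le (min_le_left _ _)) ?_
  rw [Real.norm_eq_abs, abs_lt]
  exact ⟨by linarith [ht.1, min_le_left ε a], by linarith [ht.2, min_le_left ε a]⟩

end SaddleChart

/-! ### Passages along a homoclinic orbit -/

/-- Points `y` of `W` near `q`, whose images under `f^T` remain in `S` for `m` further steps,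
approach `w` after these. -/
def FirstPassage (f : M → M) (S W : Set M) (T : ℕ) (q w : M) (l : Filter ℕ) (m : ℕ → ℕ) : Prop :=
  ∀ V' ∈ 𝓝 q, ∀ V ∈ 𝓝 w, ∀ᶠ n in l, ∃ y ∈ V' ∩ W,
    (∀ i ≤ m n, f^[i] (f^[T] y) ∈ S) ∧ f^[m n] (f^[T] y) ∈ V

/-- Points `y` of `W` near `q` make an excursion `f^T`, return to a point `y'` near `q` after `n`
steps in `S`, make a second excursion `f^T` and approach `w` after `m` further steps in `S`. -/
def SecondPassage (f : M → M) (S W : Set M) (T : ℕ) (q w : M) (l : Filter ℕ) (m : ℕ → ℕ) : Prop :=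
  ∀ V' ∈ 𝓝 q, ∀ V ∈ 𝓝 w, ∀ᶠ n in l, ∃ y ∈ V' ∩ W, ∃ y' ∈ V', y' = f^[n] (f^[T] y) ∧
    (∀ i ≤ n, f^[i] (f^[T] y) ∈ S) ∧ (∀ i ≤ m n, f^[i] (f^[T] y') ∈ S) ∧ f^[m n] (f^[T] y') ∈ V

/-- A homoclinic orbit from `q = φ.symm (z₀, 0)` to `f^T q = φ.symm (0, t₀)` inside the cylinder of
radius `δ`, along which the inverse return map, with `t` measured in units of `t₀`, is folded. -/
structure HomoclinicModel (f : M ≃ₜ M) (φ : OpenPartialHomeomorph M (ℂ × ℝ)) (δ : ℝ) (T : ℕ) (q : M)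
    (z₀ : ℂ) (t₀ : ℝ) (ξ : ℂ) : Prop where
  q_eq : q = φ.symm (z₀, 0)
  z₀_lt : ‖z₀‖ < δ
  z₀_ne : z₀ ≠ 0
  t₀_lt : |t₀| < δ
  t₀_ne : t₀ ≠ 0
  ret : f^[T] q = φ.symm (0, t₀)
  model : ReturnModel (fun x => (φ (f.symm^[T] (φ.symm (x.1, t₀ * x.2)))).1)
    (fun x => (φ (f.symm^[T] (φ.symm (x.1, t₀ * x.2)))).2 / t₀) z₀ ξ
  ξ_ne : ξ ≠ 0

namespace HomoclinicModel

variable {T : ℕ} {q : M} {z₀ : ℂ} {t₀ : ℝ} {ξ : ℂ}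

theorem q_mem (hφ : SaddleChart f p μ lam φ a) (hδ : δ ≤ a)
    (hq : HomoclinicModel f φ δ T q z₀ t₀ ξ) : q ∈ box φ δ := by
  have h0 : |(0 : ℝ)| < δ := by rw [abs_zero]; exact (norm_nonneg _).trans_lt hq.z₀_lt
  rw [hq.q_eq]
  exact (SaddleChart.mem_box (hφ.mem_target.2 ⟨hq.z₀_lt.trans_le hδ, h0.trans_le hδ⟩)).2 ⟨hq.z₀_lt, h0⟩

theorem eventually_preimage (hφ : SaddleChart f p μ lam φ a) (hδ : δ ≤ a)
    (hq : HomoclinicModel f φ δ T q z₀ t₀ ξ) {V : Set M} (hV : V ∈ 𝓝 q) :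
    ∀ᶠ x in 𝓝 ((0 : ℂ), (1 : ℝ)), f.symm^[T] (φ.symm (x.1, t₀ * x.2)) ∈ V ∩ box φ δ ∧
      |t₀ * x.2| < δ := by
  have h0 : ((0 : ℂ), t₀) ∈ φ.target :=
    hφ.mem_target.2 ⟨by simpa using hφ.pos, hq.t₀_lt.trans_le hδ⟩
  have hc1 : ContinuousAt (fun x : ℂ × ℝ => (x.1, t₀ * x.2)) ((0 : ℂ), (1 : ℝ)) := by fun_prop
  have hbase : ((fun x : ℂ × ℝ => (x.1, t₀ * x.2)) ((0 : ℂ), (1 : ℝ))) = (0, t₀) := by simp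
  have hc2 : ContinuousAt (fun x : ℂ × ℝ => f.symm^[T] (φ.symm (x.1, t₀ * x.2)))
      ((0 : ℂ), (1 : ℝ)) := by
    refine (f.symm.continuous.iterate T).continuousAt.comp ?_
    refine ContinuousAt.comp (f := fun x : ℂ × ℝ => (x.1, t₀ * x.2)) ?_ hc1
    have h := φ.continuousAt_symm h0
    rwa [← hbase] at h
  have hval : f.symm^[T] (φ.symm (0, t₀ * 1)) = q := by
    rw [mul_one, ← hq.ret]
    exact (f.left_inv.iterate T) q
  have hbox : box φ δ ∈ 𝓝 q :=
    (φ.isOpen_inter_preimage (Metric.isOpen_ball.prod isOpen_Ioo)).mem_nhds (hq.q_mem hφ hδ)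
  refine (hc2.eventually ?_).and ?_
  · simp only [hval]
    exact Filter.inter_mem hV hbox
  · have : Continuous fun x : ℂ × ℝ => |t₀ * x.2| := by fun_prop
    refine this.continuousAt.eventually (gt_mem_nhds ?_)
    simpa using hq.t₀_lt

theorem exists_nhds_image (hφ : SaddleChart f p μ lam φ a) (hδ : δ ≤ a)
    (hq : HomoclinicModel f φ δ T q z₀ t₀ ξ) {V : Set (ℂ × ℝ)} (hV : V ∈ 𝓝 ((0 : ℂ), (1 : ℝ))) :
    ∀ᶠ y in 𝓝 q, y ∈ φ.source ∧ f^[T] y ∈ φ.source ∧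
      ((φ (f^[T] y)).1, (φ (f^[T] y)).2 / t₀) ∈ V := by
  have h0 : ((0 : ℂ), t₀) ∈ φ.target :=
    hφ.mem_target.2 ⟨by simpa using hφ.pos, hq.t₀_lt.trans_le hδ⟩
  have hc : ContinuousAt (f^[T]) q := (f.continuous.iterate T).continuousAt
  have hs : f^[T] q ∈ φ.source := by rw [hq.ret]; exact φ.map_target h0
  refine Filter.Eventually.and (φ.open_source.mem_nhds (hq.q_mem hφ hδ).1)
    ((hc.eventually (φ.open_source.mem_nhds hs)).and ?_)
  have h1 : ContinuousAt (fun y => φ (f^[T] y)) q := (φ.continuousAt hs).comp hc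
  have h2 : ContinuousAt (fun y => ((φ (f^[T] y)).1, (φ (f^[T] y)).2 / t₀)) q :=
    (continuous_fst.continuousAt.comp h1).prodMk ((continuous_snd.continuousAt.comp h1).div_const _)
  refine h2.eventually ?_
  have h3 : φ (f^[T] q) = (0, t₀) := by rw [hq.ret, φ.right_inv h0]
  simp only [h3, div_self hq.t₀_ne]
  exact hV

/-- The coordinates of `y` in terms of those of `f^T y`. -/
theorem preimage_coord (hq : HomoclinicModel f φ δ T q z₀ t₀ ξ) {y : M} (hy : f^[T] y ∈ φ.source) :
    f.symm^[T] (φ.symm ((φ (f^[T] y)).1, t₀ * ((φ (f^[T] y)).2 / t₀))) = y := by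
  rw [mul_div_cancel₀ _ hq.t₀_ne, Prod.mk.eta, φ.left_inv hy]
  exact (f.left_inv.iterate T) y

variable {r : ℝ} {c : Circle} {l : Filter ℕ} {m : ℕ → ℕ} {u v : Circle} {w : ℂ} {τ : ℝ}

theorem eventually_symm_mem (hφ : SaddleChart f p μ lam φ a)
    (hm : Tendsto m l atTop) (hw : ‖w‖ < a) {V : Set M} (hV : V ∈ 𝓝 (φ.symm (w, 0))) :
    ∀ᶠ n in l, ∀ t : ℝ, |t| < a → φ.symm (w, lam ^ m n * t) ∈ V := by
  have h0 : (w, (0 : ℝ)) ∈ φ.target := hφ.mem_target.2 ⟨hw, by simpa using hφ.pos⟩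
  have hc : ContinuousAt (fun t : ℝ => φ.symm (w, t)) 0 :=
    ContinuousAt.comp (f := fun t : ℝ => (w, t)) (φ.continuousAt_symm h0) (by fun_prop)
  obtain ⟨ε, hε, hball⟩ := Metric.mem_nhds_iff.1 (hc.preimage_mem_nhds hV)
  have h1 : Tendsto (fun n => lam ^ m n * a) l (𝓝 0) := by
    simpa using ((tendsto_pow_atTop_nhds_zero_of_lt_one hφ.lam_pos.le hφ.lam_lt).comp hm).mul_const a
  filter_upwards [h1.eventually (gt_mem_nhds hε)] with n hn t ht
  apply hball
  rw [mem_ball_zero_iff, Real.norm_eq_abs, abs_mul, abs_of_pos (pow_pos hφ.lam_pos _)]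
  exact lt_of_lt_of_le (mul_lt_mul_of_pos_left ht (pow_pos hφ.lam_pos _)) hn.le

theorem firstPassage [T2Space M] (hφ : SaddleChart f p μ lam φ a) (hδ : δ ≤ a)
    (hq : HomoclinicModel f φ δ T q z₀ t₀ ξ) (hr : 1 < r) (hμ : μ = r * c)
    (hm : Tendsto m l atTop) (hv : Tendsto (fun n => c ^ m n) l (𝓝 v)) (hwδ : ‖w‖ < δ)
    (hw : dot (ξ * v) w < 0) :
    FirstPassage f (box φ δ) (localUnstable φ) T q (φ.symm (w, 0)) l m := by
  intro V' hV' V hV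
  have h1 := hq.model.exists_first hr hμ hm hv hw (hq.eventually_preimage hφ hδ hV')
  filter_upwards [h1, eventually_symm_mem hφ hm (hwδ.trans_le hδ) hV] with n hn hnV
  obtain ⟨s, ⟨⟨hyV, hyb⟩, hs⟩, hG⟩ := hn
  have hy2 := (div_eq_zero_iff.1 hG).resolve_right hq.t₀_ne
  refine ⟨_, ⟨hyV, hyb.1, hy2⟩, ?_⟩
  have e1 : f^[T] (f.symm^[T] (φ.symm ((μ⁻¹) ^ m n * w, t₀ * s))) =
      φ.symm ((μ⁻¹) ^ m n * w, t₀ * s) := (f.right_inv.iterate T) _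
  simp only [e1]
  refine ⟨fun i hi => hφ.iterate_mem_box hδ hi hwδ hs, ?_⟩
  rw [hφ.iterate_symm_inv_pow le_rfl (hwδ.trans_le hδ) (hs.trans_le hδ), Nat.sub_self, pow_zero,
    one_mul]
  exact hnV _ (hs.trans_le hδ)

theorem secondPassage [T2Space M] (hφ : SaddleChart f p μ lam φ a) (hδ : δ ≤ a)
    (hq : HomoclinicModel f φ δ T q z₀ t₀ ξ) (hr : 1 < r) (hμ : μ = r * c) (hl : l ≤ atTop)
    (hm : Tendsto m l atTop) (hu : Tendsto (fun n => c ^ n) l (𝓝 u))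
    (hv : Tendsto (fun n => c ^ m n) l (𝓝 v)) (hz₀ : dot (ξ * u) z₀ < 0)
    (hτ : Tendsto (fun n => r ^ m n * lam ^ n) l (𝓝 τ)) (hwδ : ‖w‖ < δ)
    (hw : dot (ξ * v) w < τ) :
    SecondPassage f (box φ δ) (localUnstable φ) T q (φ.symm (w, 0)) l m := by
  intro V' hV' V hV
  have h1 := hq.model.exists_second hr hμ hφ.lam_pos hφ.lam_lt hl hm hu hz₀ hv hτ hw
    (hq.eventually_preimage hφ hδ hV')
  filter_upwards [h1, eventually_symm_mem hφ hm (hwδ.trans_le hδ) hV] with n hn hnV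
  obtain ⟨s, s', ⟨⟨hyV', hyb'⟩, hs⟩, ⟨⟨hyV, hyb⟩, hs'⟩, hG', hG⟩ := hn
  have hy2 := (div_eq_zero_iff.1 hG).resolve_right hq.t₀_ne
  rw [div_eq_iff hq.t₀_ne] at hG'
  set y' := f.symm^[T] (φ.symm ((μ⁻¹) ^ m n * w, t₀ * s)) with hy'
  have hZ : ‖(φ y').1‖ < δ := mem_ball_zero_iff.1 hyb'.2.1
  have e1 : f^[T] (f.symm^[T] (φ.symm ((μ⁻¹) ^ n * (φ y').1, t₀ * s'))) =
      φ.symm ((μ⁻¹) ^ n * (φ y').1, t₀ * s') := (f.right_inv.iterate T) _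
  have e2 : f^[T] y' = φ.symm ((μ⁻¹) ^ m n * w, t₀ * s) := (f.right_inv.iterate T) _
  refine ⟨_, ⟨hyV, hyb.1, hy2⟩, y', hyV', ?_⟩
  simp only [e1, e2]
  refine ⟨?_, fun i hi => hφ.iterate_mem_box hδ hi hZ hs', fun i hi => hφ.iterate_mem_box hδ hi hwδ hs,
    ?_⟩
  · rw [hφ.iterate_symm_inv_pow le_rfl (hZ.trans_le hδ) (hs'.trans_le hδ), Nat.sub_self, pow_zero,
      one_mul, show lam ^ n * (t₀ * s') = (φ y').2 by rw [hG']; ring, Prod.mk.eta,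
      φ.left_inv hyb'.1]
  · rw [hφ.iterate_symm_inv_pow le_rfl (hwδ.trans_le hδ) (hs.trans_le hδ), Nat.sub_self, pow_zero,
      one_mul]
    exact hnV _ (hs.trans_le hδ)

theorem dot_le_of_firstPassage (hφ : SaddleChart f p μ lam φ a) (hδ : δ ≤ a)
    (hq : HomoclinicModel f φ δ T q z₀ t₀ ξ) (hr : 1 < r) (hμ : μ = r * c) [NeBot l]
    (hv : Tendsto (fun n => c ^ m n) l (𝓝 v)) (hwa : ‖w‖ < a)
    (h : FirstPassage f φ.source (localUnstable φ) T q (φ.symm (w, 0)) l m) :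
    dot (ξ * v) w ≤ 0 := by
  refine hq.model.dot_le_of_limit hr hμ hv fun V hV ε hε => ?_
  have h0 : (w, (0 : ℝ)) ∈ φ.target := hφ.mem_target.2 ⟨hwa, by simpa using hφ.pos⟩
  have hw : ∀ᶠ x in 𝓝 (φ.symm (w, 0)), ‖(φ x).1 - w‖ < ε := by
    have hc : ContinuousAt (fun x => ‖(φ x).1 - w‖) (φ.symm (w, 0)) :=
      ((continuous_fst.continuousAt.comp (φ.continuousAt (φ.map_target h0))).sub
        continuousAt_const).norm
    refine hc.eventually (gt_mem_nhds ?_)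
    simpa only [φ.right_inv h0, sub_self, norm_zero] using hε
  filter_upwards [h _ (hq.exists_nhds_image hφ hδ hV) _ hw] with n hn
  obtain ⟨y, ⟨⟨-, hys, hyV⟩, hyW⟩, hyi, hyw⟩ := hn
  refine ⟨_, hyV, ?_⟩
  simp only [hq.preimage_coord hys, hyW.2]
  refine ⟨by simpa using hε, ?_⟩
  have := hφ.coord_iterate hyi
  rw [this] at hyw
  exact hyw

theorem dot_le_of_secondPassage (hφ : SaddleChart f p μ lam φ a) (hδ : δ ≤ a)
    (hq : HomoclinicModel f φ δ T q z₀ t₀ ξ) (hr : 1 < r) (hμ : μ = r * c) [NeBot l]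
    (hv : Tendsto (fun n => c ^ m n) l (𝓝 v))
    (hτ : Tendsto (fun n => r ^ m n * lam ^ n) l (𝓝 τ)) (hwa : ‖w‖ < a)
    (h : SecondPassage f φ.source (localUnstable φ) T q (φ.symm (w, 0)) l m) :
    dot (ξ * v) w ≤ τ := by
  refine hq.model.dot_le_of_limit hr hμ hv fun V hV ε hε => ?_
  have h0 : (w, (0 : ℝ)) ∈ φ.target := hφ.mem_target.2 ⟨hwa, by simpa using hφ.pos⟩
  have hw : ∀ᶠ x in 𝓝 (φ.symm (w, 0)), ‖(φ x).1 - w‖ < ε := by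
    have hc : ContinuousAt (fun x => ‖(φ x).1 - w‖) (φ.symm (w, 0)) :=
      ((continuous_fst.continuousAt.comp (φ.continuousAt (φ.map_target h0))).sub
        continuousAt_const).norm
    refine hc.eventually (gt_mem_nhds ?_)
    simpa only [φ.right_inv h0, sub_self, norm_zero] using hε
  -- the height of the sheet is `lamⁿ s` with `s` near `1`
  have hτs : ∀ᶠ P : ℝ × (ℂ × ℝ) in 𝓝 τ ×ˢ 𝓝 ((0 : ℂ), (1 : ℝ)), |P.1 * P.2.2 - τ| < ε := by
    rw [← nhds_prod_eq]
    have hc : Continuous fun P : ℝ × (ℂ × ℝ) => |P.1 * P.2.2 - τ| := by fun_prop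
    refine hc.continuousAt.eventually (gt_mem_nhds ?_)
    simpa using hε
  obtain ⟨pa, hpa, pb, hpb, hpab⟩ := eventually_prod_iff.1 hτs
  filter_upwards [h _ (hq.exists_nhds_image hφ hδ (Filter.inter_mem hV hpb)) _ hw,
    hτ.eventually hpa] with n hn hna
  obtain ⟨y, ⟨⟨-, hys, -, hyb⟩, hyW⟩, y', ⟨hy's, hy'T, hy'V, -⟩, hy', hyn, hyi, hyw⟩ := hn
  refine ⟨_, hy'V, ?_⟩
  simp only [hq.preimage_coord hy'T]
  have e1 := hφ.coord_iterate hyn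
  rw [← hy'] at e1
  constructor
  · have := hpab hna hyb
    simp only at this
    convert this using 2
    rw [e1]
    simp only
    ring
  · have := hφ.coord_iterate hyi
    rw [this] at hyw
    exact hyw

end HomoclinicModel

end Chart

/-! ### Topologically conjugate homoclinic tangencies -/

/-- A saddle-focus with a folded homoclinic orbit, together with the coordinates and constants that
describe it: `μ = r c` with `c` on the unit circle. -/
structure TangencySystem (M : Type*) [TopologicalSpace M] where
  f : M ≃ₜ M
  p : M
  μ : ℂ
  r : ℝ
  c : Circle
  lam : ℝ
  φ : OpenPartialHomeomorph M (ℂ × ℝ)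
  a : ℝ
  δ : ℝ
  T : ℕ
  q : M
  z₀ : ℂ
  t₀ : ℝ
  ξ : ℂ
  chart : SaddleChart f p μ lam φ a
  δ_le : δ ≤ a
  model : HomoclinicModel f φ δ T q z₀ t₀ ξ
  one_lt : 1 < r
  polar : μ = r * c

/-- A conjugacy between two systems that respects the fixed points, the homoclinic points and the
chosen neighbourhoods. -/
structure TangencySystem.Conj {M : Type*} [TopologicalSpace M] (S₀ S₁ : TangencySystem M)
    (h : M ≃ₜ M) : Prop where
  conj : ∀ x, h (S₀.f x) = S₁.f (h x)
  map_p : h S₀.p = S₁.p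
  map_q : h S₀.q = S₁.q
  T_eq : S₀.T = S₁.T
  maps : ∀ x ∈ box S₀.φ S₀.δ, h x ∈ S₁.φ.source
  maps_symm : ∀ x ∈ box S₁.φ S₁.δ, h.symm x ∈ S₀.φ.source

/-- A continuous map sending an open half plane into a closed one sends its closure there too. The
similarities `μ₀` and `μ₁` reduce the check to a neighbourhood of `0`. -/
theorem dot_le_of_local {μ₀ μ₁ : ℂ} {r₀ r₁ : ℝ} {c₀ c₁ v₀ v₁ : Circle} {δ τ₀ τ₁ : ℝ} {ξ₀ ξ₁ : ℂ}
    {H : ℂ → ℂ} (hr₀ : 1 < r₀) (hr₁ : 1 < r₁) (hμ₀ : μ₀ = r₀ * c₀) (hμ₁ : μ₁ = r₁ * c₁) (hδ : 0 < δ)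
    (hξ₀ : ξ₀ ≠ 0) (hH : Continuous H) (hconj : ∀ w, H (μ₀ * w) = μ₁ * H w)
    (hloc : ∀ (j : ℕ) (w : ℂ), ‖w‖ < δ → dot (ξ₀ * (v₀ * (c₀⁻¹) ^ j : Circle)) w < τ₀ * (r₀⁻¹) ^ j →
      dot (ξ₁ * (v₁ * (c₁⁻¹) ^ j : Circle)) (H w) ≤ τ₁ * (r₁⁻¹) ^ j) (w : ℂ)
    (hw : dot (ξ₀ * v₀) w ≤ τ₀) : dot (ξ₁ * v₁) (H w) ≤ τ₁ := by
  have hscale : ∀ {μ : ℂ} {r : ℝ} {c v : Circle} {ξ : ℂ} (j : ℕ) (w : ℂ), 1 < r → μ = r * c →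
      dot (ξ * (v * (c⁻¹) ^ j : Circle)) w = (r⁻¹) ^ j * dot (ξ * v) (μ ^ j * w) := by
    intro μ r c v ξ j w hr hμ
    have h1 := dot_mul_circle_pow hμ (ξ * (v * (c⁻¹) ^ j : Circle)) w j
    have h2 : ξ * ((v * (c⁻¹) ^ j : Circle) : ℂ) * ((c ^ j : Circle) : ℂ) = ξ * v := by
      rw [mul_assoc, ← Circle.coe_mul, mul_assoc, ← mul_pow, inv_mul_cancel, one_pow, mul_one]
    rw [h2] at h1
    rw [h1, ← mul_assoc, ← mul_pow, inv_mul_cancel₀ (by linarith), one_pow, one_mul]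
  have hit : ∀ j w, H (μ₀ ^ j * w) = μ₁ ^ j * H w := by
    intro j
    induction j with
    | zero => simp
    | succ j ih => intro w; rw [pow_succ', mul_assoc, hconj, ih, pow_succ', mul_assoc]
  have hstrict : ∀ w, dot (ξ₀ * v₀) w < τ₀ → dot (ξ₁ * v₁) (H w) ≤ τ₁ := by
    intro w hw
    obtain ⟨j, hj⟩ := exists_inv_pow_mul_mem_ball (μ := μ₀)
      (by rw [norm_eq_of_polar hr₀ hμ₀]; exact hr₀) hδ w
    rw [mem_ball_zero_iff] at hj
    have e1 : μ₀ ^ j * ((μ₀⁻¹) ^ j * w) = w := by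
      rw [← mul_assoc, ← mul_pow, mul_inv_cancel₀ (ne_zero_of_polar hr₀ hμ₀), one_pow, one_mul]
    have p0 : 0 < (r₀⁻¹) ^ j := by positivity
    have p1 : 0 < (r₁⁻¹) ^ j := by positivity
    have h1 := hloc j _ hj (by
      rw [hscale j _ hr₀ hμ₀, e1, mul_comm τ₀]
      exact mul_lt_mul_of_pos_left hw p0)
    rw [hscale j _ hr₁ hμ₁, ← hit, e1, mul_comm τ₁] at h1
    exact le_of_mul_le_mul_left h1 p1
  have hn : ξ₀ * v₀ ≠ 0 := mul_ne_zero hξ₀ v₀.coe_ne_zero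
  have hlim : Tendsto (fun ε : ℝ => dot (ξ₁ * v₁) (H (w + ((-ε : ℝ) : ℂ) * (ξ₀ * v₀)))) (𝓝[>] 0)
      (𝓝 (dot (ξ₁ * v₁) (H w))) := by
    have hc : Continuous fun ε : ℝ => dot (ξ₁ * v₁) (H (w + ((-ε : ℝ) : ℂ) * (ξ₀ * v₀))) := by
      fun_prop
    have := hc.tendsto 0
    simp only [neg_zero, Complex.ofReal_zero, zero_mul, add_zero] at this
    exact this.mono_left nhdsWithin_le_nhds
  refine le_of_tendsto hlim (eventually_mem_nhdsWithin.mono fun ε hε => hstrict _ ?_)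
  rw [dot_add, dot_real_mul]
  have := mul_pos (show 0 < ε from hε) (dot_self_pos hn)
  linarith

namespace TangencySystem.Conj

variable {M : Type*} [TopologicalSpace M] {S₀ S₁ : TangencySystem M} {h : M ≃ₜ M}

theorem symm (H : S₀.Conj S₁ h) : S₁.Conj S₀ h.symm where
  conj x := by
    rw [Homeomorph.symm_apply_eq, H.conj, h.apply_symm_apply]
  map_p := by rw [← H.map_p, h.symm_apply_apply]
  map_q := by rw [← H.map_q, h.symm_apply_apply]
  T_eq := H.T_eq.symm
  maps := H.maps_symm
  maps_symm := H.maps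

theorem iterate (H : S₀.Conj S₁ h) (n : ℕ) (x : M) : h (S₀.f^[n] x) = S₁.f^[n] (h x) :=
  Function.Semiconj.iterate_right (f := h) (ga := S₀.f) (gb := S₁.f) H.conj n x

theorem iterate_symm (H : S₀.Conj S₁ h) (n : ℕ) (x : M) :
    h (S₀.f.symm^[n] x) = S₁.f.symm^[n] (h x) := by
  refine Function.Semiconj.iterate_right (f := h) (ga := S₀.f.symm) (gb := S₁.f.symm) (fun x => ?_) n x
  rw [Homeomorph.eq_symm_apply, ← H.conj, S₀.f.apply_symm_apply]

theorem δ_pos (S : TangencySystem M) : 0 < S.δ := (norm_nonneg _).trans_lt S.model.z₀_lt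

theorem symm_mem_box (S : TangencySystem M) {z : ℂ} (hz : ‖z‖ < S.δ) :
    S.φ.symm (z, 0) ∈ box S.φ S.δ := by
  have h0 : |(0 : ℝ)| < S.δ := by simpa using δ_pos S
  exact (SaddleChart.mem_box (S.chart.mem_target.2 ⟨hz.trans_le S.δ_le, h0.trans_le S.δ_le⟩)).2 ⟨hz, h0⟩

/-- A conjugacy maps the unstable disk into the unstable disk, since it maps backward orbits that
remain near one fixed point to such orbits at the other. -/
theorem map_localUnstable [T2Space M] (H : S₀.Conj S₁ h) {x : M} (hx : x ∈ box S₀.φ S₀.δ)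
    (hx0 : (S₀.φ x).2 = 0) : h x ∈ localUnstable S₁.φ := by
  refine ⟨H.maps x hx, S₁.chart.snd_eq_zero fun n => ?_⟩
  rw [← H.iterate_symm]
  apply H.maps
  have hz : ‖(S₀.φ x).1‖ < S₀.δ := mem_ball_zero_iff.1 hx.2.1
  have hx' : x = S₀.φ.symm ((S₀.φ x).1, 0) := by
    rw [← hx0, Prod.mk.eta, S₀.φ.left_inv hx.1]
  rw [hx', S₀.chart.symm_iterate_symm n (hz.trans_le S₀.δ_le)]
  exact symm_mem_box S₀ ((S₀.chart.norm_inv_pow_mul_le n _).trans_lt hz)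

theorem map_symm_eq [T2Space M] (H : S₀.Conj S₁ h) {z : ℂ} (hz : ‖z‖ < S₀.δ) :
    h (S₀.φ.symm (z, 0)) = S₁.φ.symm ((S₁.φ (h (S₀.φ.symm (z, 0)))).1, 0) ∧
      ‖(S₁.φ (h (S₀.φ.symm (z, 0)))).1‖ < S₁.a := by
  have hb := symm_mem_box S₀ hz
  have ht : (z, (0 : ℝ)) ∈ S₀.φ.target :=
    S₀.chart.mem_target.2 ⟨hz.trans_le S₀.δ_le, by simpa using S₀.chart.pos⟩
  have h1 := H.map_localUnstable hb (by rw [S₀.φ.right_inv ht])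
  refine ⟨?_, (S₁.chart.coord_lt h1.1).1⟩
  have h2 := S₁.φ.left_inv h1.1
  rwa [← Prod.mk.eta (p := S₁.φ _), h1.2, eq_comm] at h2

theorem continuousOn_fst (H : S₀.Conj S₁ h) :
    ContinuousOn (fun z => (S₁.φ (h (S₀.φ.symm (z, 0)))).1) (Metric.ball 0 S₀.δ) := by
  have h1 : ContinuousOn (fun z : ℂ => S₀.φ.symm (z, 0)) (Metric.ball 0 S₀.δ) :=
    S₀.φ.continuousOn_symm.comp (by fun_prop) fun z hz =>
      S₀.chart.mem_target.2 ⟨(mem_ball_zero_iff.1 hz).trans_le S₀.δ_le, by simpa using S₀.chart.pos⟩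
  exact continuous_fst.comp_continuousOn (S₁.φ.continuousOn.comp (h.continuous.comp_continuousOn h1)
    fun z hz => H.maps _ (symm_mem_box S₀ (mem_ball_zero_iff.1 hz)))

theorem fst_inv_mul [T2Space M] (H : S₀.Conj S₁ h) {z : ℂ} (hz : ‖z‖ < S₀.δ) :
    (S₁.φ (h (S₀.φ.symm (S₀.μ⁻¹ * z, 0)))).1 = S₁.μ⁻¹ * (S₁.φ (h (S₀.φ.symm (z, 0)))).1 := by
  have hz' : ‖S₀.μ⁻¹ * z‖ < S₀.δ := by
    simpa using (S₀.chart.norm_inv_pow_mul_le 1 z).trans_lt hz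
  have e1 : S₀.f (S₀.φ.symm (S₀.μ⁻¹ * z, 0)) = S₀.φ.symm (z, 0) := by
    have := S₀.chart.iterate_symm_inv_pow (le_refl 1) (hz.trans_le S₀.δ_le) (t := 0)
      (by simpa using S₀.chart.pos)
    simpa using this
  have h1 := S₁.chart.conj _ (H.maps _ (symm_mem_box S₀ hz'))
    (by rw [← H.conj, e1]; exact H.maps _ (symm_mem_box S₀ hz))
  rw [← H.conj, e1] at h1
  rw [h1, ← mul_assoc, inv_mul_cancel₀ S₁.chart.ne_zero, one_mul]

theorem fst_fst [T2Space M] (H : S₀.Conj S₁ h) {z : ℂ} (hz : ‖z‖ < S₀.δ) :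
    (S₀.φ (h.symm (S₁.φ.symm ((S₁.φ (h (S₀.φ.symm (z, 0)))).1, 0)))).1 = z := by
  have ht : (z, (0 : ℝ)) ∈ S₀.φ.target :=
    S₀.chart.mem_target.2 ⟨hz.trans_le S₀.δ_le, by simpa using S₀.chart.pos⟩
  rw [← (H.map_symm_eq hz).1, h.symm_apply_apply, S₀.φ.right_inv ht]

theorem fst_zero (H : S₀.Conj S₁ h) : (S₁.φ (h (S₀.φ.symm (0, 0)))).1 = 0 := by
  rw [S₀.chart.symm_zero, H.map_p, S₁.chart.map_base]; rfl

/-- The conjugacy between the unstable disks, in coordinates, extends to a homeomorphism of the plane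
that conjugates `μ₀` to `μ₁`. -/
theorem exists_plane [T2Space M] (H : S₀.Conj S₁ h) : ∃ Θ : ℂ ≃ₜ ℂ, (∀ w, Θ (S₀.μ * w) = S₁.μ * Θ w) ∧
    (∀ z, ‖z‖ < S₀.δ → h (S₀.φ.symm (z, 0)) = S₁.φ.symm (Θ z, 0) ∧ ‖Θ z‖ < S₁.a) ∧
    (∀ z, ‖z‖ < S₁.δ → h.symm (S₁.φ.symm (z, 0)) = S₀.φ.symm (Θ.symm z, 0) ∧ ‖Θ.symm z‖ < S₀.a) := by
  obtain ⟨Θ, h1, h2, h3⟩ := exists_homeomorph_extension S₀.chart.one_lt S₁.chart.one_lt (δ_pos S₀)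
    (δ_pos S₁) H.continuousOn_fst H.symm.continuousOn_fst H.fst_zero H.symm.fst_zero
    (fun z hz => H.fst_inv_mul (mem_ball_zero_iff.1 hz))
    (fun z hz => H.symm.fst_inv_mul (mem_ball_zero_iff.1 hz))
    (fun z hz _ => H.fst_fst (mem_ball_zero_iff.1 hz))
    (fun z hz _ => H.symm.fst_fst (mem_ball_zero_iff.1 hz))
  refine ⟨Θ, h1, fun z hz => ?_, fun z hz => ?_⟩
  · rw [h2 z (mem_ball_zero_iff.2 hz)]
    exact H.map_symm_eq hz
  · rw [h3 z (mem_ball_zero_iff.2 hz)]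
    exact H.symm.map_symm_eq hz

variable {l : Filter ℕ} {m : ℕ → ℕ} {u₀ u₁ v₀ v₁ : Circle} {w : M}

theorem nhds_box (S : TangencySystem M) : box S.φ S.δ ∈ 𝓝 S.q :=
  (S.φ.isOpen_inter_preimage (Metric.isOpen_ball.prod isOpen_Ioo)).mem_nhds
    (S.model.q_mem S.chart S.δ_le)

theorem map_firstPassage [T2Space M] (H : S₀.Conj S₁ h)
    (hp : FirstPassage S₀.f (box S₀.φ S₀.δ) (localUnstable S₀.φ) S₀.T S₀.q w l m) :
    FirstPassage S₁.f S₁.φ.source (localUnstable S₁.φ) S₁.T S₁.q (h w) l m := by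
  intro V' hV' V hV
  rw [← H.map_q] at hV'
  filter_upwards [hp _ (Filter.inter_mem (nhds_box S₀) (h.continuous.continuousAt.preimage_mem_nhds hV'))
    _ (h.continuous.continuousAt.preimage_mem_nhds hV)] with n hn
  obtain ⟨y, ⟨⟨hyb, hyV⟩, hyW⟩, hyi, hyw⟩ := hn
  refine ⟨h y, ⟨hyV, H.map_localUnstable hyb hyW.2⟩, fun i hi => ?_, ?_⟩
  · rw [← H.T_eq, ← H.iterate, ← H.iterate]; exact H.maps _ (hyi i hi)
  · rw [← H.T_eq, ← H.iterate, ← H.iterate]; exact hyw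

theorem map_secondPassage [T2Space M] (H : S₀.Conj S₁ h)
    (hp : SecondPassage S₀.f (box S₀.φ S₀.δ) (localUnstable S₀.φ) S₀.T S₀.q w l m) :
    SecondPassage S₁.f S₁.φ.source (localUnstable S₁.φ) S₁.T S₁.q (h w) l m := by
  intro V' hV' V hV
  rw [← H.map_q] at hV'
  filter_upwards [hp _ (Filter.inter_mem (nhds_box S₀) (h.continuous.continuousAt.preimage_mem_nhds hV'))
    _ (h.continuous.continuousAt.preimage_mem_nhds hV)] with n hn
  obtain ⟨y, ⟨⟨hyb, hyV⟩, hyW⟩, y', hy'V, hy', hyn, hyi, hyw⟩ := hn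
  refine ⟨h y, ⟨hyV, H.map_localUnstable hyb hyW.2⟩, h y', hy'V.2, ?_, fun i hi => ?_, fun i hi => ?_, ?_⟩
  · rw [hy', ← H.T_eq, H.iterate, H.iterate]
  · rw [← H.T_eq, ← H.iterate, ← H.iterate]; exact H.maps _ (hyn i hi)
  · rw [← H.T_eq, ← H.iterate, ← H.iterate]; exact H.maps _ (hyi i hi)
  · rw [← H.T_eq, ← H.iterate, ← H.iterate]; exact hyw

theorem tendsto_pow_sub {c v : Circle} (hm : Tendsto m l atTop)
    (hv : Tendsto (fun n => c ^ m n) l (𝓝 v)) (j : ℕ) :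
    Tendsto (fun n => c ^ (m n - j)) l (𝓝 (v * (c⁻¹) ^ j)) := by
  refine (hv.mul_const ((c⁻¹) ^ j)).congr' ?_
  filter_upwards [hm.eventually_ge_atTop j] with n hn
  obtain ⟨i, hi⟩ := Nat.exists_eq_add_of_le hn
  rw [hi, Nat.add_sub_cancel_left, pow_add, mul_right_comm, ← mul_pow, mul_inv_cancel, one_pow, one_mul]

theorem tendsto_pow_sub_mul {r τ : ℝ} (hr : 1 < r) {e : ℕ → ℝ} (hm : Tendsto m l atTop)
    (hτ : Tendsto (fun n => r ^ m n * e n) l (𝓝 τ)) (j : ℕ) :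
    Tendsto (fun n => r ^ (m n - j) * e n) l (𝓝 (τ * (r⁻¹) ^ j)) := by
  refine (hτ.mul_const ((r⁻¹) ^ j)).congr' ?_
  filter_upwards [hm.eventually_ge_atTop j] with n hn
  obtain ⟨i, hi⟩ := Nat.exists_eq_add_of_le hn
  have h0 : r ^ j ≠ 0 := pow_ne_zero _ (by linarith)
  rw [hi, Nat.add_sub_cancel_left, pow_add, inv_pow]
  field_simp

theorem dot_le_zero [T2Space M] (H : S₀.Conj S₁ h) {Θ : ℂ → ℂ} (hΘ : Continuous Θ)
    (hΘc : ∀ w, Θ (S₀.μ * w) = S₁.μ * Θ w)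
    (hΘh : ∀ z, ‖z‖ < S₀.δ → h (S₀.φ.symm (z, 0)) = S₁.φ.symm (Θ z, 0) ∧ ‖Θ z‖ < S₁.a) [NeBot l]
    (hm : Tendsto m l atTop) (hv₀ : Tendsto (fun n => S₀.c ^ m n) l (𝓝 v₀))
    (hv₁ : Tendsto (fun n => S₁.c ^ m n) l (𝓝 v₁)) (w : ℂ) (hw : dot (S₀.ξ * v₀) w ≤ 0) :
    dot (S₁.ξ * v₁) (Θ w) ≤ 0 := by
  refine dot_le_of_local S₀.one_lt S₁.one_lt S₀.polar S₁.polar (δ_pos S₀) S₀.model.ξ_ne hΘ hΘc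
    (fun j z hz hdot => ?_) w hw
  rw [zero_mul] at hdot ⊢
  have hm' : Tendsto (fun n => m n - j) l atTop := (tendsto_sub_atTop_nat j).comp hm
  have h1 := S₀.model.firstPassage S₀.chart S₀.δ_le S₀.one_lt S₀.polar hm'
    (tendsto_pow_sub hm hv₀ j) hz hdot
  have h2 := H.map_firstPassage h1
  rw [(hΘh z hz).1] at h2
  exact S₁.model.dot_le_of_firstPassage S₁.chart S₁.δ_le S₁.one_lt S₁.polar
    (tendsto_pow_sub hm hv₁ j) (hΘh z hz).2 h2

theorem dot_le_tau [T2Space M] (H : S₀.Conj S₁ h) {Θ : ℂ → ℂ} (hΘ : Continuous Θ)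
    (hΘc : ∀ w, Θ (S₀.μ * w) = S₁.μ * Θ w)
    (hΘh : ∀ z, ‖z‖ < S₀.δ → h (S₀.φ.symm (z, 0)) = S₁.φ.symm (Θ z, 0) ∧ ‖Θ z‖ < S₁.a) [NeBot l]
    (hl : l ≤ atTop) (hm : Tendsto m l atTop) (hu₀ : Tendsto (fun n => S₀.c ^ n) l (𝓝 u₀))
    (hz₀ : dot (S₀.ξ * u₀) S₀.z₀ < 0) (hv₀ : Tendsto (fun n => S₀.c ^ m n) l (𝓝 v₀))
    (hv₁ : Tendsto (fun n => S₁.c ^ m n) l (𝓝 v₁)) {τ₀ τ₁ : ℝ}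
    (hτ₀ : Tendsto (fun n => S₀.r ^ m n * S₀.lam ^ n) l (𝓝 τ₀))
    (hτ₁ : Tendsto (fun n => S₁.r ^ m n * S₁.lam ^ n) l (𝓝 τ₁)) (w : ℂ)
    (hw : dot (S₀.ξ * v₀) w ≤ τ₀) : dot (S₁.ξ * v₁) (Θ w) ≤ τ₁ := by
  refine dot_le_of_local S₀.one_lt S₁.one_lt S₀.polar S₁.polar (δ_pos S₀) S₀.model.ξ_ne hΘ hΘc
    (fun j z hz hdot => ?_) w hw
  have hm' : Tendsto (fun n => m n - j) l atTop := (tendsto_sub_atTop_nat j).comp hm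
  have h1 := S₀.model.secondPassage S₀.chart S₀.δ_le S₀.one_lt S₀.polar hl hm' hu₀
    (tendsto_pow_sub hm hv₀ j) hz₀ (tendsto_pow_sub_mul S₀.one_lt hm hτ₀ j) hz hdot
  have h2 := H.map_secondPassage h1
  rw [(hΘh z hz).1] at h2
  exact S₁.model.dot_le_of_secondPassage S₁.chart S₁.δ_le S₁.one_lt S₁.polar
    (tendsto_pow_sub hm hv₁ j) (tendsto_pow_sub_mul S₁.one_lt hm hτ₁ j) (hΘh z hz).2 h2

theorem plane_symm_conj {Θ : ℂ ≃ₜ ℂ} {μ₀ μ₁ : ℂ} (hΘc : ∀ w, Θ (μ₀ * w) = μ₁ * Θ w) (w : ℂ) :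
    Θ.symm (μ₁ * w) = μ₀ * Θ.symm w := by
  rw [Homeomorph.symm_apply_eq, hΘc, Θ.apply_symm_apply]

/-- The rotation angles of conjugate systems agree up to sign, when the first is irrational. -/
theorem circle_eq_or_eq_inv [T2Space M] (H : S₀.Conj S₁ h)
    (hd : ∀ x, MapClusterPt x atTop (fun n : ℕ => S₀.c ^ n)) : S₁.c = S₀.c ∨ S₁.c = S₀.c⁻¹ := by
  obtain ⟨Θ, hΘc, hΘ₀, hΘ₁⟩ := H.exists_plane
  have hiff : ∀ U : Ultrafilter ℕ, ↑U ≤ (atTop : Filter ℕ) → ∀ x y,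
      Tendsto (fun n : ℕ => S₀.c ^ n) U (𝓝 x) → Tendsto (fun n : ℕ => S₁.c ^ n) U (𝓝 y) →
      ∀ w, dot (S₀.ξ * x) w ≤ 0 ↔ dot (S₁.ξ * y) (Θ w) ≤ 0 := by
    intro U hU x y hx hy w
    refine ⟨H.dot_le_zero Θ.continuous hΘc hΘ₀ (m := id) hU hx hy w, fun hw => ?_⟩
    have := H.symm.dot_le_zero Θ.symm.continuous (plane_symm_conj hΘc) hΘ₁ (m := id) hU hy hx (Θ w) hw
    rwa [Θ.symm_apply_apply] at this
  have hcancel : ∀ (S : TangencySystem M) (x x' : Circle),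
      (∀ w, dot (S.ξ * x) w ≤ 0 → dot (S.ξ * x') w ≤ 0) → x = x' := by
    intro S x x' hx
    have := eq_of_halfPlane_eq (by rw [norm_mul, norm_mul, Circle.norm_coe, Circle.norm_coe])
      (mul_ne_zero S.model.ξ_ne x.coe_ne_zero) hx
    exact Circle.ext (mul_left_cancel₀ S.model.ξ_ne this)
  refine eq_or_eq_inv_of_limits_determined hd fun U V hU hV x x' y y' hx hx' hy hy' => ⟨?_, ?_⟩
  · rintro rfl
    refine hcancel S₁ y y' fun w hw => ?_
    obtain ⟨w, rfl⟩ := Θ.surjective w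
    exact (hiff V hV x y' hx' hy' w).1 ((hiff U hU x y hx hy w).2 hw)
  · rintro rfl
    refine hcancel S₀ x x' fun w hw => ?_
    exact (hiff V hV x' y hx' hy' w).2 ((hiff U hU x y hx hy w).1 hw)

theorem pos_of_halfPlane {Θ : ℂ ≃ₜ ℂ} (h0 : Θ 0 = 0) {n₀ n₁ : ℂ} (hn₁ : n₁ ≠ 0) {τ₀ τ₁ : ℝ}
    (hτ : 0 < τ₀) (hΘ : ∀ w, dot n₀ w ≤ τ₀ → dot n₁ (Θ w) ≤ τ₁) : 0 < τ₁ := by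
  have hc : Continuous fun ε : ℝ => dot n₀ (Θ.symm ((ε : ℂ) * n₁)) := by fun_prop
  have h1 : ∀ᶠ ε : ℝ in 𝓝 0, dot n₀ (Θ.symm ((ε : ℂ) * n₁)) < τ₀ := by
    refine hc.continuousAt.eventually (gt_mem_nhds ?_)
    have : Θ.symm 0 = 0 := by rw [Homeomorph.symm_apply_eq, h0]
    simpa [this, dot] using hτ
  obtain ⟨ε, h2, hε⟩ := ((h1.filter_mono nhdsWithin_le_nhds).and
    (eventually_mem_nhdsWithin (s := Ioi (0 : ℝ)))).exists
  have h3 := hΘ _ h2.le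
  rw [Θ.apply_symm_apply, dot_real_mul] at h3
  exact (mul_pos hε (dot_self_pos hn₁)).trans_le h3

/-- Iterates `m` for which `rᵐ lamⁿ` lies between `r⁻¹` and `1`. -/
theorem exists_balanced {r lam : ℝ} (hr : 1 < r) (h0 : 0 < lam) (h1 : lam < 1) :
    ∃ m : ℕ → ℕ, Tendsto m atTop atTop ∧ ∀ n, r ^ m n * lam ^ n ≤ 1 ∧ r⁻¹ ≤ r ^ m n * lam ^ n := by
  have hex : ∀ n : ℕ, ∃ m : ℕ, r ^ m ≤ (lam ^ n)⁻¹ ∧ (lam ^ n)⁻¹ < r ^ (m + 1) := fun n =>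
    exists_nat_pow_near ((one_le_inv₀ (pow_pos h0 n)).2 (pow_le_one₀ h0.le h1.le)) hr
  choose m hm1 hm2 using hex
  refine ⟨m, tendsto_atTop.2 fun B => ?_, fun n => ⟨?_, ?_⟩⟩
  · have h2 : Tendsto (fun n : ℕ => (lam⁻¹) ^ n) atTop atTop :=
      tendsto_pow_atTop_atTop_of_one_lt ((one_lt_inv₀ h0).2 h1)
    filter_upwards [h2.eventually_ge_atTop (r ^ B)] with n hn
    rw [inv_pow] at hn
    exact Nat.lt_succ_iff.1 ((pow_lt_pow_iff_right₀ hr).1 (hn.trans_lt (hm2 n)))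
  · have := mul_le_mul_of_nonneg_right (hm1 n) (pow_pos h0 n).le
    rwa [inv_mul_cancel₀ (pow_pos h0 n).ne'] at this
  · have h3 := mul_lt_mul_of_pos_right (hm2 n) (pow_pos h0 n)
    rw [inv_mul_cancel₀ (pow_pos h0 n).ne', pow_succ] at h3
    rw [inv_le_iff_one_le_mul₀ (by linarith)]
    nlinarith

theorem eq_of_tendsto_mul_pow {x y τ₀ τ₁ : ℝ} (hx : 0 < x) (hy : 0 < y) (hτ₀ : 0 < τ₀) (hτ₁ : 0 < τ₁)
    [NeBot l] (hl : l ≤ atTop) {e : ℕ → ℝ} (h0 : Tendsto (fun n => e n * x ^ n) l (𝓝 τ₀))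
    (h1 : Tendsto (fun n => e n * y ^ n) l (𝓝 τ₁)) : x = y := by
  have key : ∀ {x y τ₀ τ₁ : ℝ}, 0 < x → 0 < y → 0 < τ₀ →
      Tendsto (fun n => e n * x ^ n) l (𝓝 τ₀) → Tendsto (fun n => e n * y ^ n) l (𝓝 τ₁) → ¬ x < y := by
    intro x y τ₀ τ₁ hx hy hτ₀ h0 h1 hlt
    have h2 : Tendsto (fun n : ℕ => (x / y) ^ n) l (𝓝 0) :=
      (tendsto_pow_atTop_nhds_zero_of_lt_one (by positivity) ((div_lt_one hy).2 hlt)).mono_left hl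
    have h3 := h1.mul h2
    rw [mul_zero] at h3
    refine hτ₀.ne (tendsto_nhds_unique (h3.congr fun n => ?_) h0)
    have := pow_ne_zero n hy.ne'
    rw [div_pow]; field_simp
  exact le_antisymm (not_lt.1 (key hy hx hτ₁ h1 h0)) (not_lt.1 (key hx hy hτ₀ h0 h1))

/-- Conjugate systems with the same irrational rotation have the same multipliers, and the conjugacy
between their unstable disks is linear conformal. -/
theorem linear [T2Space M] (H : S₀.Conj S₁ h) (hd : ∀ x, MapClusterPt x atTop (fun n : ℕ => S₀.c ^ n))
    (hc : S₁.c = S₀.c) (him : (S₀.c : ℂ).im ≠ 0) :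
    S₀.r = S₁.r ∧ S₀.lam = S₁.lam ∧ ∃ L : ℂ, L ≠ 0 ∧ L * S₀.z₀ = S₁.z₀ ∧
      ∃ ε > 0, ∀ z : ℂ, ‖z‖ < ε → h (S₀.φ.symm (z, 0)) = S₁.φ.symm (L * z, 0) ∧ ‖L * z‖ < S₁.a := by
  obtain ⟨Θ, hΘc, hΘ₀, hΘ₁⟩ := H.exists_plane
  have hΘ0 : Θ 0 = 0 := by
    have h1 := hΘc 0
    rw [mul_zero] at h1
    have h2 : (S₁.μ - 1) * Θ 0 = 0 := by linear_combination -h1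
    refine (mul_eq_zero.1 h2).resolve_left fun h3 => ?_
    have h4 := S₁.chart.one_lt
    rw [sub_eq_zero.1 h3, norm_one] at h4
    exact lt_irrefl _ h4
  have hF : ∀ (u : Circle) (w : ℂ), dot (S₀.ξ * u) w ≤ 0 ↔ dot (S₁.ξ * u) (Θ w) ≤ 0 := by
    intro u w
    obtain ⟨U, hU, hUu⟩ := mapClusterPt_iff_ultrafilter.1 (hd u)
    have hUu' : Tendsto (fun n : ℕ => S₁.c ^ n) U (𝓝 u) := by rwa [hc]
    refine ⟨H.dot_le_zero Θ.continuous hΘc hΘ₀ (m := id) hU hUu hUu' w, fun hw => ?_⟩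
    have := H.symm.dot_le_zero Θ.symm.continuous (plane_symm_conj hΘc) hΘ₁ (m := id) hU hUu' hUu
      (Θ w) hw
    rwa [Θ.symm_apply_apply] at this
  have hz : Θ S₀.z₀ = S₁.z₀ := by
    obtain ⟨h1, h2⟩ := hΘ₀ _ S₀.model.z₀_lt
    rw [← S₀.model.q_eq, H.map_q, S₁.model.q_eq] at h1
    have t1 : (S₁.z₀, (0 : ℝ)) ∈ S₁.φ.target :=
      S₁.chart.mem_target.2 ⟨S₁.model.z₀_lt.trans_le S₁.δ_le, by simpa using S₁.chart.pos⟩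
    have t2 : (Θ S₀.z₀, (0 : ℝ)) ∈ S₁.φ.target :=
      S₁.chart.mem_target.2 ⟨h2, by simpa using S₁.chart.pos⟩
    exact (congrArg Prod.fst (S₁.φ.symm.injOn t1 t2 h1)).symm
  -- a direction `u` for which the folded surface lies over the homoclinic point
  obtain ⟨u, hu⟩ : ∃ u : Circle, dot (S₀.ξ * u) S₀.z₀ < 0 := by
    refine ⟨Circle.exp (Complex.arg (-S₀.z₀ / S₀.ξ)), ?_⟩
    have h1 := Complex.norm_mul_exp_arg_mul_I (-S₀.z₀ / S₀.ξ)
    have h2 : (‖-S₀.z₀ / S₀.ξ‖ : ℝ) * dot (S₀.ξ * Circle.exp (Complex.arg (-S₀.z₀ / S₀.ξ))) S₀.z₀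
        = -dot S₀.z₀ S₀.z₀ := by
      rw [← real_mul_dot, Circle.coe_exp, mul_left_comm, h1, mul_div_cancel₀ _ S₀.model.ξ_ne]
      simp [dot]; ring
    have h3 := dot_self_pos S₀.model.z₀_ne
    by_contra! h4
    have := mul_nonneg (norm_nonneg (-S₀.z₀ / S₀.ξ)) h4
    linarith
  have hu₁ : dot (S₁.ξ * u) S₁.z₀ < 0 := by
    have e : ((Circle.exp Real.pi * u : Circle) : ℂ) = -u := by
      rw [Circle.coe_mul, Circle.coe_exp, Complex.exp_pi_mul_I, neg_one_mul]
    have eneg : ∀ ξ z : ℂ, dot (ξ * -u) z = -dot (ξ * u) z := by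
      intro ξ z; simp [dot]; ring
    have h1 := hF (Circle.exp Real.pi * u) S₀.z₀
    rw [e, eneg, eneg, hz] at h1
    by_contra! h2
    have := h1.2 (by linarith)
    linarith
  obtain ⟨U, hU, hUu⟩ := mapClusterPt_iff_ultrafilter.1 (hd u)
  have hUu' : Tendsto (fun n : ℕ => S₁.c ^ n) U (𝓝 u) := by rwa [hc]
  obtain ⟨m₀, hm₀, hb₀⟩ := exists_balanced S₀.one_lt S₀.chart.lam_pos S₀.chart.lam_lt
  obtain ⟨m₁, hm₁, hb₁⟩ := exists_balanced S₁.one_lt S₁.chart.lam_pos S₁.chart.lam_lt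
  -- with the minimum of the two choices neither boundary line escapes to infinity, and at least
  -- one of them stays away from `0`
  set m : ℕ → ℕ := fun n => min (m₀ n) (m₁ n) with hm
  have hmt : Tendsto m U atTop := by
    refine Tendsto.mono_left ?_ hU
    refine tendsto_atTop.2 fun B => ?_
    filter_upwards [hm₀.eventually_ge_atTop B, hm₁.eventually_ge_atTop B] with n h1 h2
    exact le_min h1 h2
  obtain ⟨v, hv⟩ : ∃ v, Tendsto (fun n => S₀.c ^ m n) U (𝓝 v) :=
    ⟨(U.map fun n => S₀.c ^ m n).lim, (U.map fun n => S₀.c ^ m n).le_nhds_lim⟩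
  have hv' : Tendsto (fun n => S₁.c ^ m n) U (𝓝 v) := by rwa [hc]
  have hlim : ∀ (S : TangencySystem M) (k : ℕ → ℕ), (∀ n, m n ≤ k n) →
      (∀ n, S.r ^ k n * S.lam ^ n ≤ 1) →
      ∃ τ : ℝ, 0 ≤ τ ∧ Tendsto (fun n => S.r ^ m n * S.lam ^ n) U (𝓝 τ) := by
    intro S k hk hk1
    have hmem : ∀ n, S.r ^ m n * S.lam ^ n ∈ Icc (0 : ℝ) 1 := by
      intro n
      have h1 := pow_pos S.chart.lam_pos n
      have h2 : 0 < S.r ^ m n := pow_pos (by linarith [S.one_lt]) _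
      exact ⟨by positivity, (mul_le_mul_of_nonneg_right
        (pow_le_pow_right₀ S.one_lt.le (hk n)) h1.le).trans (hk1 n)⟩
    obtain ⟨τ, hτ, hτU⟩ := isCompact_Icc.ultrafilter_le_nhds
      (U.map fun n => S.r ^ m n * S.lam ^ n)
      (le_principal_iff.2 (Filter.Eventually.of_forall (f := (U : Filter ℕ)) hmem))
    exact ⟨τ, hτ.1, hτU⟩
  obtain ⟨τ₀, hτ₀, hτ₀t⟩ := hlim S₀ m₀ (fun n => min_le_left _ _) fun n => (hb₀ n).1
  obtain ⟨τ₁, hτ₁, hτ₁t⟩ := hlim S₁ m₁ (fun n => min_le_right _ _) fun n => (hb₁ n).1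
  have hn₀ : S₀.ξ * v ≠ 0 := mul_ne_zero S₀.model.ξ_ne v.coe_ne_zero
  have hn₁ : S₁.ξ * v ≠ 0 := mul_ne_zero S₁.model.ξ_ne v.coe_ne_zero
  have hF01 := H.dot_le_tau Θ.continuous hΘc hΘ₀ hU hmt hUu hu hv hv' hτ₀t hτ₁t
  have hF10 := H.symm.dot_le_tau Θ.symm.continuous (plane_symm_conj hΘc) hΘ₁ hU hmt hUu' hu₁ hv' hv
    hτ₁t hτ₀t
  have hpos : 0 < τ₀ ∧ 0 < τ₁ := by
    have hinv : ∀ S : TangencySystem M, 0 < S.r⁻¹ := fun S => inv_pos.2 (by linarith [S.one_lt])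
    rcases U.eventually_or.1 (Filter.Eventually.of_forall (f := (U : Filter ℕ)) fun n =>
      min_choice (m₀ n) (m₁ n)) with hmin | hmin
    · have h1 : 0 < τ₀ := (hinv S₀).trans_le (ge_of_tendsto hτ₀t (hmin.mono fun n hn => by
        simp only [hm, hn]; exact (hb₀ n).2))
      exact ⟨h1, pos_of_halfPlane hΘ0 hn₁ h1 hF01⟩
    · have h1 : 0 < τ₁ := (hinv S₁).trans_le (ge_of_tendsto hτ₁t (hmin.mono fun n hn => by
        simp only [hm, hn]; exact (hb₁ n).2))
      have h0 : Θ.symm 0 = 0 := by rw [Homeomorph.symm_apply_eq, hΘ0]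
      exact ⟨pos_of_halfPlane h0 hn₀ h1 hF10, h1⟩
  obtain ⟨hμ, L, hL0, hL⟩ := linear_of_halfPlanes Θ.continuous S₀.one_lt S₀.polar him hd S₀.model.ξ_ne
    S₁.model.ξ_ne hΘc hΘ0 hF hpos.1 hpos.2 fun w => ⟨hF01 w, fun hw => by
      have := hF10 (Θ w) hw
      rwa [Θ.symm_apply_apply] at this⟩
  have hr : S₀.r = S₁.r := by
    rw [← norm_eq_of_polar S₀.one_lt S₀.polar, hμ, norm_eq_of_polar S₁.one_lt S₁.polar]
  refine ⟨hr, ?_, L, hL0, by rw [← hL, hz], S₀.δ, δ_pos S₀, fun z hz => ?_⟩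
  · rw [← hr] at hτ₁t
    exact eq_of_tendsto_mul_pow S₀.chart.lam_pos S₁.chart.lam_pos hpos.1 hpos.2 hU hτ₀t hτ₁t
  · rw [← hL]; exact hΘ₀ z hz

end TangencySystem.Conj

/-! ### Existence and change of linearizing coordinates -/

open Polynomial in
/-- A root of the characteristic polynomial in an extension field is the eigenvalue of a linear form
with values in that field. -/
theorem exists_linear_form_of_isRoot {E K : Type*} [AddCommGroup E] [Module ℝ E] [Module.Free ℝ E]
    [Module.Finite ℝ E] [Field K] [Algebra ℝ K] (A : E →ₗ[ℝ] E) (μ : K)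
    (hμ : (A.charpoly.map (algebraMap ℝ K)).IsRoot μ) :
    ∃ Z : E →ₗ[ℝ] K, Z ≠ 0 ∧ ∀ x, Z (A x) = μ * Z x := by
  classical
  let b := Module.Free.chooseBasis ℝ E
  let N := LinearMap.toMatrix b b A
  have h1 : (Matrix.scalar _ μ - N.map (algebraMap ℝ K)).det = 0 := by
    rw [← Matrix.eval_charpoly, Matrix.charpoly_map, LinearMap.charpoly_toMatrix]
    exact hμ
  obtain ⟨v, hv, hv0⟩ := Matrix.exists_vecMul_eq_zero_iff.2 h1
  have hvj : ∀ j, ∑ i, v i * algebraMap ℝ K (N i j) = μ * v j := by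
    intro j
    have := congrFun hv0 j
    rw [Matrix.vecMul_sub, Pi.sub_apply, Pi.zero_apply, sub_eq_zero] at this
    rw [Matrix.scalar_apply, Matrix.vecMul_diagonal] at this
    rw [mul_comm, this]
    rfl
  have hZb : ∀ j, (b.constr ℝ v : E →ₗ[ℝ] K) (b j) = v j := fun j => b.constr_basis ℝ v j
  refine ⟨b.constr ℝ v, fun h0 => hv ?_, fun x => ?_⟩
  · funext j
    rw [← hZb, h0]; rfl
  · have hcomp : (b.constr ℝ v : E →ₗ[ℝ] K) ∘ₗ A = LinearMap.mulLeft ℝ μ ∘ₗ b.constr ℝ v := by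
      refine b.ext fun j => ?_
      simp only [LinearMap.comp_apply, LinearMap.mulLeft_apply, hZb]
      rw [← hvj, ← b.sum_repr (A (b j)), map_sum]
      refine Finset.sum_congr rfl fun i _ => ?_
      rw [map_smul, hZb, Algebra.smul_def, mul_comm]
      simp only [N, LinearMap.toMatrix_apply]
    exact LinearMap.congr_fun hcomp x

/-- Eigenforms for a non-real eigenvalue `μ` and a real one `lam` form a coordinate system. The
image of `(Z, τ)` is invariant under `(μ, lam)` and projects nontrivially to both factors, so it is
everything. -/
theorem surjective_prod_of_eigenforms {A : ℂ × ℝ →ₗ[ℝ] ℂ × ℝ} {μ : ℂ} {lam : ℝ} (hμ : μ.im ≠ 0)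
    {Z : ℂ × ℝ →ₗ[ℝ] ℂ} {τ : ℂ × ℝ →ₗ[ℝ] ℝ} (hZ : Z ≠ 0) (hτ : τ ≠ 0)
    (hZA : ∀ x, Z (A x) = μ * Z x) (hτA : ∀ x, τ (A x) = lam * τ x) :
    Function.Surjective (Z.prod τ) := by
  obtain ⟨x, hx⟩ : ∃ x, Z x ≠ 0 := by
    by_contra! h; exact hZ (LinearMap.ext h)
  obtain ⟨x₀, hx₀⟩ : ∃ x, τ x ≠ 0 := by
    by_contra! h; exact hτ (LinearMap.ext h)
  set y := A x - lam • x with hy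
  have hy1 : Z y = (μ - lam) * Z x := by
    rw [hy, map_sub, map_smul, hZA, Complex.real_smul]; ring
  have hy2 : τ y = 0 := by rw [hy, map_sub, map_smul, hτA, smul_eq_mul, sub_self]
  have hy0 : Z y ≠ 0 := by
    rw [hy1]
    refine mul_ne_zero (fun h => hμ ?_) hx
    rw [sub_eq_zero.1 h, Complex.ofReal_im]
  have hplane : ∀ z : ℂ, ∃ x, Z x = z ∧ τ x = 0 := by
    intro z
    set ζ := z / Z y with hζ
    refine ⟨(ζ.re - ζ.im / μ.im * μ.re) • y + (ζ.im / μ.im) • A y, ?_, ?_⟩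
    · rw [map_add, map_smul, map_smul, hZA, Complex.real_smul, Complex.real_smul]
      have : ((ζ.re - ζ.im / μ.im * μ.re : ℝ) : ℂ) + ((ζ.im / μ.im : ℝ) : ℂ) * μ = ζ := by
        apply Complex.ext
        · simp
        · simp [hμ]
      rw [← mul_assoc, ← add_mul, this, hζ, div_mul_cancel₀ _ hy0]
    · rw [map_add, map_smul, map_smul, hτA, hy2]; simp
  rintro ⟨z, t⟩
  obtain ⟨x₁, h1, h2⟩ := hplane (z - Z ((t / τ x₀) • x₀))
  refine ⟨x₁ + (t / τ x₀) • x₀, ?_⟩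
  change (Z _, τ _) = _
  rw [map_add, map_add, h1, h2, map_smul τ]
  simp [hx₀]

theorem exp_mul_I_im_ne_zero {θ : ℝ} (hθ : ∀ n : ℤ, θ ≠ n * Real.pi) :
    (Complex.exp (θ * Complex.I)).im ≠ 0 := by
  rw [Complex.exp_ofReal_mul_I_im]
  intro h
  obtain ⟨n, hn⟩ := Real.sin_eq_zero_iff.1 h
  exact hθ n hn.symm

section Manifold

variable {M : Type*} [TopologicalSpace M] [ChartedSpace (EuclideanSpace ℝ (Fin 3)) M]
  {k : ℕ∞} {f : M ≃ₘ^k⟮𝓡 3, 𝓡 3⟯ M} {p : M} {r θ lam : ℝ}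

theorem exists_isLinearizing (h : IsLinearSaddleFocus k f p r θ lam) :
    ∃ φ a, IsLinearizing k f p r θ lam φ a := by
  obtain ⟨-, hr, hθ, -, -, φ, A, hφ, hroots⟩ := h
  set μ : ℂ := r * Complex.exp (θ * Complex.I) with hμ
  have hμim : μ.im ≠ 0 := by
    rw [hμ, Complex.im_ofReal_mul]
    exact mul_ne_zero (by linarith) (exp_mul_I_im_ne_zero hθ)
  have hμroot : (A.charpoly.map (algebraMap ℝ ℂ)).IsRoot μ :=
    Polynomial.isRoot_of_mem_roots (by rw [hroots]; simp)
  have hlroot : (A.charpoly.map (algebraMap ℝ ℝ)).IsRoot lam := by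
    have h1 : (A.charpoly.map (algebraMap ℝ ℂ)).IsRoot (algebraMap ℝ ℂ lam) :=
      Polynomial.isRoot_of_mem_roots (by rw [hroots]; simp)
    rw [Algebra.algebraMap_self, Polynomial.map_id]
    exact (Polynomial.isRoot_map_iff (algebraMap ℝ ℂ).injective).1 h1
  obtain ⟨Z, hZ, hZA⟩ := exists_linear_form_of_isRoot A μ hμroot
  obtain ⟨τ, hτ, hτA⟩ := exists_linear_form_of_isRoot A lam hlroot
  have hsurj := surjective_prod_of_eigenforms hμim hZ hτ hZA hτA
  let P : (ℂ × ℝ) ≃L[ℝ] (ℂ × ℝ) :=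
    (LinearEquiv.ofBijective (Z.prod τ) ⟨LinearMap.injective_iff_surjective.2 hsurj, hsurj⟩
      ).toContinuousLinearEquiv
  have hP : ∀ x, P x = (Z x, τ x) := fun x => rfl
  let ψ := φ.transHomeomorph P.toHomeomorph
  have hψ : ∀ x, ψ x = P (φ x) := fun x => rfl
  have hψs : ∀ v, ψ.symm v = φ.symm (P.symm v) := fun v => rfl
  have hbase : ψ p = 0 := by rw [hψ, hφ.map_base, map_zero]
  have h0 : (0 : ℂ × ℝ) ∈ ψ.target := by
    rw [← hbase]; exact ψ.map_source hφ.mem_source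
  obtain ⟨a, ha, hball⟩ := Metric.isOpen_iff.1 ψ.open_target 0 h0
  let C : Set (ℂ × ℝ) := Metric.ball (0 : ℂ) a ×ˢ Ioo (-a) a
  have hC : IsOpen C := Metric.isOpen_ball.prod isOpen_Ioo
  have hC0 : (0 : ℂ × ℝ) ∈ C := ⟨Metric.mem_ball_self ha, by simpa using ha⟩
  have hCsub : C ⊆ ψ.target := by
    rintro v ⟨h1, h2⟩
    apply hball
    rw [mem_ball_zero_iff, Prod.norm_def]
    exact max_lt (mem_ball_zero_iff.1 h1) (abs_lt.2 h2)
  let χ : OpenPartialHomeomorph M (ℂ × ℝ) := (ψ.symm.restrOpen C hC).symm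
  have hχt : χ.target = C := by
    change ψ.target ∩ C = C
    exact inter_eq_right.2 hCsub
  have hχs : χ.source ⊆ φ.source := fun x hx => (show x ∈ ψ.source ∩ ψ ⁻¹' C from hx).1
  have hPs : ContMDiff 𝓘(ℝ, ℂ × ℝ) 𝓘(ℝ, ℂ × ℝ) k P := P.contDiff.contMDiff
  have hPs' : ContMDiff 𝓘(ℝ, ℂ × ℝ) 𝓘(ℝ, ℂ × ℝ) k P.symm := P.symm.contDiff.contMDiff
  refine ⟨χ, a, ⟨⟨?_, hbase, ?_, ?_, ?_⟩, ha, hχt⟩⟩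
  · have : p ∈ ψ.source ∩ ψ ⁻¹' C := ⟨hφ.mem_source, by rw [mem_preimage, hbase]; exact hC0⟩
    exact this
  · exact hPs.comp_contMDiffOn (hφ.contMDiffOn.mono hχs)
  · refine hφ.contMDiffOn_symm.comp hPs'.contMDiffOn fun v hv => ?_
    rw [hχt] at hv
    exact hCsub hv
  · intro x hx hfx
    change P (φ (f x)) = normalForm r θ lam (P (φ x))
    rw [hφ.conj x (hχs hx) (hχs hfx), hP, hP, hZA, hτA]
    rfl

/-- Linearizing coordinates with `z` replaced by its conjugate. -/
noncomputable def conjCoord (φ : OpenPartialHomeomorph M (ℂ × ℝ)) : OpenPartialHomeomorph M (ℂ × ℝ) :=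
  φ.transHomeomorph (Complex.conjCLE.toHomeomorph.prodCongr (Homeomorph.refl ℝ))

theorem IsLinearizing.conjCoord {φ : OpenPartialHomeomorph M (ℂ × ℝ)} {a θ' : ℝ}
    (h : IsLinearizing k f p r θ lam φ a)
    (hθ : Complex.exp (θ' * Complex.I) = starRingEnd ℂ (Complex.exp (θ * Complex.I))) :
    IsLinearizing k f p r θ' lam (conjCoord φ) a := by
  have hC : ContDiff ℝ k fun v : ℂ × ℝ => (starRingEnd ℂ v.1, v.2) :=
    (Complex.conjCLE.contDiff.comp contDiff_fst).prodMk contDiff_snd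
  have ht : ∀ v, v ∈ (SaddleFocus.conjCoord φ).target ↔ (starRingEnd ℂ v.1, v.2) ∈ φ.target :=
    fun v => Iff.rfl
  refine ⟨⟨h.mem_source, ?_, ?_, ?_, ?_⟩, h.pos, ?_⟩
  · change (starRingEnd ℂ (φ p).1, (φ p).2) = 0
    rw [h.map_base]; simp
  · exact hC.contMDiff.comp_contMDiffOn h.contMDiffOn
  · exact h.contMDiffOn_symm.comp hC.contMDiff.contMDiffOn fun v hv => (ht v).1 hv
  · intro x hx hfx
    change (starRingEnd ℂ (φ (f x)).1, (φ (f x)).2) =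
      normalForm r θ' lam (starRingEnd ℂ (φ x).1, (φ x).2)
    rw [h.conj x hx hfx]
    simp only [normalForm, map_mul, hθ, Complex.conj_ofReal]
  · ext v
    rw [ht, h.target_eq]
    simp only [mem_prod, mem_ball_zero_iff, Complex.norm_conj]

theorem IsLinearizing.congr_angle {φ : OpenPartialHomeomorph M (ℂ × ℝ)} {a θ' : ℝ}
    (h : IsLinearizing k f p r θ lam φ a)
    (hθ : Complex.exp (θ' * Complex.I) = Complex.exp (θ * Complex.I)) :
    IsLinearizing k f p r θ' lam φ a :=
  ⟨⟨h.mem_source, h.map_base, h.contMDiffOn, h.contMDiffOn_symm, fun x hx hfx => by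
    rw [h.conj x hx hfx]; simp only [normalForm, hθ]⟩, h.pos, h.target_eq⟩

theorem exists_isLinearizing_of_exp {θ' : ℝ} (h : IsLinearSaddleFocus k f p r θ lam)
    (hθ : Complex.exp (θ' * Complex.I) = Complex.exp (θ * Complex.I) ∨
      Complex.exp (θ' * Complex.I) = starRingEnd ℂ (Complex.exp (θ * Complex.I))) :
    ∃ φ a, IsLinearizing k f p r θ' lam φ a := by
  obtain ⟨φ, a, hφ⟩ := exists_isLinearizing h
  rcases hθ with hθ | hθ
  · exact ⟨φ, a, hφ.congr_angle hθ⟩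
  · exact ⟨_, a, hφ.conjCoord hθ⟩

theorem IsPositivelyAssociated.of_exp {q : M} {θ' : ℝ} (h : IsPositivelyAssociated k f p q r θ lam)
    (hθ : Complex.exp (θ' * Complex.I) = Complex.exp (θ * Complex.I) ∨
      Complex.exp (θ' * Complex.I) = starRingEnd ℂ (Complex.exp (θ * Complex.I))) :
    IsPositivelyAssociated k f p q r θ' lam := by
  intro φ a hφ α hα
  rcases hθ with hθ | hθ
  · exact h φ a (hφ.congr_angle hθ.symm) α hα
  · exact h _ a (hφ.conjCoord (by rw [hθ, Complex.conj_conj])) α hα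

theorem IsLinearizing.saddleChart {φ : OpenPartialHomeomorph M (ℂ × ℝ)} {a : ℝ}
    (h : IsLinearizing k f p r θ lam φ a) (hfix : f p = p) (hr : 1 < r) (h0 : 0 < lam) (h1 : lam < 1) :
    SaddleChart f.toHomeomorph p (r * Complex.exp (θ * Complex.I)) lam φ a where
  fixed := hfix
  mem_source := h.mem_source
  map_base := h.map_base
  pos := h.pos
  target_eq := h.target_eq
  conj := h.conj
  one_lt := by
    rw [norm_mul, Complex.norm_exp_ofReal_mul_I, mul_one, Complex.norm_real,
      Real.norm_of_nonneg (by linarith)]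
    exact hr
  lam_pos := h0
  lam_lt := h1

end Manifold

/-! ### The folded return map of a homoclinic tangency -/

section Return

/-- Strict differentiability splits the inverse return map near the tangency point into its values on
the stable axis and a linear function of the unstable coordinate. -/
theorem ReturnModel.of_strictFDeriv {F F' : ℂ × ℝ → ℂ × ℝ} {z₀ : ℂ} {t₀ : ℝ} (ht₀ : t₀ ≠ 0)
    (hF : ContDiffAt ℝ 1 F (0, t₀)) (hF0 : F (0, t₀) = (z₀, 0))
    (hF' : DifferentiableAt ℝ F' (z₀, 0)) (hF'0 : F' (z₀, 0) = (0, t₀))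
    (hinv : ∀ᶠ w in 𝓝 (z₀, (0 : ℝ)), F (F' w) = w)
    (hpos : ∀ᶠ s in 𝓝[≠] (1 : ℝ), 0 < (F (0, t₀ * s)).2 / t₀) :
    ∃ ξ : ℂ, ξ ≠ 0 ∧ ReturnModel (fun x => (F (x.1, t₀ * x.2)).1)
      (fun x => (F (x.1, t₀ * x.2)).2 / t₀) z₀ ξ := by
  let S : ℂ × ℝ →L[ℝ] ℂ × ℝ :=
    (ContinuousLinearMap.fst ℝ ℂ ℝ).prod (t₀ • ContinuousLinearMap.snd ℝ ℂ ℝ)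
  have hS : ∀ x, S x = (x.1, t₀ * x.2) := fun x => rfl
  have hS1 : S (0, 1) = (0, t₀) := by rw [hS, mul_one]
  have hSsurj : Function.Surjective S := by
    rintro ⟨z, t⟩
    exact ⟨(z, t / t₀), by rw [hS, mul_div_cancel₀ _ ht₀]⟩
  have hFS : HasStrictFDerivAt F (fderiv ℝ F (0, t₀)) (S (0, 1)) := by
    rw [hS1]; exact hF.hasStrictFDerivAt one_ne_zero
  set G : ℂ × ℝ → ℝ := fun x => (F (x.1, t₀ * x.2)).2 / t₀ with hGdef
  let D : ℂ × ℝ →L[ℝ] ℝ :=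
    t₀⁻¹ • ((ContinuousLinearMap.snd ℝ ℂ ℝ).comp ((fderiv ℝ F (0, t₀)).comp S))
  have hG : HasStrictFDerivAt G D (0, 1) := by
    have h1 := (hFS.comp (0, 1) S.hasStrictFDerivAt).snd.const_smul t₀⁻¹
    have h2 : G = fun x => t₀⁻¹ • (F (S x)).2 := by
      funext x
      exact div_eq_inv_mul _ _
    rw [h2]
    exact h1
  have hG0 : G (0, 1) = 0 := by
    simp only [hGdef, mul_one, hF0, zero_div]
  -- the tangency: `G` has a minimum at the base point of the stable axis
  have hDt : D (0, 1) = 0 := by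
    have h1 : HasDerivAt (fun s : ℝ => G ((0 : ℂ), s)) (D (0, 1)) 1 := by
      have h2 : HasDerivAt (fun s : ℝ => ((0 : ℂ), s)) ((0 : ℂ), (1 : ℝ)) 1 :=
        (hasDerivAt_const _ _).prodMk (hasDerivAt_id _)
      exact hG.hasFDerivAt.comp_hasDerivAt 1 h2
    have hmin : IsLocalMin (fun s : ℝ => G ((0 : ℂ), s)) 1 := by
      have h3 := eventually_nhdsWithin_iff.1 hpos
      filter_upwards [h3] with s hs
      rw [hG0]
      by_cases h4 : s = 1
      · rw [h4, hG0]
      · exact (hs h4).le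
    exact hmin.hasDerivAt_eq_zero h1
  let ξ : ℂ := ⟨D (1, 0), D (Complex.I, 0)⟩
  have hDz : ∀ z : ℂ, D (z, 0) = dot ξ z := by
    intro z
    have h1 : (z, (0 : ℝ)) = z.re • ((1 : ℂ), (0 : ℝ)) + z.im • (Complex.I, (0 : ℝ)) := by
      rw [Prod.smul_mk, Prod.smul_mk, Prod.mk_add_mk]
      simp [Complex.re_add_im]
    rw [h1, map_add, map_smul, map_smul]
    simp only [dot, ξ, smul_eq_mul]
    ring
  have hDdot : ∀ x, D x = dot ξ x.1 := by
    intro x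
    have h1 : x = (x.1, (0 : ℝ)) + x.2 • ((0 : ℂ), (1 : ℝ)) := by
      rw [Prod.smul_mk, Prod.mk_add_mk]; simp
    rw [h1, map_add, map_smul, hDt, smul_zero, add_zero, hDz]
    simp
  refine ⟨ξ, ?_, ?_, ?_, ?_, hG0, ?_, hpos⟩
  · intro hξ
    have h1 : HasFDerivAt F (fderiv ℝ F (0, t₀)) (F' (z₀, 0)) := by
      rw [hF'0]; exact (hF.differentiableAt one_ne_zero).hasFDerivAt
    have h2 := h1.comp (z₀, (0 : ℝ)) hF'.hasFDerivAt
    have h3 : HasFDerivAt (F ∘ F') (ContinuousLinearMap.id ℝ (ℂ × ℝ)) (z₀, (0 : ℝ)) :=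
      (hasFDerivAt_id _).congr_of_eventuallyEq hinv
    have h4 := congrArg (fun L : ℂ × ℝ →L[ℝ] ℂ × ℝ => (L (0, 1)).2) (h2.unique h3)
    obtain ⟨x, hx⟩ := hSsurj (fderiv ℝ F' (z₀, 0) (0, 1))
    have h5 : D x = t₀⁻¹ * (fderiv ℝ F (0, t₀) (fderiv ℝ F' (z₀, 0) (0, 1))).2 := by
      rw [← hx]; rfl
    rw [hDdot, hξ] at h5
    change (fderiv ℝ F (0, t₀) (fderiv ℝ F' (z₀, 0) (0, 1))).2 = 1 at h4
    rw [h4, mul_one] at h5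
    exact inv_ne_zero ht₀ (by rw [← h5]; simp [dot])
  all_goals
    have hev : ∀ᶠ x in 𝓝 ((0 : ℂ), (1 : ℝ)), ContinuousAt (fun x => F (S x)) x := by
      have h1 : ∀ᶠ v in 𝓝 (S (0, 1)), ContinuousAt F v := by
        rw [hS1]
        exact (hF.eventually (by simp)).mono fun v hv => hv.continuousAt
      filter_upwards [S.continuous.continuousAt.eventually h1] with x hx
      exact ContinuousAt.comp (f := S) hx S.continuous.continuousAt
  · exact hev.mono fun x hx => continuous_fst.continuousAt.comp hx
  · exact hev.mono fun x hx => (continuous_snd.continuousAt.comp hx).div_const _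
  · simp only [mul_one, hF0]
  · intro ε hε
    have h1 := hG.isLittleO.def hε
    have h2 : Tendsto (fun x : ℂ × ℝ => (x, ((0 : ℂ), x.2))) (𝓝 ((0 : ℂ), (1 : ℝ)))
        (𝓝 (((0 : ℂ), (1 : ℝ)), ((0 : ℂ), (1 : ℝ)))) := by
      have : Continuous fun x : ℂ × ℝ => (x, ((0 : ℂ), x.2)) := by fun_prop
      exact this.tendsto _
    filter_upwards [h2.eventually h1] with x hx
    have h3 : x - ((0 : ℂ), x.2) = (x.1, 0) := by
      apply Prod.ext <;> simp
    simp only [h3, hDz, Prod.norm_mk, norm_zero, Real.norm_eq_abs] at hx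
    rwa [max_eq_left (norm_nonneg _)] at hx

variable {M : Type*} [TopologicalSpace M] {f : M ≃ₜ M} {p : M} {μ : ℂ} {lam : ℝ}
  {φ : OpenPartialHomeomorph M (ℂ × ℝ)} {a : ℝ}

/-- The components of the complement of the unstable disk lie on one of its two sides. -/
theorem mul_pos_of_mem_component {x y : M}
    (hx : x ∈ φ.source \ localUnstable φ)
    (hy : y ∈ connectedComponentIn (φ.source \ localUnstable φ) x) : 0 < (φ y).2 * (φ x).2 := by
  set C := connectedComponentIn (φ.source \ localUnstable φ) x with hC
  have hsub : C ⊆ φ.source \ localUnstable φ := connectedComponentIn_subset _ _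
  have hpre : IsPreconnected ((fun y => (φ y).2) '' C) :=
    isPreconnected_connectedComponentIn.image _
      (continuous_snd.comp_continuousOn (φ.continuousOn.mono fun y hy => (hsub hy).1))
  have hne : ∀ y ∈ C, (φ y).2 ≠ 0 := fun y hy h0 => (hsub hy).2 ⟨(hsub hy).1, h0⟩
  have h0 : (0 : ℝ) ∉ (fun y => (φ y).2) '' C := by
    rintro ⟨y, hy, h⟩
    exact hne y hy h
  have hyC : (φ y).2 ∈ (fun y => (φ y).2) '' C := ⟨y, hy, rfl⟩
  have hxC : (φ x).2 ∈ (fun y => (φ y).2) '' C := ⟨x, mem_connectedComponentIn hx, rfl⟩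
  by_contra! hle
  rcases mul_nonpos_iff.1 hle with ⟨h1, h2⟩ | ⟨h1, h2⟩
  · exact h0 (hpre.ordConnected.out hxC hyC ⟨h2, h1⟩)
  · exact h0 (hpre.ordConnected.out hyC hxC ⟨h1, h2⟩)

end Return

section Manifold

variable {M : Type*} [TopologicalSpace M] [ChartedSpace (EuclideanSpace ℝ (Fin 3)) M]
  {k : ℕ∞} {f : M ≃ₘ^k⟮𝓡 3, 𝓡 3⟯ M} {p : M} {r θ lam : ℝ}
  {φ : OpenPartialHomeomorph M (ℂ × ℝ)} {a : ℝ}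

theorem iterate_symm_iterate (f : M ≃ₘ^k⟮𝓡 3, 𝓡 3⟯ M) {i n : ℕ} (h : i ≤ n) (x : M) :
    f^[n] (f.symm^[i] x) = f^[n - i] x := by
  obtain ⟨j, rfl⟩ := Nat.exists_eq_add_of_le h
  rw [Nat.add_sub_cancel_left, add_comm, Function.iterate_add_apply]
  exact congrArg _ ((f.toHomeomorph.right_inv.iterate i) x)

/-- Points of the stable axis, brought back to `q` by the inverse map, form a regular stable arc. -/
theorem isStableArc_axis [T2Space M] (hφ : IsLinearizing k f p r θ lam φ a)
    (hc : SaddleChart f.toHomeomorph p (r * Complex.exp (θ * Complex.I)) lam φ a) (hk : 3 ≤ k)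
    {q : M} {n : ℕ} {t₀ : ℝ} (ht₀ : |t₀| < a) (hq : f^[n] q = φ.symm (0, t₀)) :
    IsStableArc k f p q fun s => f.symm^[n] (φ.symm (0, t₀ + s)) := by
  have hk0 : (k : ℕ∞ω) ≠ 0 := by
    have : k ≠ 0 := by rintro rfl; simp at hk
    exact_mod_cast this
  set α : ℝ → M := fun s => f.symm^[n] (φ.symm (0, t₀ + s)) with hα
  have hα0 : α 0 = q := by
    simp only [hα, add_zero, ← hq]
    exact (f.toHomeomorph.left_inv.iterate n) q
  set ε := a - |t₀| with hε
  have hε0 : 0 < ε := by linarith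
  have hmem : ∀ s ∈ Ioo (-ε) ε, |t₀ + s| < a := fun s hs =>
    (abs_add_le _ _).trans_lt (by have := abs_lt.2 hs; linarith)
  have htgt : ∀ s ∈ Ioo (-ε) ε, ((0 : ℂ), t₀ + s) ∈ φ.target := fun s hs =>
    hc.mem_target.2 ⟨by simpa using hc.pos, hmem s hs⟩
  have hsm : ContMDiffOn 𝓘(ℝ, ℝ) (𝓡 3) k α (Ioo (-ε) ε) := by
    have h1 : ContMDiff 𝓘(ℝ, ℝ) 𝓘(ℝ, ℂ × ℝ) k fun s : ℝ => ((0 : ℂ), t₀ + s) :=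
      (contDiff_const.prodMk (contDiff_const.add contDiff_id)).contMDiff
    have h2 : ContMDiff (𝓡 3) (𝓡 3) k (f.symm^[n]) := f.symm.contMDiff.iterate n
    exact h2.comp_contMDiffOn (hφ.contMDiffOn_symm.comp h1.contMDiffOn htgt)
  have h0mem : (0 : ℝ) ∈ Ioo (-ε) ε := ⟨by linarith, hε0⟩
  refine ⟨hα0, fun h0 => ?_, ε, hε0, hsm, fun V hV => ?_⟩
  · have hd : HasMFDerivAt 𝓘(ℝ, ℝ) (𝓡 3) α 0 (mfderiv 𝓘(ℝ, ℝ) (𝓡 3) α 0) :=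
      ((hsm.contMDiffAt (Ioo_mem_nhds h0mem.1 h0mem.2)).mdifferentiableAt hk0).hasMFDerivAt
    have hqs : f^[n] q ∈ φ.source := by
      rw [hq]; simpa using φ.map_target (htgt 0 h0mem)
    have hg : MDifferentiableAt (𝓡 3) 𝓘(ℝ, ℂ × ℝ) (fun x => φ (f^[n] x)) (α 0) := by
      rw [hα0]
      have h2 : ContMDiff (𝓡 3) (𝓡 3) k (f^[n]) := f.contMDiff.iterate n
      exact ((hφ.contMDiffOn.contMDiffAt (φ.open_source.mem_nhds hqs)).comp q
        h2.contMDiffAt).mdifferentiableAt hk0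
    have h3 := hg.hasMFDerivAt.comp 0 hd
    rw [h0, ContinuousLinearMap.comp_zero] at h3
    have h4 : HasFDerivAt (fun s : ℝ => φ (f^[n] (α s))) (0 : ℝ →L[ℝ] ℂ × ℝ) 0 :=
      h3.hasFDerivAt
    have h5 : HasFDerivAt (fun s : ℝ => ((0 : ℂ), t₀ + s)) (0 : ℝ →L[ℝ] ℂ × ℝ) 0 := by
      refine h4.congr_of_eventuallyEq ?_
      filter_upwards [Ioo_mem_nhds h0mem.1 h0mem.2] with s hs
      have : f^[n] (α s) = φ.symm (0, t₀ + s) := (f.toHomeomorph.right_inv.iterate n) _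
      rw [this, φ.right_inv (htgt s hs)]
    have h6 : HasDerivAt (fun s : ℝ => ((0 : ℂ), t₀ + s)) ((0 : ℂ), (1 : ℝ)) 0 :=
      (hasDerivAt_const _ _).prodMk ((hasDerivAt_id _).const_add _)
    have h7 := congrArg Prod.snd (h5.hasDerivAt.unique h6)
    simp at h7
  · have hm : Tendsto (fun i => i - n) atTop atTop := tendsto_sub_atTop_nat n
    have hV' : V ∈ 𝓝 (φ.symm (0, 0)) := by rwa [hc.symm_zero]
    filter_upwards [HomoclinicModel.eventually_symm_mem hc hm (w := 0) (by simpa using hc.pos) hV',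
      eventually_ge_atTop n] with i hi hin s hs
    rw [iterate_symm_iterate f hin]
    have := hc.iterate_symm (i - n) (z := 0) (t := t₀ + s) (by simpa using hc.pos) (hmem s hs)
    rw [mul_zero] at this
    exact this ▸ hi _ (hmem s hs)

/-- A positively associated homoclinic point gives a folded return map between any sufficiently late
points of its backward and forward orbits. -/
theorem exists_homoclinicModel [T2Space M] (hφ : IsLinearizing k f p r θ lam φ a)
    (hc : SaddleChart f.toHomeomorph p (r * Complex.exp (θ * Complex.I)) lam φ a) (hk : 3 ≤ k)
    {q : M} (hqp : q ≠ p) (hs : ∀ V ∈ 𝓝 p, ∀ᶠ n : ℕ in atTop, f^[n] q ∈ V)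
    (hu : ∀ V ∈ 𝓝 p, ∀ᶠ n : ℕ in atTop, f.symm^[n] q ∈ V)
    (hpos : IsPositivelyAssociated k f p q r θ lam) {δ : ℝ} (hδ : 0 < δ) (hδa : δ ≤ a) :
    ∀ᶠ n' : ℕ in atTop, ∀ᶠ n : ℕ in atTop, ∃ z₀ t₀ ξ,
      HomoclinicModel f.toHomeomorph φ δ (n + n') (f.symm^[n] q) z₀ t₀ ξ := by
  have hk1 : (1 : ℕ∞ω) ≤ k := by
    have : (1 : ℕ∞) ≤ k := le_trans (by norm_num) hk
    exact_mod_cast this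
  obtain ⟨n₁, hn₁⟩ := eventually_atTop.1 (hs _ (hc.box_mem_nhds hδ))
  refine eventually_atTop.2 ⟨n₁, fun n' hn' => ?_⟩
  set x := f^[n'] q with hx
  have hxb : x ∈ box φ δ := hn₁ n' hn'
  have hfwd : ∀ i, f^[i] x ∈ φ.source := fun i => by
    rw [hx, ← Function.iterate_add_apply]
    exact (hn₁ _ (by omega)).1
  have hx1 : (φ x).1 = 0 := hc.fst_eq_zero hfwd
  set t₀ := (φ x).2 with ht₀def
  have hxeq : x = φ.symm (0, t₀) := by
    rw [← hx1, ht₀def, Prod.mk.eta, φ.left_inv hxb.1]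
  have ht₀ : |t₀| < δ := abs_lt.2 hxb.2.2
  have ht₀ne : t₀ ≠ 0 := by
    intro h0
    rw [h0, hc.symm_zero] at hxeq
    have h1 : f.symm^[n'] x = q := (f.toHomeomorph.left_inv.iterate n') q
    have h2 : f.symm^[n'] p = p :=
      Function.iterate_fixed ((f.toHomeomorph.symm_apply_eq).2 hc.fixed.symm) n'
    exact hqp (by rw [← h1, hxeq, h2])
  have hx0 : f^[n'] q = φ.symm (0, t₀) := hxeq
  have harc := isStableArc_axis hφ hc hk (ht₀.trans_le hδa) hx0
  obtain ⟨n₂, hn₂⟩ := eventually_atTop.1 (hu _ (hc.box_mem_nhds hδ))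
  filter_upwards [hpos φ a hφ _ harc, eventually_ge_atTop n₂, eventually_ge_atTop n']
    with n hcomp hn2 hnn'
  set q' := f.symm^[n] q with hq'
  have hq'b : q' ∈ box φ δ := hn₂ n hn2
  have hq'2 : (φ q').2 = 0 := hc.snd_eq_zero fun i => by
    change f.symm^[i] q' ∈ φ.source
    rw [hq', ← Function.iterate_add_apply]
    exact (hn₂ _ (by omega)).1
  set z₀ := (φ q').1 with hz₀
  have hq'eq : q' = φ.symm (z₀, 0) := by
    rw [← hq'2, hz₀, Prod.mk.eta, φ.left_inv hq'b.1]
  have hz₀lt : ‖z₀‖ < δ := mem_ball_zero_iff.1 hq'b.2.1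
  have hback : f^[n] q' = q := (f.toHomeomorph.right_inv.iterate n) q
  have hret : f^[n + n'] q' = φ.symm (0, t₀) := by
    rw [add_comm, Function.iterate_add_apply, hback, ← hxeq]
  have htgt0 : ((0 : ℂ), t₀) ∈ φ.target :=
    hc.mem_target.2 ⟨by simpa using hc.pos, ht₀.trans_le hδa⟩
  have htgtz : (z₀, (0 : ℝ)) ∈ φ.target :=
    hc.mem_target.2 ⟨hz₀lt.trans_le hδa, by simpa using hc.pos⟩
  have hret' : f.symm^[n + n'] (φ.symm (0, t₀)) = q' := by
    rw [← hret]; exact (f.toHomeomorph.left_inv.iterate _) _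
  -- the fold: near `q` the stable arc lies on the side of `t₀`, off the tangency point
  have hfold : ∀ᶠ s in 𝓝[≠] (1 : ℝ), 0 < (φ (f.symm^[n + n'] (φ.symm (0, t₀ * s)))).2 / t₀ := by
    have hlim : Tendsto (fun s : ℝ => t₀ * s - t₀) (𝓝[≠] 1) (𝓝[≠] 0) := by
      refine tendsto_nhdsWithin_iff.2 ⟨?_, ?_⟩
      · have hcont : Continuous fun s : ℝ => t₀ * s - t₀ := by fun_prop
        have := hcont.tendsto 1
        simp only [mul_one, sub_self] at this
        exact this.mono_left nhdsWithin_le_nhds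
      · filter_upwards [eventually_mem_nhdsWithin] with s hs
        have hs' : s ≠ 1 := hs
        have : t₀ * (s - 1) ≠ 0 := mul_ne_zero ht₀ne (sub_ne_zero.2 hs')
        rwa [mul_sub, mul_one] at this
    filter_upwards [hlim.eventually hcomp] with s hs
    rw [add_sub_cancel, ← Function.iterate_add_apply] at hs
    have hcoord : φ (f^[n] q) =
        ((r * Complex.exp (θ * Complex.I)) ^ (n - n') * (φ x).1, lam ^ (n - n') * t₀) := by
      have h1 : f^[n] q = f^[n - n'] x := by
        rw [hx, ← Function.iterate_add_apply, Nat.sub_add_cancel hnn']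
      rw [h1]
      exact hc.coord_iterate (n := n - n') fun i _ => hfwd i
    have hlamp := pow_pos hc.lam_pos (n - n')
    have hmem : f^[n] q ∈ φ.source \ localUnstable φ := by
      refine ⟨(hn₁ n (by omega)).1, fun h0 => ?_⟩
      have h1 := h0.2
      rw [hcoord] at h1
      exact mul_ne_zero hlamp.ne' ht₀ne h1
    have h2 := mul_pos_of_mem_component hmem hs
    rw [hcoord, mul_left_comm] at h2
    have h3 := pos_of_mul_pos_right h2 hlamp.le
    rcases mul_pos_iff.1 h3 with ⟨h4, h5⟩ | ⟨h4, h5⟩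
    · exact div_pos h4 h5
    · exact div_pos_of_neg_of_neg h4 h5
  set F : ℂ × ℝ → ℂ × ℝ := fun v => φ (f.symm^[n + n'] (φ.symm v)) with hF
  set F' : ℂ × ℝ → ℂ × ℝ := fun v => φ (f^[n + n'] (φ.symm v)) with hF'
  have hsmooth : ∀ (g : M → M), ContMDiff (𝓡 3) (𝓡 3) k g → ∀ v ∈ φ.target, g (φ.symm v) ∈ φ.source →
      ContDiffAt ℝ 1 (fun v => φ (g (φ.symm v))) v := by
    intro g hg v hv hgv
    have h1 : ContMDiffAt 𝓘(ℝ, ℂ × ℝ) 𝓘(ℝ, ℂ × ℝ) k (fun v => φ (g (φ.symm v))) v :=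
      (hφ.contMDiffOn.contMDiffAt (φ.open_source.mem_nhds hgv)).comp v
        (hg.contMDiffAt.comp v (hφ.contMDiffOn_symm.contMDiffAt (φ.open_target.mem_nhds hv)))
    exact (contMDiffAt_iff_contDiffAt.1 h1).of_le hk1
  have hFd : ContDiffAt ℝ 1 F (0, t₀) :=
    hsmooth _ (f.symm.contMDiff.iterate _) _ htgt0 (by rw [hret']; exact hq'b.1)
  have hretz : f^[n + n'] (φ.symm (z₀, 0)) = φ.symm (0, t₀) := by rw [← hq'eq, hret]
  have hF'd : ContDiffAt ℝ 1 F' (z₀, 0) :=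
    hsmooth _ (f.contMDiff.iterate _) _ htgtz (by rw [hretz]; exact φ.map_target htgt0)
  have hinv : ∀ᶠ w in 𝓝 (z₀, (0 : ℝ)), F (F' w) = w := by
    have h1 : ContinuousAt (fun w => f^[n + n'] (φ.symm w)) (z₀, (0 : ℝ)) :=
      (f.toHomeomorph.continuous.iterate (n + n')).continuousAt.comp (φ.continuousAt_symm htgtz)
    have h2 : ∀ᶠ w in 𝓝 (z₀, (0 : ℝ)), f^[n + n'] (φ.symm w) ∈ φ.source := by
      refine h1.eventually (φ.open_source.mem_nhds ?_)
      change f^[n + n'] (φ.symm (z₀, 0)) ∈ φ.source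
      rw [hretz]; exact φ.map_target htgt0
    filter_upwards [h2, φ.open_target.mem_nhds htgtz] with w hw1 hw2
    simp only [hF, hF']
    rw [φ.left_inv hw1]
    have h3 : f.symm^[n + n'] (f^[n + n'] (φ.symm w)) = φ.symm w :=
      (f.toHomeomorph.left_inv.iterate _) _
    rw [h3, φ.right_inv hw2]
  obtain ⟨ξ, hξ, hmodel⟩ := ReturnModel.of_strictFDeriv (F := F) (F' := F') ht₀ne hFd
    (by simp only [hF, hret', hq'eq, φ.right_inv htgtz]) (hF'd.differentiableAt one_ne_zero)
    (by simp only [hF', hretz, φ.right_inv htgt0]) hinv hfold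
  refine ⟨z₀, t₀, ξ, hq'eq, hz₀lt, ?_, ht₀, ht₀ne, hret, hmodel, hξ⟩
  intro h0
  rw [h0, hc.symm_zero] at hq'eq
  have h2 : f^[n] p = p := Function.iterate_fixed hc.fixed n
  exact hqp (by rw [← hback, hq'eq, h2])

end Manifold

/-! ### Conjugacies between saddle-foci with a tangency -/

section

section Manifold

variable {M : Type*} [TopologicalSpace M] [ChartedSpace (EuclideanSpace ℝ (Fin 3)) M] {k : ℕ∞}

theorem IsHomoclinicQuadraticTangency.eventually_mem {f : M ≃ₘ^k⟮𝓡 3, 𝓡 3⟯ M} {p q : M}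
    (hq : IsHomoclinicQuadraticTangency k f p q) {V : Set M} (hV : V ∈ 𝓝 p) :
    (∀ᶠ n : ℕ in atTop, f^[n] q ∈ V) ∧ ∀ᶠ n : ℕ in atTop, f.symm^[n] q ∈ V := by
  obtain ⟨-, α, σ, -, ⟨hα0, -, ε, hε, -, hα⟩, ⟨hσ0, -, ε', hε', -, hσ⟩, -⟩ := hq
  constructor
  · filter_upwards [hα V hV] with n hn
    rw [← hα0]
    exact hn 0 ⟨by linarith, hε⟩
  · filter_upwards [hσ V hV] with n hn
    rw [← hσ0]
    exact hn 0 (Metric.mem_ball_self hε')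

/-- A saddle-focus `p` of `f` with a positively associated homoclinic tangency `q`, together with
linearizing coordinates at `p`. -/
structure LinearizedTangency (k : ℕ∞) (f : M ≃ₘ^k⟮𝓡 3, 𝓡 3⟯ M) (p q : M) (r θ lam : ℝ)
    (φ : OpenPartialHomeomorph M (ℂ × ℝ)) (a : ℝ) : Prop where
  fixed : f p = p
  one_lt : 1 < r
  lam_pos : 0 < lam
  lam_lt : lam < 1
  chart : IsLinearizing k f p r θ lam φ a
  tangency : IsHomoclinicQuadraticTangency k f p q
  assoc : IsPositivelyAssociated k f p q r θ lam

namespace LinearizedTangency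

variable {f f₀ f₁ : M ≃ₘ^k⟮𝓡 3, 𝓡 3⟯ M} {p q p₀ p₁ q₀ q₁ : M} {r θ lam r₀ r₁ θ₀ θ₁ lam₀ lam₁ : ℝ}
  {φ φ₀ φ₁ : OpenPartialHomeomorph M (ℂ × ℝ)} {a a₀ a₁ : ℝ} {h h' : M ≃ₜ M}

theorem saddleChart (D : LinearizedTangency k f p q r θ lam φ a) :
    SaddleChart f.toHomeomorph p (r * Complex.exp (θ * Complex.I)) lam φ a :=
  D.chart.saddleChart D.fixed D.one_lt D.lam_pos D.lam_lt

/-- Two conjugacies give rise to tangency systems, the same for both. -/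
theorem exists_system [T2Space M] (hk : 3 ≤ k)
    (D₀ : LinearizedTangency k f₀ p₀ q₀ r₀ θ₀ lam₀ φ₀ a₀)
    (D₁ : LinearizedTangency k f₁ p₁ q₁ r₁ θ₁ lam₁ φ₁ a₁)
    (hh : IsConjugacy f₀ f₁ p₀ p₁ q₀ q₁ h) (hh' : IsConjugacy f₀ f₁ p₀ p₁ q₀ q₁ h') :
    ∃ S₀ S₁ : TangencySystem M,
      (S₀.r = r₀ ∧ S₀.c = Circle.exp θ₀ ∧ S₀.lam = lam₀ ∧ S₀.φ = φ₀) ∧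
      (S₁.r = r₁ ∧ S₁.c = Circle.exp θ₁ ∧ S₁.lam = lam₁ ∧ S₁.φ = φ₁ ∧ S₁.a = a₁) ∧
      S₀.Conj S₁ h ∧ S₀.Conj S₁ h' := by
  have hsymm : ∀ {g : M ≃ₜ M}, IsConjugacy f₀ f₁ p₀ p₁ q₀ q₁ g → g.symm p₁ = p₀ := fun hg => by
    rw [← hg.2.1, Homeomorph.symm_apply_apply]
  have hnhd₀ : ∀ {g : M ≃ₜ M}, IsConjugacy f₀ f₁ p₀ p₁ q₀ q₁ g → g ⁻¹' φ₁.source ∈ 𝓝 p₀ :=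
    fun {g} hg => g.continuous.continuousAt.preimage_mem_nhds
      (by rw [hg.2.1]; exact φ₁.open_source.mem_nhds D₁.chart.mem_source)
  have hnhd₁ : ∀ {g : M ≃ₜ M}, IsConjugacy f₀ f₁ p₀ p₁ q₀ q₁ g → g.symm ⁻¹' φ₀.source ∈ 𝓝 p₁ :=
    fun {g} hg => g.symm.continuous.continuousAt.preimage_mem_nhds
      (by rw [hsymm hg]; exact φ₀.open_source.mem_nhds D₀.chart.mem_source)
  obtain ⟨δ₀, hδ₀, hδa₀, hbox₀⟩ :=
    D₀.saddleChart.exists_box_subset (inter_mem (hnhd₀ hh) (hnhd₀ hh'))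
  obtain ⟨δ₁, hδ₁, hδa₁, hbox₁⟩ :=
    D₁.saddleChart.exists_box_subset (inter_mem (hnhd₁ hh) (hnhd₁ hh'))
  have m₀ := exists_homoclinicModel D₀.chart D₀.saddleChart hk D₀.tangency.1
    (fun V hV => (D₀.tangency.eventually_mem hV).1) (fun V hV => (D₀.tangency.eventually_mem hV).2)
    D₀.assoc hδ₀ hδa₀
  have m₁ := exists_homoclinicModel D₁.chart D₁.saddleChart hk D₁.tangency.1
    (fun V hV => (D₁.tangency.eventually_mem hV).1) (fun V hV => (D₁.tangency.eventually_mem hV).2)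
    D₁.assoc hδ₁ hδa₁
  obtain ⟨n', hn₀, hn₁⟩ := (m₀.and m₁).exists
  obtain ⟨n, ⟨z, t, ξ, hm₀⟩, ⟨z', t', ξ', hm₁⟩⟩ := (hn₀.and hn₁).exists
  have hmap : ∀ {g : M ≃ₜ M}, IsConjugacy f₀ f₁ p₀ p₁ q₀ q₁ g →
      g (f₀.symm^[n] q₀) = f₁.symm^[n] q₁ := by
    intro g hg
    have h1 : Function.Semiconj g f₀.symm f₁.symm := fun x => by
      rw [← f₁.toEquiv.apply_eq_iff_eq]
      change f₁ (g (f₀.symm x)) = f₁ (f₁.symm (g x))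
      rw [← hg.1, f₀.apply_symm_apply, f₁.apply_symm_apply]
    rw [(h1.iterate_right n).eq, hg.2.2]
  have hconj : ∀ {g : M ≃ₜ M}, IsConjugacy f₀ f₁ p₀ p₁ q₀ q₁ g →
      (∀ x ∈ box φ₀ δ₀, g x ∈ φ₁.source) → (∀ x ∈ box φ₁ δ₁, g.symm x ∈ φ₀.source) →
      TangencySystem.Conj (M := M)
        ⟨f₀.toHomeomorph, p₀, _, r₀, Circle.exp θ₀, lam₀, φ₀, a₀, δ₀, n + n', f₀.symm^[n] q₀, z, t, ξ,
          D₀.saddleChart, hδa₀, hm₀, D₀.one_lt, by rw [Circle.coe_exp]⟩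
        ⟨f₁.toHomeomorph, p₁, _, r₁, Circle.exp θ₁, lam₁, φ₁, a₁, δ₁, n + n', f₁.symm^[n] q₁, z', t',
          ξ', D₁.saddleChart, hδa₁, hm₁, D₁.one_lt, by rw [Circle.coe_exp]⟩ g :=
    fun hg hb₀ hb₁ => ⟨hg.1, hg.2.1, hmap hg, rfl, hb₀, hb₁⟩
  exact ⟨_, _, ⟨rfl, rfl, rfl, rfl⟩, ⟨rfl, rfl, rfl, rfl, rfl⟩,
    hconj hh (fun x hx => (hbox₀ hx).1) fun x hx => (hbox₁ hx).1,
    hconj hh' (fun x hx => (hbox₀ hx).2) fun x hx => (hbox₁ hx).2⟩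

theorem exp_eq_or_eq_conj [T2Space M] (hk : 3 ≤ k)
    (D₀ : LinearizedTangency k f₀ p₀ q₀ r₀ θ₀ lam₀ φ₀ a₀)
    (D₁ : LinearizedTangency k f₁ p₁ q₁ r₁ θ₁ lam₁ φ₁ a₁)
    (hh : IsConjugacy f₀ f₁ p₀ p₁ q₀ q₁ h) (hirr : Irrational (θ₀ / (2 * Real.pi))) :
    Complex.exp (θ₀ * Complex.I) = Complex.exp (θ₁ * Complex.I) ∨
      Complex.exp (θ₀ * Complex.I) = starRingEnd ℂ (Complex.exp (θ₁ * Complex.I)) := by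
  obtain ⟨S₀, S₁, ⟨-, hc₀, -⟩, ⟨-, hc₁, -⟩, H, -⟩ := exists_system hk D₀ D₁ hh hh
  have hd : ∀ x, MapClusterPt x atTop fun n : ℕ => S₀.c ^ n := by
    rw [hc₀]; exact mapClusterPt_circleExp_pow hirr
  rcases H.circle_eq_or_eq_inv hd with h1 | h1
  · left
    rw [hc₀, hc₁] at h1
    rw [← Circle.coe_exp, ← Circle.coe_exp, h1]
  · right
    rw [hc₀, hc₁] at h1
    rw [← Circle.coe_exp, ← Circle.coe_exp, h1, Circle.coe_inv_eq_conj, Complex.conj_conj]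

/-- For coordinates with the same angle, conjugacies are linear near `0` on the unstable disk, with a
factor that does not depend on the conjugacy, since it takes the coordinate of a point on the orbit of
`q₀` to that of its image. -/
theorem exists_linear [T2Space M] (hk : 3 ≤ k)
    (D₀ : LinearizedTangency k f₀ p₀ q₀ r₀ θ lam₀ φ₀ a₀)
    (D₁ : LinearizedTangency k f₁ p₁ q₁ r₁ θ lam₁ φ₁ a₁)
    (hh : IsConjugacy f₀ f₁ p₀ p₁ q₀ q₁ h) (hh' : IsConjugacy f₀ f₁ p₀ p₁ q₀ q₁ h')
    (hirr : Irrational (θ / (2 * Real.pi))) (him : (Complex.exp (θ * Complex.I)).im ≠ 0) :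
    r₀ = r₁ ∧ lam₀ = lam₁ ∧ ∃ L : ℂ, L ≠ 0 ∧ ∃ ε > 0, ∀ z : ℂ, ‖z‖ < ε → ‖L * z‖ < a₁ ∧
      h (φ₀.symm (z, 0)) = φ₁.symm (L * z, 0) ∧ h' (φ₀.symm (z, 0)) = φ₁.symm (L * z, 0) := by
  obtain ⟨S₀, S₁, ⟨hr₀, hc₀, hl₀, hφ₀⟩, ⟨hr₁, hc₁, hl₁, hφ₁, ha₁⟩, H, H'⟩ :=
    exists_system hk D₀ D₁ hh hh'
  have hd : ∀ x, MapClusterPt x atTop fun n : ℕ => S₀.c ^ n := by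
    rw [hc₀]; exact mapClusterPt_circleExp_pow hirr
  have him' : (S₀.c : ℂ).im ≠ 0 := by rwa [hc₀, Circle.coe_exp]
  obtain ⟨er, el, L, hL, hLz, ε, hε, hlin⟩ := H.linear hd (hc₁.trans hc₀.symm) him'
  obtain ⟨-, -, L', -, hLz', ε', hε', hlin'⟩ := H'.linear hd (hc₁.trans hc₀.symm) him'
  obtain rfl : L' = L := mul_right_cancel₀ S₀.model.z₀_ne (hLz'.trans hLz.symm)
  rw [hφ₀, hφ₁, ha₁] at hlin
  rw [hφ₀, hφ₁] at hlin'
  refine ⟨by rw [← hr₀, er, hr₁], by rw [← hl₀, el, hl₁], L', hL, min ε ε', lt_min hε hε',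
    fun z hz => ?_⟩
  obtain ⟨h1, h2⟩ := hlin z (hz.trans_le (min_le_left _ _))
  exact ⟨h2, h1, (hlin' z (hz.trans_le (min_le_right _ _))).1⟩

end LinearizedTangency

end Manifold

variable {M : Type*} [TopologicalSpace M] [T2Space M]

/-- A conjugacy that is linear near `0` on the unstable disk is given by the same linear map at all
points whose image stays in the disk. -/
theorem isLinearConformal_of_local {f₀ f₁ h : M ≃ₜ M} {p₀ p₁ : M} {μ : ℂ} {lam : ℝ}
    {φ₀ φ₁ : OpenPartialHomeomorph M (ℂ × ℝ)} {a₀ a₁ : ℝ} (hφ₀ : SaddleChart f₀ p₀ μ lam φ₀ a₀)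
    (hφ₁ : SaddleChart f₁ p₁ μ lam φ₁ a₁) (hconj : ∀ x, h (f₀ x) = f₁ (h x)) {L : ℂ} (hL : L ≠ 0)
    {ε : ℝ} (hε : 0 < ε)
    (hlin : ∀ z : ℂ, ‖z‖ < ε → ‖L * z‖ < a₁ ∧ h (φ₀.symm (z, 0)) = φ₁.symm (L * z, 0)) :
    IsLinearConformal h φ₀ φ₁ a₁ := by
  refine ⟨‖L‖, L.arg, norm_ne_zero_iff.2 hL, fun x hx => ?_⟩
  rw [Complex.norm_mul_exp_arg_mul_I]
  set z := (φ₀ x).1 with hz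
  have hxz : x = φ₀.symm (z, 0) := by
    rw [hz, ← hx.2, Prod.mk.eta, φ₀.left_inv hx.1]
  have hza : ‖z‖ < a₀ := by
    refine (hφ₀.mem_target (t := 0)).1 ?_ |>.1
    rw [hz, ← hx.2]
    exact φ₀.map_source hx.1
  obtain ⟨n, hn⟩ := exists_inv_pow_mul_mem_ball hφ₀.one_lt hε z
  rw [mem_ball_zero_iff] at hn
  obtain ⟨hnL, hnh⟩ := hlin _ hn
  have hback : f₀.symm^[n] x = φ₀.symm ((μ⁻¹) ^ n * z, 0) := by
    rw [hxz, hφ₀.symm_iterate_symm n hza]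
  have hsemi : Function.Semiconj h f₀ f₁ := hconj
  have hx' : h x = f₁^[n] (φ₁.symm (L * ((μ⁻¹) ^ n * z), 0)) := by
    rw [← hnh, ← hback, ← (hsemi.iterate_right n).eq]
    exact congrArg h ((f₀.right_inv.iterate n) x).symm
  have hμ : μ ^ n * (L * ((μ⁻¹) ^ n * z)) = L * z := by
    rw [inv_pow, mul_left_comm L, ← mul_assoc, mul_inv_cancel₀ (pow_ne_zero _ hφ₀.ne_zero), one_mul]
  have hmem : h x ∈ localUnstable φ₁ → ‖L * z‖ < a₁ ∧ (φ₁ (h x)).1 = L * z := by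
    intro hhx
    set z' := (φ₁ (h x)).1 with hz'
    have hxz' : h x = φ₁.symm (z', 0) := by
      rw [hz', ← hhx.2, Prod.mk.eta, φ₁.left_inv hhx.1]
    have hza' : ‖z'‖ < a₁ := by
      refine (hφ₁.mem_target (t := 0)).1 ?_ |>.1
      rw [hz', ← hhx.2]
      exact φ₁.map_source hhx.1
    have h1 : f₁.symm^[n] (h x) = φ₁.symm (L * ((μ⁻¹) ^ n * z), 0) := by
      rw [hx']; exact (f₁.left_inv.iterate n) _
    rw [hxz', hφ₁.symm_iterate_symm n hza'] at h1
    have h0 : |(0 : ℝ)| < a₁ := by rw [abs_zero]; exact hφ₁.pos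
    have h2 := congrArg Prod.fst (φ₁.symm.injOn
      (hφ₁.mem_target.2 ⟨(hφ₁.norm_inv_pow_mul_le n z').trans_lt hza', h0⟩)
      (hφ₁.mem_target.2 ⟨hnL, h0⟩) h1)
    dsimp only at h2
    have h3 : z' = L * z := by
      rw [← hμ, ← h2, ← mul_assoc, inv_pow, mul_inv_cancel₀ (pow_ne_zero _ hφ₀.ne_zero), one_mul]
    exact ⟨h3 ▸ hza', h3⟩
  refine ⟨⟨fun hhx => (hmem hhx).1, fun hlt => ?_⟩, fun hhx => (hmem hhx).2⟩
  have h0 : |(0 : ℝ)| < a₁ := by rw [abs_zero]; exact hφ₁.pos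
  have htgt : (L * z, (0 : ℝ)) ∈ φ₁.target := hφ₁.mem_target.2 ⟨hlt, h0⟩
  rw [hφ₁.iterate_symm n (by rwa [hμ]) h0, hμ, mul_zero] at hx'
  rw [hx']
  exact ⟨φ₁.map_target htgt, by rw [φ₁.right_inv htgt]⟩

/-- Conjugacies that agree near the fixed point agree on the unstable disk. -/
theorem eqOn_localUnstable_of_local {f₀ f₁ h h' : M ≃ₜ M} {p₀ : M} {μ : ℂ} {lam : ℝ}
    {φ₀ : OpenPartialHomeomorph M (ℂ × ℝ)} {a₀ : ℝ} (hφ₀ : SaddleChart f₀ p₀ μ lam φ₀ a₀)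
    (hconj : ∀ x, h (f₀ x) = f₁ (h x)) (hconj' : ∀ x, h' (f₀ x) = f₁ (h' x)) {ε : ℝ} (hε : 0 < ε)
    (hloc : ∀ z : ℂ, ‖z‖ < ε → h' (φ₀.symm (z, 0)) = h (φ₀.symm (z, 0))) :
    EqOn h' h (localUnstable φ₀) := by
  intro x hx
  obtain ⟨n, hn⟩ := exists_inv_pow_mul_mem_ball hφ₀.one_lt hε (φ₀ x).1
  rw [mem_ball_zero_iff] at hn
  have hback : f₀.symm^[n] x = φ₀.symm ((μ⁻¹) ^ n * (φ₀ x).1, 0) := by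
    rw [← hφ₀.symm_iterate_symm n, ← hx.2, Prod.mk.eta, φ₀.left_inv hx.1]
    refine (hφ₀.mem_target (t := 0)).1 ?_ |>.1
    rw [← hx.2]
    exact φ₀.map_source hx.1
  have hs : Function.Semiconj h f₀ f₁ := hconj
  have hs' : Function.Semiconj h' f₀ f₁ := hconj'
  have hx' : f₀^[n] (f₀.symm^[n] x) = x := (f₀.right_inv.iterate n) x
  rw [← hx', (hs.iterate_right n).eq, (hs'.iterate_right n).eq, hback, hloc _ hn]

end

end SaddleFocus

theorem theoremB {M : Type*} [TopologicalSpace M] [T2Space M] [SecondCountableTopology M]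
    [ChartedSpace (EuclideanSpace ℝ (Fin 3)) M] [IsManifold (𝓡 3) ∞ M]
    (k : ℕ∞) (hk : 3 ≤ k) (f₀ f₁ : M ≃ₘ^k⟮𝓡 3, 𝓡 3⟯ M) (p₀ p₁ q₀ q₁ : M)
    (r₀ r₁ θ₀ θ₁ lam₀ lam₁ : ℝ)
    (hp₀ : SaddleFocus.IsLinearSaddleFocus k f₀ p₀ r₀ θ₀ lam₀)
    (hp₁ : SaddleFocus.IsLinearSaddleFocus k f₁ p₁ r₁ θ₁ lam₁)
    (hq₀ : SaddleFocus.IsHomoclinicQuadraticTangency k f₀ p₀ q₀)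
    (hq₁ : SaddleFocus.IsHomoclinicQuadraticTangency k f₁ p₁ q₁)
    (hpos₀ : SaddleFocus.IsPositivelyAssociated k f₀ p₀ q₀ r₀ θ₀ lam₀)
    (hpos₁ : SaddleFocus.IsPositivelyAssociated k f₁ p₁ q₁ r₁ θ₁ lam₁)
    (h : M ≃ₜ M) (hh : SaddleFocus.IsConjugacy f₀ f₁ p₀ p₁ q₀ q₁ h)
    (hirr : Irrational (θ₀ / (2 * Real.pi))) :
    (lam₀ = lam₁ ∧ r₀ = r₁) ∧
    (∃ φ₀ a₀, SaddleFocus.IsLinearizing k f₀ p₀ r₀ θ₀ lam₀ φ₀ a₀) ∧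
    (∃ φ₁ a₁, SaddleFocus.IsLinearizing k f₁ p₁ r₁ θ₀ lam₁ φ₁ a₁) ∧
    (∀ φ₀ a₀ φ₁ a₁, SaddleFocus.IsLinearizing k f₀ p₀ r₀ θ₀ lam₀ φ₀ a₀ →
      SaddleFocus.IsLinearizing k f₁ p₁ r₁ θ₀ lam₁ φ₁ a₁ →
        SaddleFocus.IsLinearConformal h φ₀ φ₁ a₁ ∧
        ∀ h' : M ≃ₜ M, SaddleFocus.IsConjugacy f₀ f₁ p₀ p₁ q₀ q₁ h' →
          Set.EqOn h' h (SaddleFocus.localUnstable φ₀)) := by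
  obtain ⟨φ₀, a₀, hφ₀⟩ := SaddleFocus.exists_isLinearizing hp₀
  obtain ⟨φ₁, a₁, hφ₁⟩ := SaddleFocus.exists_isLinearizing hp₁
  have him := SaddleFocus.exp_mul_I_im_ne_zero hp₀.2.2.1
  obtain ⟨hfix₀, hr₀, -, hl₀, hl₀', -⟩ := id hp₀
  obtain ⟨hfix₁, hr₁, -, hl₁, hl₁', -⟩ := id hp₁
  have hexp := SaddleFocus.LinearizedTangency.exp_eq_or_eq_conj hk
    ⟨hfix₀, hr₀, hl₀, hl₀', hφ₀, hq₀, hpos₀⟩ ⟨hfix₁, hr₁, hl₁, hl₁', hφ₁, hq₁, hpos₁⟩ hh hirr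
  have hpos₁' := hpos₁.of_exp hexp
  obtain ⟨ψ₁, b₁, hψ₁⟩ := SaddleFocus.exists_isLinearizing_of_exp hp₁ hexp
  obtain ⟨hr, hl, -⟩ := SaddleFocus.LinearizedTangency.exists_linear hk
    ⟨hfix₀, hr₀, hl₀, hl₀', hφ₀, hq₀, hpos₀⟩ ⟨hfix₁, hr₁, hl₁, hl₁', hψ₁, hq₁, hpos₁'⟩ hh hh hirr him
  refine ⟨⟨hl, hr⟩, ⟨φ₀, a₀, hφ₀⟩, ⟨ψ₁, b₁, hψ₁⟩, fun φ₀ a₀ φ₁ a₁ hφ₀ hφ₁ => ?_⟩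
  have D₀ : SaddleFocus.LinearizedTangency k f₀ p₀ q₀ r₀ θ₀ lam₀ φ₀ a₀ :=
    ⟨hfix₀, hr₀, hl₀, hl₀', hφ₀, hq₀, hpos₀⟩
  have D₁ : SaddleFocus.LinearizedTangency k f₁ p₁ q₁ r₁ θ₀ lam₁ φ₁ a₁ :=
    ⟨hfix₁, hr₁, hl₁, hl₁', hφ₁, hq₁, hpos₁'⟩
  have hφ₁' := D₁.saddleChart
  rw [← hr, ← hl] at hφ₁'
  constructor
  · obtain ⟨-, -, L, hL, ε, hε, hlin⟩ := D₀.exists_linear hk D₁ hh hh hirr him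
    exact SaddleFocus.isLinearConformal_of_local D₀.saddleChart hφ₁' hh.1 hL hε
      fun z hz => ⟨(hlin z hz).1, (hlin z hz).2.1⟩
  · intro h' hh'
    obtain ⟨-, -, L, -, ε, hε, hlin⟩ := D₀.exists_linear hk D₁ hh hh' hirr him
    exact SaddleFocus.eqOn_localUnstable_of_local (f₁ := f₁.toHomeomorph) D₀.saddleChart hh.1 hh'.1 hε
      fun z hz => (hlin z hz).2.2.trans (hlin z hz).2.1.symm
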